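/- **Setting.** Let $\mathfrak g$ be one of the following simple complex Lie superalgebras: $\mathfrak{sl}(m|n)$ with $1\le m<n$; $\mathfrak{psl}(n|n)$ with $n\ge 2$; $\mathfrak{osp}(2|2n)$ with $n\ge 2$; $\mathfrak{osp}(1|2n)$ with $n\ge 1$; $D(2,1;\alpha)$ with $\alpha\ne 0,-1$; $F(4)$; $G(3)$. Fix a Cartan subalgebra $\mathfrak h$ and the distinguished Borel subalgebra, and let $\rho$ be its Weyl vector. Let $\lambda\in\mathfrak h^*$ be dominant integral, i.e. the simple highest weight module $L(\lambda)$ is finite-dimensional. Assume that for every integer $k\ge1$ the weight $k\lambda$ is typical, i.e. $(k\lambda+\rho,\beta)\neq0$ for every isotropic positive odd root $\beta$. **The Kus–Fourier polytope.** Let $R^+=R_0^+\sqcup R_1^+$ be the even and odd positive roots (for $\mathfrak{psl}(n|n)$ indexed by those of $\mathfrak{sl}(n|n)$). $P(\lambda)\subset\mathbb R^{R^+}$ consists of the points $s$ with $s_\beta\ge 0$ for all $\beta\in R^+$, $s_\beta\le1$ for $\beta\in R_1^+$, and the following inequalities. * *Type $A_r$ (Dyck paths).* For labels $m_1,\dots,m_r$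 and $\alpha_{i,j}=\alpha_i+\dots+\alpha_j$: for every path from a simple root $\alpha_i=\alpha_{i,i}$ to a simple root $\alpha_j$ with steps $\alpha_{p,q}\to\alpha_{p,q+1}$ or $\alpha_{p,q}\to\alpha_{p+1,q}$, the sum of $s$ along the path is at most $m_i+\dots+m_j$. * *Type $C_n$ (symplectic Dyck paths).* Let $\alpha_{i,j}=\alpha_i+\dots+\alpha_j$ for $1\le i\le j\le n$ and $\alpha_{i,2n-j}=(\alpha_i+\dots+\alpha_n)+(\alpha_{n-1}+\dots+\alpha_j)$ for $1\le i\le j<n$, so that $\alpha_{j,2n-j}=2\delta_j$; paths start at a simple root, have the same steps, and stay in the set of positive roots. For every path from $\alpha_i$ to $\alpha_j$ the sum is at most $m_i+\dots+m_j$, and for every path from $\alpha_i$ to $2\delta_j$ the sum is at most $m_i+\dots+m_n$. * $\mathfrak{sl}(m|n)$, $\mathfrak{psl}(n|n)$: the type $A_{m-1}$ and type $A_{n-1}$ inequalities for the even roots, with the labels of $\lambda$ on the two factors of $\mathfrak{sl}_m\oplus\mathfrak{sl}_n$. * $\mathfrak{osp}(2|2n)$: the type $C_n$ inequalities for the even roots,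 with the labels of $\lambda$ on $\mathfrak{sp}_{2n}$. * $\mathfrak{osp}(1|2n)$ (orthosymplectic Dyck paths): the type $C_n$ inequalities for the even roots with the labels of $\lambda$ on $\mathfrak{sp}_{2n}$, where for paths ending at $2\delta_j$ the summand $s_{\delta_j}$ of the odd root $\delta_j$ is added to the sum. * $D(2,1;\alpha)$, with even part $\mathfrak{sl}_2^{\oplus3}$ and even positive roots $2\varepsilon_1,2\varepsilon_2,2\varepsilon_3$, odd simple root $\varepsilon_1-\varepsilon_2-\varepsilon_3$: $s_{2\varepsilon_i}\le\lambda((2\varepsilon_i)^\vee)$ for $i=2,3$, and $s_\theta+\sum_{\beta\in R_1^+}s_\beta\le\lambda(\theta^\vee)$ with $\theta=2\varepsilon_1$. * $G(3)$, with even part $\mathfrak{sl}_2\oplus G_2$: $s_\theta+\sum_{\beta\in R_1^+}s_\beta\le\lambda(\theta^\vee)$, where $\theta$ is the positive root of $\mathfrak{sl}_2$, together with, for the positive roots $i\alpha_1+j\alpha_2$ of $G_2$ ($\alpha_1$ short, coordinate $s_{ij}$, labels $m_1,m_2$): $s_{10}\le m_1$, $s_{01}\le m_2$, $s_{31}+s_{21}+s_{10}\le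 m_1+m_2$, $s_{21}+s_{11}+s_{10}\le m_1+m_2$, $s_{11}+s_{01}+s_{10}\le m_1+m_2$, $s_{32}+s_{31}+s_{21}+s_{11}+s_{01}\le m_1+2m_2$, $s_{31}+s_{21}+s_{11}+s_{01}+s_{10}\le m_1+2m_2$. * $F(4)$, with even part $\mathfrak{sl}_2\oplus\mathfrak{so}_7$: $s_\theta+\sum_{\beta\in R_1^+}s_\beta\le\lambda(\theta^\vee)$, where $\theta$ is the positive root of $\mathfrak{sl}_2$, together with, for $\mathfrak{so}_7$ with simple roots $\alpha_1=\varepsilon_1-\varepsilon_2$, $\alpha_2=\varepsilon_2-\varepsilon_3$, $\alpha_3=\varepsilon_3$, labels $m_1,m_2,m_3$, and coordinates $x_{ij}$ at $\alpha_i+\dots+\alpha_j$ and $y_{ij}$ at $\varepsilon_i+\varepsilon_j$: 1. $x_{11}\le m_1$, $x_{22}\le m_2$, $x_{33}\le m_3$, $x_{11}+x_{12}+x_{22}\le m_1+m_2$; 2. $x_{22}+x_{23}+x_{33}$ and $x_{23}+y_{23}+x_{33}$ are at most $m_2+m_3$; 3. $x_{11}+x_{12}+x_{13}+x_{22}+x_{33}$,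 $x_{11}+x_{13}+x_{22}+x_{23}+x_{33}$, $x_{11}+x_{13}+y_{13}+x_{23}+x_{33}$ and $x_{11}+y_{13}+x_{23}+y_{23}+x_{33}$ are at most $m_1+m_2+m_3$; 4. $x_{11}+x_{12}+x_{13}+y_{13}+x_{22}+x_{23}+x_{33}$, $x_{11}+x_{12}+y_{13}+x_{22}+x_{23}+y_{23}+x_{33}$, $x_{12}+x_{13}+y_{13}+y_{12}+x_{22}+x_{23}+x_{33}$, $x_{12}+y_{13}+y_{12}+x_{22}+x_{23}+y_{23}+x_{33}$ and $x_{11}+x_{12}+x_{13}+2x_{22}+x_{23}+x_{33}$ are at most $m_1+2m_2+m_3$; 5. $x_{11}+x_{13}+y_{13}+x_{22}+2x_{23}+y_{23}+2x_{33}$, $x_{11}+x_{12}+x_{13}+y_{13}+x_{22}+x_{23}+y_{23}+2x_{33}$ and $x_{12}+x_{13}+y_{13}+y_{12}+x_{22}+x_{23}+y_{23}+2x_{33}$ are at most $m_1+2m_2+2m_3$; 6. $x_{11}+x_{12}+x_{13}+y_{13}+2x_{22}+2x_{23}+y_{23}+2x_{33}$ and $x_{12}+x_{13}+y_{13}+y_{12}+2x_{22}+2x_{23}+y_{23}+2x_{33}$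 are at most $m_1+3m_2+2m_3$. Let $S(\lambda)$ be the set of lattice points of $P(\lambda)$, written as pairs $(I,\mathbf m)$ with $I\subseteq R_1^+$ and $\mathbf m\in\mathbb Z_{\ge0}^{R_0^+}$. In the free commutative superalgebra over $\mathbb C$ on even variables $x_\beta$ $(\beta\in R_0^+)$, $v$ and odd variables $\xi_\beta$ $(\beta\in R_1^+)$, let $$A=\mathbb C[\xi^Ix^{\mathbf m}v\mid(I,\mathbf m)\in S(\lambda)]$$ be the subalgebra generated by the monomials $\xi^Ix^{\mathbf m}v$. **Supervarieties.** For a commutative superalgebra $B$ let $K(B)$ be its localization at the even non-zero-divisors, and $J_B$ the preimage in $B$ of the ideal of $K(B)$ generated by the odd elements. $B$ is *reduced* if $J_B$ is the set of nilpotent elements and the zero-divisors of $B/J_B$ are exactly the images of the zero-divisors of $B$; it is *fermionically regular* if $B\cong\bigwedge_RM$ as a superring for a module $M$ over a commutative ring $R$. A superscheme $X$ is reduced if $\mathcal O_X(U)$ is reduced for all affine open $U$, and generically fermionically regular if the points with fermionically regular stalks are dense. A *supervariety* is a reduced, generically fermionically regular, separated superscheme of finite type over $\mathbb C$. A *supertorus*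 is an algebraic supergroup $T$ given by a Harish-Chandra pair $(T_0,\mathfrak t)$ with $T_0\cong(\mathbb C^\times)^p$ and $[\mathfrak t_0,\mathfrak t]=0$. A *faithful toric supervariety* is an irreducible supervariety $X$ with a left action of a supertorus $T$ and a $T$-equivariant open immersion $T\to X$. **Claim.** The superscheme $\operatorname{Spec}A$ is a faithful toric supervariety. -/

import Mathlib

open scoped BigOperators

noncomputable section

namespace SuperToric

universe u

/-! ### Supercommutative superalgebras over `ℂ` -/

/-- A commutative superalgebra over `ℂ`: a decomposition `A = A₀ ⊕ A₁` with
`A_i A_j ⊆ A_{i+j}` and `a b = (-1)^{|a||b|} b a` for homogeneous `a`, `b`. -/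
class SuperCommAlgebra (A : Type*) [Ring A] [Algebra ℂ A] where
  part : ZMod 2 → Submodule ℂ A
  isCompl : IsCompl (part 0) (part 1)
  one_mem : (1 : A) ∈ part 0
  mul_mem : ∀ {i j : ZMod 2} {a b : A}, a ∈ part i → b ∈ part j → a * b ∈ part (i + j)
  comm : ∀ {i j : ZMod 2} {a b : A}, a ∈ part i → b ∈ part j →
    a * b = (-1 : ℂ) ^ (i.val * j.val) • (b * a)

section Algebra

variable (A : Type*) [Ring A] [Algebra ℂ A] [SuperCommAlgebra A]

abbrev part (i : ZMod 2) : Submodule ℂ A := SuperCommAlgebra.part i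

/-- The even part `A₀`, a commutative ring. -/
def evenSub : Subalgebra ℂ A where
  carrier := part A 0
  mul_mem' {a b} ha hb := by
    have h := SuperCommAlgebra.mul_mem (A := A) (i := 0) (j := 0) ha hb
    rwa [add_zero] at h
  add_mem' ha hb := (part A 0).add_mem ha hb
  algebraMap_mem' r := by
    rw [Algebra.algebraMap_eq_smul_one]
    exact (part A 0).smul_mem r SuperCommAlgebra.one_mem

variable {A} in
theorem even_comm {a : A} (ha : a ∈ part A 0) (b : A) : a * b = b * a := by
  have hb : b ∈ part A 0 ⊔ part A 1 := by
    rw [(SuperCommAlgebra.isCompl (A := A)).sup_eq_top]; trivial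
  obtain ⟨b₀, h₀, b₁, h₁, rfl⟩ := Submodule.mem_sup.1 hb
  have e₀ := SuperCommAlgebra.comm (A := A) ha h₀
  have e₁ := SuperCommAlgebra.comm (A := A) ha h₁
  simp only [ZMod.val_zero, zero_mul, pow_zero, one_smul] at e₀ e₁
  rw [mul_add, add_mul, e₀, e₁]

instance evenCommRing : CommRing (evenSub A) :=
  { (inferInstance : Ring (evenSub A)) with
    mul_comm := fun a b => Subtype.ext (even_comm a.2 b.1) }

/-- `A` is an algebra over its (central) even part. -/
instance evenAlgebra : Algebra (evenSub A) A where
  smul r a := r.1 * a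
  algebraMap := (evenSub A).val.toRingHom
  commutes' r a := even_comm r.2 a
  smul_def' _ _ := rfl

/-- The topological space underlying the affine superscheme `Spec A`. -/
abbrev SpecTop : Type _ := PrimeSpectrum (evenSub A)

variable {A} in
/-- The homogeneous part of degree `i` of a localization `S⁻¹A`, with `S ⊆ A₀`. -/
def locPart (S : Submonoid (evenSub A)) (i : ZMod 2) : Set (LocalizedModule S A) :=
  {x | ∃ a ∈ part A i, ∃ s : S, x = LocalizedModule.mk a s}

variable {A} in
/-- The natural map `A → S⁻¹A`. -/
def toLoc (S : Submonoid (evenSub A)) : A →+* LocalizedModule S A where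
  toFun a := LocalizedModule.mk a 1
  map_one' := OreLocalization.one_def.symm
  map_mul' a b := by rw [LocalizedModule.mk_mul_mk, one_mul]
  map_zero' := LocalizedModule.zero_mk 1
  map_add' a b := by rw [LocalizedModule.mk_add_mk]; simp

/-- The stalk of the structure sheaf of `Spec A` at a point. -/
abbrev Stalk (x : SpecTop A) : Type _ := LocalizedModule x.asIdeal.primeCompl A

/-! ### Reduced and fermionically regular superrings -/

/-- The even non-zero-divisors. -/
def nonzdiv : Submonoid (evenSub A) where
  carrier := {s | ∀ a : A, s.1 * a = 0 → a = 0}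
  one_mem' a h := by simpa using h
  mul_mem' {s t} hs ht a h := ht a (hs _ (by simpa [mul_assoc] using h))

/-- The total superring of fractions `K(A)`. -/
abbrev FractionSuperring : Type _ := LocalizedModule (nonzdiv A) A

/-- The ideal `J_A`, the preimage in `A` of the ideal of `K(A)` generated by `K(A)₁`. -/
def bodyIdeal : TwoSidedIdeal A :=
  TwoSidedIdeal.comap (toLoc (nonzdiv A)) (TwoSidedIdeal.span (locPart (nonzdiv A) 1))

/-- The zero-divisors of a ring. -/
def zdiv (R : Type*) [Ring R] : Set R := {a | ∃ b : R, b ≠ 0 ∧ (a * b = 0 ∨ b * a = 0)}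

/-- A superring is reduced if `J_A` is the set of nilpotent elements and the zero-divisors of the
underlying ring `A / J_A` are exactly the classes of the zero-divisors of `A`. -/
def IsReducedSuperring : Prop :=
  (∀ a : A, a ∈ bodyIdeal A ↔ IsNilpotent a) ∧
    (bodyIdeal A).ringCon.mk' '' zdiv A = zdiv (bodyIdeal A).ringCon.Quotient

end Algebra

/-- A superring `B` with homogeneous parts `P 0`, `P 1` is fermionically regular if it is an
exterior algebra `⋀ M` of a module over a commutative ring, with its parity grading. -/
def IsFermionicallyRegular (B : Type u) [Ring B] (P : ZMod 2 → Set B) : Prop :=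
  ∃ (R M : Type u) (_ : CommRing R) (_ : AddCommGroup M) (_ : Module R M)
    (e : B ≃+* ExteriorAlgebra R M),
    ∀ (i : ZMod 2) (b : B),
      b ∈ P i ↔ e b ∈ CliffordAlgebra.evenOdd (0 : QuadraticForm R M) i

/-! ### Morphisms of affine superschemes -/

/-- Even homomorphisms of superalgebras `A → B`, that is, morphisms `Spec B → Spec A`. -/
structure SuperHom (A B : Type*) [Ring A] [Algebra ℂ A] [SuperCommAlgebra A]
    [Ring B] [Algebra ℂ B] [SuperCommAlgebra B] extends A →ₐ[ℂ] B where
  map_part : ∀ (i : ZMod 2) (a : A), a ∈ part A i → toFun a ∈ part B i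

namespace SuperHom

variable {A B : Type*} [Ring A] [Algebra ℂ A] [SuperCommAlgebra A]
  [Ring B] [Algebra ℂ B] [SuperCommAlgebra B] (φ : SuperHom A B)

/-- The induced homomorphism `A₀ → B₀`. -/
def even : evenSub A →+* evenSub B where
  toFun a := ⟨φ.toAlgHom a.1, φ.map_part 0 a.1 a.2⟩
  map_one' := Subtype.ext (map_one φ.toAlgHom)
  map_mul' a b := Subtype.ext (map_mul φ.toAlgHom a.1 b.1)
  map_zero' := Subtype.ext (map_zero φ.toAlgHom)
  map_add' a b := Subtype.ext (map_add φ.toAlgHom a.1 b.1)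

/-- The continuous map `|Spec B| → |Spec A|`. -/
def specMap : SpecTop B → SpecTop A := PrimeSpectrum.comap φ.even

/-- The map of stalks at a point `y` of `Spec B`, sending `a / s` to `φ a / φ s`. -/
def stalkMap (y : SpecTop B) (z : Stalk A (φ.specMap y)) : Stalk B y :=
  LocalizedModule.liftOn z
    (fun p => LocalizedModule.mk (φ.toAlgHom p.1)
      (⟨φ.even p.2.1, fun h => p.2.2 h⟩ : y.asIdeal.primeCompl))
    (by
      rintro ⟨a, s⟩ ⟨b, t⟩ ⟨w, hw⟩
      rw [LocalizedModule.mk_eq]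
      refine ⟨⟨φ.even w.1, fun h => w.2 h⟩, ?_⟩
      have h : w.1.1 * (t.1.1 * a) = w.1.1 * (s.1.1 * b) := hw
      have h' := congrArg φ.toAlgHom h
      simp only [map_mul] at h'
      exact h')

/-- `Spec B → Spec A` is an open immersion: an open embedding of spaces that is an isomorphism on
all stalks. -/
def IsOpenImmersion : Prop :=
  Topology.IsOpenEmbedding φ.specMap ∧ ∀ y : SpecTop B, Function.Bijective (φ.stalkMap y)

end SuperHom

/-! ### Affine supervarieties -/

section Variety

variable (A : Type u) [Ring A] [Algebra ℂ A] [SuperCommAlgebra A]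

/-- `Spec A` is reduced: `𝒪(U)` is a reduced superring for every affine open `U`. The affine open
sub-superschemes `U` are the open immersions `Spec B → Spec A`, and then `𝒪(U) = B`. -/
def SpecIsReduced : Prop :=
  ∀ (B : Type u) [Ring B] [Algebra ℂ B] [SuperCommAlgebra B] (φ : SuperHom A B),
    φ.IsOpenImmersion → IsReducedSuperring B

/-- `Spec A` is generically fermionically regular: the points with fermionically regular stalk
contain a dense set. -/
def SpecIsGFR : Prop :=
  ∃ Z : Set (SpecTop A), Dense Z ∧
    ∀ x ∈ Z, IsFermionicallyRegular (Stalk A x) (locPart x.asIdeal.primeCompl)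

/-- `Spec A` is an irreducible algebraic supervariety over `ℂ`. -/
structure IsIrreducibleSupervariety : Prop where
  irreducible : IrreducibleSpace (SpecTop A)
  reduced : SpecIsReduced A
  gfr : SpecIsGFR A
  finiteType : Algebra.FiniteType ℂ A
  /-- The diagonal is a closed immersion, so that `Spec A` is separated. -/
  separated : Function.Surjective (LinearMap.mul' ℂ A)

end Variety

/-! ### Superalgebras of (Laurent) polynomials in even and odd variables -/

/-- The superalgebra with even monomials `x^m`, `m ∈ M`, and odd variables `ξ_i`, `i ∈ ι`:
formal combinations of the `x^m` with coefficients in the exterior algebra on the `ξ_i`. It is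
`ℂ[x₁,…,x_n,ξ₁,…,ξ_q]` for `M = ℕⁿ` and `ℂ[t₁^±,…,t_p^±,ξ₁,…,ξ_q]` for `M = ℤᵖ`. -/
abbrev SuperPoly (M ι : Type*) : Type _ := AddMonoidAlgebra (ExteriorAlgebra ℂ (ι → ℂ)) M

section SuperPoly

variable {ι : Type*}

theorem ι_mul_eq (v : ι → ℂ) (x : ExteriorAlgebra ℂ (ι → ℂ)) :
    ExteriorAlgebra.ι ℂ v * x = CliffordAlgebra.involute x * ExteriorAlgebra.ι ℂ v := by
  induction x using CliffordAlgebra.induction with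
  | algebraMap r => rw [AlgHom.commutes]; exact (Algebra.commutes r _).symm
  | ι w =>
    rw [CliffordAlgebra.involute_ι, neg_mul]
    exact eq_neg_of_add_eq_zero_left (ExteriorAlgebra.ι_add_mul_swap v w)
  | mul a b ha hb => rw [← mul_assoc, ha, mul_assoc, hb, map_mul, mul_assoc]
  | add a b ha hb => rw [mul_add, ha, hb, map_add, add_mul]

/-- The even and odd elements of the exterior algebra. -/
abbrev extPart (ι : Type*) (i : ZMod 2) : Submodule ℂ (ExteriorAlgebra ℂ (ι → ℂ)) :=
  CliffordAlgebra.evenOdd (0 : QuadraticForm ℂ (ι → ℂ)) i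

theorem even_central {a : ExteriorAlgebra ℂ (ι → ℂ)} (ha : a ∈ extPart ι 0)
    (x : ExteriorAlgebra ℂ (ι → ℂ)) : a * x = x * a := by
  induction a, ha using CliffordAlgebra.even_induction with
  | algebraMap r => exact Algebra.commutes r x
  | add _ _ _ _ ha hb => rw [add_mul, mul_add, ha, hb]
  | ι_mul_ι_mul v w y _ hy =>
    have h₁ := ι_mul_eq v
    have h₂ := ι_mul_eq w
    change ∀ x, CliffordAlgebra.ι 0 v * x = _ at h₁
    change ∀ x, CliffordAlgebra.ι 0 w * x = _ at h₂
    rw [mul_assoc, hy, ← mul_assoc, mul_assoc (CliffordAlgebra.ι 0 v), h₂, ← mul_assoc, h₁,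
      CliffordAlgebra.involute_involute, mul_assoc, mul_assoc, mul_assoc]

theorem odd_mul_eq {a : ExteriorAlgebra ℂ (ι → ℂ)} (ha : a ∈ extPart ι 1)
    (x : ExteriorAlgebra ℂ (ι → ℂ)) : a * x = CliffordAlgebra.involute x * a := by
  induction a, ha using CliffordAlgebra.odd_induction with
  | ι v => exact ι_mul_eq v x
  | add _ _ _ _ ha hb => rw [add_mul, mul_add, ha, hb]
  | ι_mul_ι_mul v w y _ hy =>
    have h₁ := ι_mul_eq v
    have h₂ := ι_mul_eq w
    change ∀ x, CliffordAlgebra.ι 0 v * x = _ at h₁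
    change ∀ x, CliffordAlgebra.ι 0 w * x = _ at h₂
    rw [mul_assoc, hy, ← mul_assoc, mul_assoc (CliffordAlgebra.ι 0 v), h₂, ← mul_assoc, h₁,
      CliffordAlgebra.involute_involute, mul_assoc, mul_assoc, mul_assoc]

theorem ext_comm {i j : ZMod 2} {a b : ExteriorAlgebra ℂ (ι → ℂ)} (ha : a ∈ extPart ι i)
    (hb : b ∈ extPart ι j) : a * b = (-1 : ℂ) ^ (i.val * j.val) • (b * a) := by
  have key : ∀ k : ZMod 2, k = 0 ∨ k = 1 := by decide
  obtain rfl | rfl := key i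
  · simpa using even_central ha b
  · obtain rfl | rfl := key j
    · simpa using (even_central hb a).symm
    · have h := odd_mul_eq ha b
      rw [CliffordAlgebra.involute_eq_of_mem_odd hb] at h
      simpa [ZMod.val_one] using h

end SuperPoly

section SuperPolyParts

variable (M ι : Type*)

/-- The elements of `SuperPoly M ι` all of whose coefficients have parity `i`. -/
def polyPart (i : ZMod 2) : Submodule ℂ (SuperPoly M ι) where
  carrier := {f | ∀ m, f.coeff m ∈ extPart ι i}
  zero_mem' m := by simp
  add_mem' hf hg m := by simpa using add_mem (hf m) (hg m)
  smul_mem' c f hf m := by simpa using Submodule.smul_mem _ c (hf m)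

variable {M ι} in
theorem single_mem_polyPart {i : ZMod 2} {c : ExteriorAlgebra ℂ (ι → ℂ)} (hc : c ∈ extPart ι i)
    (m : M) : (AddMonoidAlgebra.single m c : SuperPoly M ι) ∈ polyPart M ι i := by
  classical
  intro m'
  rw [AddMonoidAlgebra.coeff_single, Finsupp.single_apply]
  split_ifs
  · exact hc
  · exact zero_mem _

variable {M ι} in
theorem polyPart_induction {i : ZMod 2} {p : SuperPoly M ι → Prop} {f : SuperPoly M ι}
    (hf : f ∈ polyPart M ι i) (h0 : p 0) (hadd : ∀ f g, p f → p g → p (f + g))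
    (hs : ∀ (m : M) (c : ExteriorAlgebra ℂ (ι → ℂ)), c ∈ extPart ι i →
      p (AddMonoidAlgebra.single m c)) : p f := by
  classical
  have hsum : f = ∑ m ∈ f.coeff.support, AddMonoidAlgebra.single m (f.coeff m) := by
    have := AddMonoidAlgebra.sum_coeff_single f
    exact this.symm
  rw [hsum]
  exact Finset.sum_induction _ p hadd h0 fun m _ => hs m _ (hf m)

instance superPoly [AddCommMonoid M] : SuperCommAlgebra (SuperPoly M ι) where
  part := polyPart M ι
  isCompl := by
    have hc := CliffordAlgebra.evenOdd_isCompl (Q := (0 : QuadraticForm ℂ (ι → ℂ)))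
    refine ⟨?_, ?_⟩
    · rw [Submodule.disjoint_def]
      intro f h₀ h₁
      ext m
      exact (Submodule.disjoint_def.1 hc.disjoint) _ (h₀ m) (h₁ m)
    · rw [codisjoint_iff, eq_top_iff]
      rintro f -
      induction f using AddMonoidAlgebra.induction_linear with
      | zero => exact zero_mem _
      | add f g hf hg => exact add_mem hf hg
      | single m c =>
        have hcm : c ∈ extPart ι 0 ⊔ extPart ι 1 := by rw [hc.sup_eq_top]; trivial
        obtain ⟨c₀, h₀, c₁, h₁, rfl⟩ := Submodule.mem_sup.1 hcm
        rw [AddMonoidAlgebra.single_add]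
        exact Submodule.add_mem_sup (single_mem_polyPart h₀ m) (single_mem_polyPart h₁ m)
  one_mem := single_mem_polyPart (Submodule.one_le.1 (CliffordAlgebra.one_le_evenOdd_zero _)) 0
  mul_mem {i j a b} ha hb := by
    refine polyPart_induction (p := fun f => f * b ∈ polyPart M ι (i + j)) ha ?_ ?_
      fun m c hc => ?_
    · rw [zero_mul]; exact zero_mem _
    · intro f g hf hg; beta_reduce at hf hg ⊢; rw [add_mul]; exact add_mem hf hg
    · refine polyPart_induction
        (p := fun g => AddMonoidAlgebra.single m c * g ∈ polyPart M ι (i + j)) hb ?_ ?_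
        fun n d hd => ?_
      · rw [mul_zero]; exact zero_mem _
      · intro f g hf hg; beta_reduce at hf hg ⊢; rw [mul_add]; exact add_mem hf hg
      · rw [AddMonoidAlgebra.single_mul_single]
        exact single_mem_polyPart (SetLike.mul_mem_graded hc hd) _
  comm {i j a b} ha hb := by
    refine polyPart_induction
      (p := fun f => f * b = (-1 : ℂ) ^ (i.val * j.val) • (b * f)) ha ?_ ?_ fun m c hc => ?_
    · rw [zero_mul, mul_zero, smul_zero]
    · intro f g hf hg; beta_reduce at hf hg ⊢; rw [add_mul, mul_add, hf, hg, smul_add]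
    · refine polyPart_induction (p := fun g => AddMonoidAlgebra.single m c * g =
        (-1 : ℂ) ^ (i.val * j.val) • (g * AddMonoidAlgebra.single m c)) hb ?_ ?_
        fun n d hd => ?_
      · rw [zero_mul, mul_zero, smul_zero]
      · intro f g hf hg; beta_reduce at hf hg ⊢; rw [add_mul, mul_add, hf, hg, smul_add]
      · rw [AddMonoidAlgebra.single_mul_single, AddMonoidAlgebra.single_mul_single,
          AddMonoidAlgebra.smul_single, ext_comm hc hd, add_comm]

end SuperPolyParts

/-- A subalgebra generated by homogeneous elements is again a commutative superalgebra. -/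
abbrev adjoinSuper {A : Type*} [Ring A] [Algebra ℂ A] [SuperCommAlgebra A] (G : Set A)
    (hG : ∀ g ∈ G, ∃ i, g ∈ part A i) : SuperCommAlgebra (Algebra.adjoin ℂ G) where
  part i := (part A i).comap (Algebra.adjoin ℂ G).val.toLinearMap
  isCompl := by
    have hc := SuperCommAlgebra.isCompl (A := A)
    refine ⟨?_, ?_⟩
    · rw [Submodule.disjoint_def]
      intro x h₀ h₁
      exact Subtype.ext ((Submodule.disjoint_def.1 hc.disjoint) _ h₀ h₁)
    · rw [codisjoint_iff, eq_top_iff]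
      rintro ⟨x, hx⟩ -
      suffices h : ∃ x₀ ∈ part A 0, ∃ x₁ ∈ part A 1, x₀ ∈ Algebra.adjoin ℂ G ∧
          x₁ ∈ Algebra.adjoin ℂ G ∧ x = x₀ + x₁ by
        obtain ⟨x₀, h₀, x₁, h₁, k₀, k₁, rfl⟩ := h
        exact Submodule.mem_sup.2 ⟨⟨x₀, k₀⟩, h₀, ⟨x₁, k₁⟩, h₁, rfl⟩
      induction hx using Algebra.adjoin_induction with
      | mem x hx =>
        obtain ⟨i, hi⟩ := hG x hx
        have key : ∀ k : ZMod 2, k = 0 ∨ k = 1 := by decide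
        obtain rfl | rfl := key i
        · exact ⟨x, hi, 0, zero_mem _, Algebra.subset_adjoin hx, zero_mem _, (add_zero x).symm⟩
        · exact ⟨0, zero_mem _, x, hi, zero_mem _, Algebra.subset_adjoin hx, (zero_add x).symm⟩
      | algebraMap r =>
        exact ⟨_, (evenSub A).algebraMap_mem r, 0, zero_mem _, Subalgebra.algebraMap_mem _ r,
          zero_mem _, (add_zero _).symm⟩
      | add x y _ _ hx hy =>
        obtain ⟨x₀, h₀, x₁, h₁, k₀, k₁, rfl⟩ := hx
        obtain ⟨y₀, h₀', y₁, h₁', k₀', k₁', rfl⟩ := hy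
        exact ⟨_, add_mem h₀ h₀', _, add_mem h₁ h₁', add_mem k₀ k₀', add_mem k₁ k₁',
          add_add_add_comm _ _ _ _⟩
      | mul x y _ _ hx hy =>
        obtain ⟨x₀, h₀, x₁, h₁, k₀, k₁, rfl⟩ := hx
        obtain ⟨y₀, h₀', y₁, h₁', k₀', k₁', rfl⟩ := hy
        refine ⟨x₀ * y₀ + x₁ * y₁, add_mem ?_ ?_, x₀ * y₁ + x₁ * y₀, add_mem ?_ ?_,
          add_mem (mul_mem k₀ k₀') (mul_mem k₁ k₁'), add_mem (mul_mem k₀ k₁') (mul_mem k₁ k₀'), ?_⟩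
        · exact SuperCommAlgebra.mul_mem (i := 0) (j := 0) h₀ h₀'
        · exact SuperCommAlgebra.mul_mem (i := 1) (j := 1) h₁ h₁'
        · exact SuperCommAlgebra.mul_mem (i := 0) (j := 1) h₀ h₁'
        · exact SuperCommAlgebra.mul_mem (i := 1) (j := 0) h₁ h₀'
        · simp only [mul_add, add_mul]; abel
  one_mem := SuperCommAlgebra.one_mem (A := A)
  mul_mem ha hb := SuperCommAlgebra.mul_mem (A := A) ha hb
  comm ha hb := Subtype.ext (SuperCommAlgebra.comm (A := A) ha hb)

section Monomial

variable {E O : Type}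

/-- The odd variable `ξ_o`. -/
def xi (o : O) : ExteriorAlgebra ℂ (O → ℂ) := by
  classical exact ExteriorAlgebra.ι ℂ (Pi.single o 1)

/-- The monomial `ξ^I x^m v` in the even variables `x_e` (`e ∈ E`), `v` and the odd variables
`ξ_o` (`o ∈ O`). The `ξ_o` are multiplied in an arbitrary fixed order, which only affects the
sign. -/
def monomial (I : Finset O) (m : E → ℕ) : SuperPoly ((E → ℕ) × ℕ) O :=
  AddMonoidAlgebra.single (m, 1) (I.toList.map xi).prod

/-- The generators `ξ^I x^m v`, `(I, m) ∈ S`. -/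
def generators (S : Set (Finset O × (E → ℕ))) : Set (SuperPoly ((E → ℕ) × ℕ) O) :=
  {f | ∃ s ∈ S, f = monomial s.1 s.2}

theorem generators_homogeneous (S : Set (Finset O × (E → ℕ))) :
    ∀ g ∈ generators S, ∃ i, g ∈ part (SuperPoly ((E → ℕ) × ℕ) O) i := by
  rintro _ ⟨⟨I, m⟩, -, rfl⟩
  suffices h : ∀ l : List O, ∃ i, (l.map xi).prod ∈ extPart O i by
    obtain ⟨i, hi⟩ := h I.toList
    exact ⟨i, single_mem_polyPart hi _⟩
  intro l
  induction l with
  | nil => exact ⟨0, Submodule.one_le.1 (CliffordAlgebra.one_le_evenOdd_zero _)⟩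
  | cons o l ih =>
    obtain ⟨i, hi⟩ := ih
    exact ⟨1 + i, SetLike.mul_mem_graded (CliffordAlgebra.ι_mem_evenOdd_one _ _) hi⟩

/-- The monomial superalgebra `ℂ[ξ^I x^m v | (I, m) ∈ S]`. -/
abbrev MonomialSuperalgebra (S : Set (Finset O × (E → ℕ))) : Type :=
  Algebra.adjoin ℂ (generators S)

instance monomialSuper (S : Set (Finset O × (E → ℕ))) :
    SuperCommAlgebra (MonomialSuperalgebra S) :=
  adjoinSuper (generators S) (generators_homogeneous S)

end Monomial

/-! ### Supertori and toric supervarieties -/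

/-- A supertorus, as a Harish-Chandra pair `(T₀, 𝔱)` with `T₀ = (ℂˣ)ᵖ` and `[𝔱₀, 𝔱] = 0`: then
`𝔱₀ = ℂᵖ`, `𝔱₁` has a basis `θ₁, …, θ_q` on which `T₀` acts trivially, and the pair is given by the
elements `[θ_i, θ_j] ∈ 𝔱₀`. The super Jacobi identity holds automatically. -/
structure Supertorus where
  p : ℕ
  q : ℕ
  bracket : Fin q → Fin q → Fin p → ℂ
  bracket_symm : ∀ i j, bracket i j = bracket j i

/-- The character `t ↦ t^m` of `(ℂˣ)ᵖ`. -/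
def torusChar {p : ℕ} (m : Fin p → ℤ) (t : Fin p → ℂˣ) : ℂ := ∏ k, ((t k ^ m k : ℂˣ) : ℂ)

/-- The pairing of a weight `m ∈ ℤᵖ` with `x ∈ 𝔱₀ = ℂᵖ`. -/
def weightPairing {p : ℕ} (m : Fin p → ℤ) (x : Fin p → ℂ) : ℂ := ∑ k, (m k : ℂ) * x k

namespace Supertorus

variable (T : Supertorus)

/-- The coordinate superalgebra `ℂ[T] = ℂ[t₁^±, …, t_p^±, ξ₁, …, ξ_q]`. -/
abbrev Coord : Type := SuperPoly (Fin T.p → ℤ) (Fin T.q)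

/-- Left translation by `t ∈ T₀` on functions on `T`: `(t · f)(x) = f(t⁻¹ x)`. -/
def translate (t : Fin T.p → ℂˣ) (f : T.Coord) : T.Coord :=
  f.coeff.sum fun m c => AddMonoidAlgebra.single m (torusChar (-m) t • c)

/-- The action of `θ_i ∈ 𝔱₁` on functions on `T` by left translation,
`½ ∑_j ξ_j ⟨t ∂/∂t, [θ_i, θ_j]⟩ - ∂/∂ξ_i`. -/
def oddField (i : Fin T.q) (f : T.Coord) : T.Coord :=
  f.coeff.sum fun m c => AddMonoidAlgebra.single m
    ((1 / 2 : ℂ) • ∑ j, weightPairing m (T.bracket i j) • (xi j * c) -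
      CliffordAlgebra.contractLeft (Q := (0 : QuadraticForm ℂ (Fin T.q → ℂ)))
        (LinearMap.proj i) c)

/-- A left action of the supertorus `T = (T₀, 𝔱)` on `Spec A`, in terms of the Harish-Chandra
pair: a rational action of `T₀` on `A` by automorphisms of superalgebras and an action of `𝔱` on
`A` by superderivations, compatible with each other. An element `x ∈ 𝔱₀` acts by the differential
of the action of `T₀`, that is, by `⟨m, x⟩` on vectors of weight `m`. -/
structure Action (A : Type*) [Ring A] [Algebra ℂ A] [SuperCommAlgebra A] where
  grp : (Fin T.p → ℂˣ) →* (A →ₐ[ℂ] A)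
  grp_part : ∀ t i a, a ∈ part A i → grp t a ∈ part A i
  rational : ∀ a : A, a ∈ Submodule.span ℂ
    {w : A | ∃ m : Fin T.p → ℤ, ∀ t, grp t w = torusChar m t • w}
  odd : Fin T.q → A →ₗ[ℂ] A
  odd_part : ∀ k i a, a ∈ part A i → odd k a ∈ part A (i + 1)
  leibniz : ∀ k (i : ZMod 2) (a b : A), a ∈ part A i →
    odd k (a * b) = odd k a * b + (-1 : ℂ) ^ i.val • (a * odd k b)
  odd_grp : ∀ k t a, odd k (grp t a) = grp t (odd k a)
  odd_odd : ∀ (k l : Fin T.q) (m : Fin T.p → ℤ) (w : A),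
    (∀ t, grp t w = torusChar m t • w) →
      odd k (odd l w) + odd l (odd k w) = weightPairing m (T.bracket k l) • w

end Supertorus

/-- `Spec A` is a faithful toric supervariety: an irreducible supervariety with a left action of a
supertorus `T` and a `T`-equivariant open immersion `T = Spec ℂ[T] → Spec A`. -/
def IsFaithfulToricSupervariety (A : Type) [Ring A] [Algebra ℂ A] [SuperCommAlgebra A] : Prop :=
  IsIrreducibleSupervariety A ∧
    ∃ (T : Supertorus) (ρ : T.Action A) (φ : SuperHom A T.Coord),
      (∀ t a, φ.toAlgHom (ρ.grp t a) = T.translate t (φ.toAlgHom a)) ∧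
      (∀ i a, φ.toAlgHom (ρ.odd i a) = T.oddField i (φ.toAlgHom a)) ∧
      φ.IsOpenImmersion

/-! ### Lie superalgebras -/

/-- A Lie superalgebra structure over `ℂ` on `g`. -/
structure LieSuperalgebra (g : Type*) [AddCommGroup g] [Module ℂ g] where
  part : ZMod 2 → Submodule ℂ g
  isCompl : IsCompl (part 0) (part 1)
  bracket : g →ₗ[ℂ] g →ₗ[ℂ] g
  bracket_mem : ∀ {i j : ZMod 2} {x y : g}, x ∈ part i → y ∈ part j → bracket x y ∈ part (i + j)
  skew : ∀ {i j : ZMod 2} {x y : g}, x ∈ part i → y ∈ part j →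
    bracket x y = -((-1 : ℂ) ^ (i.val * j.val) • bracket y x)
  jacobi : ∀ {i j : ZMod 2} {x y : g} (z : g), x ∈ part i → y ∈ part j →
    bracket x (bracket y z) =
      bracket (bracket x y) z + (-1 : ℂ) ^ (i.val * j.val) • bracket y (bracket x z)

/-- A subspace spanned by homogeneous elements. -/
def IsGradedSubspace {V : Type*} [AddCommGroup V] [Module ℂ V]
    (P : ZMod 2 → Submodule ℂ V) (U : Submodule ℂ V) : Prop :=
  U = (U ⊓ P 0) ⊔ (U ⊓ P 1)

namespace LieSuperalgebra

variable {g : Type*} [AddCommGroup g] [Module ℂ g] (L : LieSuperalgebra g)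

/-- `g` is simple: it is not abelian and has no non-trivial graded ideal. -/
def IsSimple : Prop :=
  L.bracket ≠ 0 ∧ ∀ I : Submodule ℂ g, IsGradedSubspace L.part I →
    (∀ x, ∀ y ∈ I, L.bracket x y ∈ I) → I = ⊥ ∨ I = ⊤

end LieSuperalgebra

/-! ### The types of Lie superalgebras under consideration -/

/-- `A m n` stands for `𝔰𝔩(m|n)` if `m < n` and for `𝔭𝔰𝔩(n|n)` if `m = n`; `C n` for `𝔬𝔰𝔭(2|2n)`;
`B n` for `𝔬𝔰𝔭(1|2n)`; `D21 α` for `D(2,1;α)`. The simple roots are those of the distinguished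
Borel subalgebra, in the following order, where the node with index `0` is the first one:

* `A m n`: `ε₁-ε₂, …, ε_{m-1}-ε_m, ε_m-δ₁, δ₁-δ₂, …, δ_{n-1}-δ_n`;
* `C n`: `ε-δ₁, δ₁-δ₂, …, δ_{n-1}-δ_n, 2δ_n`;
* `B n`: `δ₁-δ₂, …, δ_{n-1}-δ_n, δ_n`;
* `D21 α`: `ε₁-ε₂-ε₃, 2ε₂, 2ε₃`;
* `F4`: `½(δ-ε₁-ε₂-ε₃), ε₃, ε₂-ε₃, ε₁-ε₂`;
* `G3`: `δ+ε₃, ε₁, ε₂-ε₁`, where `ε₁+ε₂+ε₃ = 0`. -/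
inductive KFType : Type
  | A (m n : ℕ)
  | C (n : ℕ)
  | B (n : ℕ)
  | D21 (α : ℂ)
  | F4
  | G3

namespace KFType

/-- The parameters for which the type names a basic Lie superalgebra. -/
def Valid : KFType → Prop
  | A m n => 1 ≤ m ∧ m ≤ n ∧ 2 ≤ n
  | C n => 2 ≤ n
  | B n => 1 ≤ n
  | D21 α => α ≠ 0 ∧ α ≠ -1
  | F4 => True
  | G3 => True

/-- The number of simple roots. -/
def rank : KFType → ℕ
  | A m n => m + n - 1
  | C n => n + 1
  | B n => n
  | D21 _ => 3
  | F4 => 4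
  | G3 => 3

/-- The parity of the simple roots. -/
def parity : (τ : KFType) → Fin τ.rank → ZMod 2
  | A m _ => fun i => if i.1 + 1 = m then 1 else 0
  | C _ => fun i => if i.1 = 0 then 1 else 0
  | B n => fun i => if i.1 + 1 = n then 1 else 0
  | D21 _ => ![1, 0, 0]
  | F4 => ![1, 0, 0, 0]
  | G3 => ![1, 0, 0]

/-- The vector with entry `c` in position `i` and `-1` in position `i + 1`. -/
def stepVec (c : ℂ) (i k : ℕ) : ℂ := if k = i then c else if k = i + 1 then -1 else 0

/-- The Gram matrix of vectors in an orthogonal basis with squared lengths `w k`, `k < N`. -/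
def gramOf {r : ℕ} (N : ℕ) (w : ℕ → ℂ) (v : Fin r → ℕ → ℂ) : Matrix (Fin r) (Fin r) ℂ :=
  Matrix.of fun i j => ∑ k ∈ Finset.range N, w k * v i k * v j k

/-- The Gram matrix `(α_i, α_j)` of the simple roots with respect to an invariant form. The
orthogonal basis is `ε₁, …, ε_m, δ₁, …, δ_n` with `(ε_i,ε_i) = 1`, `(δ_j,δ_j) = -1` for `A m n`,
the basis `ε, δ₁, …, δ_n` with `(ε,ε) = 1`, `(δ_j,δ_j) = -1` for `C n`, and `δ₁, …, δ_n` with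
`(δ_j,δ_j) = -1` for `B n`. -/
def gram : (τ : KFType) → Matrix (Fin τ.rank) (Fin τ.rank) ℂ
  | A m n => gramOf (m + n) (fun k => if k < m then 1 else -1) fun i => stepVec 1 i.1
  | C n => gramOf (n + 1) (fun k => if k = 0 then 1 else -1) fun i =>
      stepVec (if i.1 = n then 2 else 1) i.1
  | B n => gramOf n (fun _ => -1) fun i => stepVec 1 i.1
  | D21 α => !![0, -1, -α; -1, 2, 0; -α, 0, 2 * α]
  | F4 => !![0, -1/2, 0, 0; -1/2, 1, -1, 0; 0, -1, 2, -1; 0, 0, -1, 2]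
  | G3 => !![0, 1, 0; 1, -2, 3; 0, 3, -6]

variable (τ : KFType)

/-- The factor `d_i` with `(λ, α_i) = d_i λ(h_i)`. -/
def symmetrizer (i : Fin τ.rank) : ℂ := if τ.gram i i = 0 then 1 else τ.gram i i / 2

/-- The Cartan matrix `α_j(h_i)`: here `h_i` is the coroot `2 α_i / (α_i, α_i)` if `α_i` is not
isotropic, and corresponds to `α_i` under the form otherwise. -/
def cartanMatrix : Matrix (Fin τ.rank) (Fin τ.rank) ℂ :=
  Matrix.of fun i j => τ.gram i j / τ.symmetrizer i

/-- `(λ, β)` for the weight with labels `a_i = λ(h_i)` and `β = ∑ c_i α_i`. -/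
def pairing (a : Fin τ.rank → ℂ) (c : Fin τ.rank → ℕ) : ℂ :=
  ∑ i, (c i : ℂ) * (τ.symmetrizer i * a i)

/-- `(β, β)` for `β = ∑ c_i α_i`. -/
def norm (c : Fin τ.rank → ℕ) : ℂ := ∑ i, ∑ j, (c i : ℂ) * (c j : ℂ) * τ.gram i j

/-- `(ρ, β)` for `β = ∑ c_i α_i`; recall that `(ρ, α_i) = (α_i, α_i) / 2`. -/
def rhoPairing (c : Fin τ.rank → ℕ) : ℂ := ∑ i, (c i : ℂ) * (τ.gram i i / 2)

end KFType

/-- A distinguished set of Chevalley generators of `g` of type `τ`. A simple Lie superalgebra with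
such generators is the basic Lie superalgebra of type `τ`; `rootPart c` is the sum of the root
spaces for `∑ c_i α_i`, and `rootPart 0` the Cartan subalgebra. -/
structure ChevalleyGenerators (τ : KFType) {g : Type*} [AddCommGroup g] [Module ℂ g]
    (L : LieSuperalgebra g) where
  e : Fin τ.rank → g
  f : Fin τ.rank → g
  h : Fin τ.rank → g
  e_mem : ∀ i, e i ∈ L.part (τ.parity i)
  f_mem : ∀ i, f i ∈ L.part (τ.parity i)
  bracket_e_f : ∀ i j, L.bracket (e i) (f j) = if i = j then h i else 0
  bracket_h_h : ∀ i j, L.bracket (h i) (h j) = 0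
  bracket_h_e : ∀ i j, L.bracket (h i) (e j) = τ.cartanMatrix i j • e j
  bracket_h_f : ∀ i j, L.bracket (h i) (f j) = -(τ.cartanMatrix i j • f j)
  generate : ∀ U : Submodule ℂ g, (∀ i, e i ∈ U) → (∀ i, f i ∈ U) →
    (∀ x ∈ U, ∀ y ∈ U, L.bracket x y ∈ U) → U = ⊤
  rootPart : (Fin τ.rank → ℤ) → Submodule ℂ g
  isInternal : DirectSum.IsInternal rootPart
  rootPart_bracket : ∀ {c d : Fin τ.rank → ℤ} {x y : g}, x ∈ rootPart c → y ∈ rootPart d →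
    L.bracket x y ∈ rootPart (c + d)
  e_root : ∀ i, e i ∈ rootPart (Pi.single i 1)
  f_root : ∀ i, f i ∈ rootPart (-Pi.single i 1)
  rootPart_zero : rootPart 0 = Submodule.span ℂ (Set.range h)

namespace ChevalleyGenerators

variable {τ : KFType} {g : Type*} [AddCommGroup g] [Module ℂ g] {L : LieSuperalgebra g}
  (R : ChevalleyGenerators τ L)

/-- The Cartan subalgebra. -/
abbrev cartan : Submodule ℂ g := R.rootPart 0

/-- The labels `λ(h_i)` of a weight. -/
def labels (lam : Module.Dual ℂ R.cartan) (i : Fin τ.rank) : ℂ :=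
  lam ⟨R.h i, by
    change R.h i ∈ R.rootPart 0
    rw [R.rootPart_zero]
    exact Submodule.subset_span ⟨i, rfl⟩⟩

/-- `λ` is typical: `(λ + ρ, β) ≠ 0` for every isotropic positive odd root `β`. -/
def IsTypical (lam : Module.Dual ℂ R.cartan) : Prop :=
  ∀ c : Fin τ.rank → ℕ, R.rootPart (fun i => (c i : ℤ)) ≠ ⊥ →
    ∑ i, (c i : ZMod 2) * τ.parity i = 1 → τ.norm c = 0 →
      τ.pairing (R.labels lam) c + τ.rhoPairing c ≠ 0

/-- `λ` is dominant integral: the simple highest weight module `L(λ)` with respect to the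
distinguished Borel subalgebra is finite-dimensional. That is, there is a finite-dimensional simple
`g`-supermodule `V` with a homogeneous highest weight vector `v` of weight `λ`. -/
def IsDominantIntegral (lam : Module.Dual ℂ R.cartan) : Prop :=
  ∃ (V : Type) (_ : AddCommGroup V) (_ : Module ℂ V) (_ : FiniteDimensional ℂ V)
    (P : ZMod 2 → Submodule ℂ V) (act : g →ₗ[ℂ] V →ₗ[ℂ] V),
    IsCompl (P 0) (P 1) ∧
    (∀ (i j : ZMod 2) (x : g) (v : V), x ∈ L.part i → v ∈ P j → act x v ∈ P (i + j)) ∧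
    (∀ (i j : ZMod 2) (x y : g) (v : V), x ∈ L.part i → y ∈ L.part j →
      act (L.bracket x y) v =
        act x (act y v) - (-1 : ℂ) ^ (i.val * j.val) • act y (act x v)) ∧
    (∀ U : Submodule ℂ V, IsGradedSubspace P U → (∀ x, ∀ v ∈ U, act x v ∈ U) →
      U = ⊥ ∨ U = ⊤) ∧
    ∃ v : V, v ≠ 0 ∧ (v ∈ P 0 ∨ v ∈ P 1) ∧ (∀ i, act (R.e i) v = 0) ∧
      ∀ x : R.cartan, act x.1 v = lam x • v

end ChevalleyGenerators

/-! ### The Kus–Fourier polytopes -/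

/-- The positive roots `α_{i,j} = α_i + ⋯ + α_j` of type `A_r`; indices start at `0`. -/
def ARoot (r : ℕ) : Type := {x : ℕ × ℕ // x.1 ≤ x.2 ∧ x.2 < r}

/-- The positive roots of type `C_n`. With indices starting at `0`, the pair `(i, j)` stands for
`α_i + ⋯ + α_j` if `j < n`, and, for `i ≤ j < n - 1`, the pair `(i, 2n-2-j)` for
`(α_i + ⋯ + α_{n-1}) + (α_{n-2} + ⋯ + α_j)`. Hence the simple roots are the `(j, j)`, and the long roots `2δ_j` are the `(j, 2n-2-j)`. -/
def CRoot (n : ℕ) : Type := {x : ℕ × ℕ // x.1 ≤ x.2 ∧ x.1 + x.2 + 2 ≤ 2 * n}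

/-- The steps of Dyck paths. -/
def DyckStep (x y : ℕ × ℕ) : Prop := y = (x.1, x.2 + 1) ∨ y = (x.1 + 1, x.2)

/-- The Dyck path inequalities in type `A_r`, for a weight with labels `m`: for all Dyck paths from
a simple root `α_i` to a simple root `α_j`, the sum is at most `m_i + ⋯ + m_j`. -/
def DyckA {r : ℕ} (m : ℕ → ℝ) (s : ARoot r → ℝ) : Prop :=
  ∀ (l : List (ARoot r)) (a b : ARoot r), l.IsChain (fun x y => DyckStep x.1 y.1) →
    l.head? = some a → l.getLast? = some b → a.1.1 = a.1.2 → b.1.1 = b.1.2 →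
      (l.map s).sum ≤ ∑ k ∈ Finset.Icc a.1.1 b.1.1, m k

/-- The Dyck path inequalities in type `C_n`, for a weight with labels `m`: for paths from `α_i` to
`α_j` the sum is at most `m_i + ⋯ + m_j`; for paths from `α_i` to the long root `2δ_j` the sum plus
`t_j` is at most `m_i + ⋯ + m_{n-1}`. For `t = 0` these are the symplectic Dyck paths; with `t_j`
the coordinate of the odd root `δ_j` they are the orthosymplectic ones. -/
def DyckC {n : ℕ} (m : ℕ → ℝ) (s : CRoot n → ℝ) (t : ℕ → ℝ) : Prop :=
  ∀ (l : List (CRoot n)) (a b : CRoot n), l.IsChain (fun x y => DyckStep x.1 y.1) →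
    l.head? = some a → l.getLast? = some b → a.1.1 = a.1.2 →
      (b.1.1 = b.1.2 → (l.map s).sum ≤ ∑ k ∈ Finset.Icc a.1.1 b.1.1, m k) ∧
      (b.1.1 + b.1.2 + 2 = 2 * n →
        (l.map s).sum + t b.1.1 ≤ ∑ k ∈ Finset.Icc a.1.1 (n - 1), m k)

/-- The positive roots of type `B₃`, with `α₁ = ε₁-ε₂`, `α₂ = ε₂-ε₃`, `α₃ = ε₃`: `rij` stands for
`α_i + ⋯ + α_j`, and `u23 = ε₂+ε₃`, `u13 = ε₁+ε₃`, `u12 = ε₁+ε₂`. -/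
inductive B3Root : Type
  | r11 | r12 | r13 | r22 | r23 | r33 | u23 | u13 | u12

/-- The inequalities of the polytope of type `B₃` for the weight with labels `m₁`, `m₂`, `m₃`. -/
def IneqB3 (m₁ m₂ m₃ : ℝ) (s : B3Root → ℝ) : Prop :=
  let x11 := s .r11
  let x12 := s .r12
  let x13 := s .r13
  let x22 := s .r22
  let x23 := s .r23
  let x33 := s .r33
  let y23 := s .u23
  let y13 := s .u13
  let y12 := s .u12
  x11 ≤ m₁ ∧ x22 ≤ m₂ ∧ x33 ≤ m₃ ∧
  x11 + x12 + x22 ≤ m₁ + m₂ ∧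
  x22 + x23 + x33 ≤ m₂ + m₃ ∧
  x23 + y23 + x33 ≤ m₂ + m₃ ∧
  x11 + x12 + x13 + x22 + x33 ≤ m₁ + m₂ + m₃ ∧
  x11 + x13 + x22 + x23 + x33 ≤ m₁ + m₂ + m₃ ∧
  x11 + x13 + y13 + x23 + x33 ≤ m₁ + m₂ + m₃ ∧
  x11 + y13 + x23 + y23 + x33 ≤ m₁ + m₂ + m₃ ∧
  x11 + x12 + x13 + y13 + x22 + x23 + x33 ≤ m₁ + 2 * m₂ + m₃ ∧
  x11 + x12 + y13 + x22 + x23 + y23 + x33 ≤ m₁ + 2 * m₂ + m₃ ∧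
  x12 + x13 + y13 + y12 + x22 + x23 + x33 ≤ m₁ + 2 * m₂ + m₃ ∧
  x12 + y13 + y12 + x22 + x23 + y23 + x33 ≤ m₁ + 2 * m₂ + m₃ ∧
  x11 + x12 + x13 + 2 * x22 + x23 + x33 ≤ m₁ + 2 * m₂ + m₃ ∧
  x11 + x13 + y13 + x22 + 2 * x23 + y23 + 2 * x33 ≤ m₁ + 2 * m₂ + 2 * m₃ ∧
  x11 + x12 + x13 + y13 + x22 + x23 + y23 + 2 * x33 ≤ m₁ + 2 * m₂ + 2 * m₃ ∧
  x12 + x13 + y13 + y12 + x22 + x23 + y23 + 2 * x33 ≤ m₁ + 2 * m₂ + 2 * m₃ ∧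
  x11 + x12 + x13 + y13 + 2 * x22 + 2 * x23 + y23 + 2 * x33 ≤ m₁ + 3 * m₂ + 2 * m₃ ∧
  x12 + x13 + y13 + y12 + 2 * x22 + 2 * x23 + y23 + 2 * x33 ≤ m₁ + 3 * m₂ + 2 * m₃

/-- The positive roots of type `G₂`: `rij` stands for `i α₁ + j α₂`, where `α₁` is short. -/
inductive G2Root : Type
  | r10 | r01 | r11 | r21 | r31 | r32

/-- The inequalities of the polytope of type `G₂` for the weight with labels `m₁`, `m₂`. -/
def IneqG2 (m₁ m₂ : ℝ) (s : G2Root → ℝ) : Prop :=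
  s .r10 ≤ m₁ ∧ s .r01 ≤ m₂ ∧
  s .r31 + s .r21 + s .r10 ≤ m₁ + m₂ ∧
  s .r21 + s .r11 + s .r10 ≤ m₁ + m₂ ∧
  s .r11 + s .r01 + s .r10 ≤ m₁ + m₂ ∧
  s .r32 + s .r31 + s .r21 + s .r11 + s .r01 ≤ m₁ + 2 * m₂ ∧
  s .r31 + s .r21 + s .r11 + s .r01 + s .r10 ≤ m₁ + 2 * m₂

namespace KFType

/-- The positive even roots. For `A m n` these are the positive roots of `𝔰𝔩(m) ⊕ 𝔰𝔩(n)`, and for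
`C n`, `B n` those of `𝔰𝔭(2n)`. For `D21 α` the indices `0, 1, 2` stand for `2ε₁, 2ε₂, 2ε₃`. For
`F4` and `G3` the element `none` stands for the roots `δ` and `2δ`, respectively, and the other ones
for the positive roots of `𝔰𝔬(7)` and `G₂`. -/
def EvenRoot : KFType → Type
  | A m n => ARoot (m - 1) ⊕ ARoot (n - 1)
  | C n => CRoot n
  | B n => CRoot n
  | D21 _ => Fin 3
  | F4 => Option B3Root
  | G3 => Option G2Root

/-- The positive odd roots: `ε_i - δ_j` for `A m n`; `ε ± δ_j` for `C n`; `δ_j` for `B n`;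
`ε₁ ± ε₂ ± ε₃` for `D21 α`; `½(δ ± ε₁ ± ε₂ ± ε₃)` for `F4`; `δ` and `δ ± ε_i` for `G3`. -/
def OddRoot : KFType → Type
  | A m n => Fin m × Fin n
  | C n => Fin n × Bool
  | B n => Fin n
  | D21 _ => Bool × Bool
  | F4 => Bool × Bool × Bool
  | G3 => Option (Fin 3 × Bool)

/-- The `k`-th label of a weight, as a real number. -/
def lab {r : ℕ} (a : Fin r → ℂ) (k : ℕ) : ℝ := if hk : k < r then (a ⟨k, hk⟩).re else 0

/-- The value `b = λ(β^∨) = 2 (λ, β) / (β, β)`, as a real number. -/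
def corootValue (τ : KFType) (a : Fin τ.rank → ℂ) (c : Fin τ.rank → ℕ) : ℝ :=
  (2 * τ.pairing a c / τ.norm c).re

/-- The inequalities of `P(λ)` that depend on `λ`, in terms of the labels `a_i = λ(h_i)`, the
coordinates `x` at the even and `y` at the odd positive roots. For `B n` the last label is the value
of `λ` on the coroot of the even root `2δ_n`, which is half of `a_{n-1}`. For the exceptional types
`2α₀+α₁+α₂`, `2α₀+3α₁+2α₂+α₃`, `2α₀+4α₁+2α₂` are the even roots `2ε₁`, `δ`, `2δ`, respectively. -/
def WeightIneq : (τ : KFType) → (Fin τ.rank → ℂ) → (τ.EvenRoot → ℝ) → (τ.OddRoot → ℝ) → Prop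
  | A m n, a, x, _ =>
      DyckA (r := m - 1) (lab a) (fun r => x (Sum.inl r)) ∧
      DyckA (r := n - 1) (fun k => lab a (m + k)) (fun r => x (Sum.inr r))
  | C n, a, x, _ => DyckC (n := n) (fun k => lab a (k + 1)) x 0
  | B n, a, x, y =>
      DyckC (n := n) (fun k => if k + 1 = n then lab a k / 2 else lab a k) x
        (fun j => if hj : j < n then y (⟨j, hj⟩ : Fin n) else 0)
  | D21 α, a, x, y =>
      x (1 : Fin 3) ≤ lab a 1 ∧ x (2 : Fin 3) ≤ lab a 2 ∧
      x (0 : Fin 3) + ∑ o : Bool × Bool, y o ≤ corootValue (D21 α) a ![2, 1, 1]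
  | F4, a, x, y =>
      IneqB3 (lab a 3) (lab a 2) (lab a 1) (fun r => x (some r)) ∧
      x (none : Option B3Root) + ∑ o : Bool × Bool × Bool, y o ≤ corootValue F4 a ![2, 3, 2, 1]
  | G3, a, x, y =>
      IneqG2 (lab a 1) (lab a 2) (fun r => x (some r)) ∧
      x (none : Option G2Root) + ∑ o : Option (Fin 3 × Bool), y o ≤ corootValue G3 a ![2, 4, 2]

/-- The polytope `P(λ)` in the space of real functions on the set of positive roots. -/
def polytope (τ : KFType) (a : Fin τ.rank → ℂ) : Set (τ.EvenRoot ⊕ τ.OddRoot → ℝ) :=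
  {s | (∀ r, 0 ≤ s r) ∧ (∀ o, s (Sum.inr o) ≤ 1) ∧
    τ.WeightIneq a (fun r => s (Sum.inl r)) (fun o => s (Sum.inr o))}

/-- The lattice points `(I, m)` of `P(λ)`. -/
def latticePoints (τ : KFType) (a : Fin τ.rank → ℂ) :
    Set (Finset τ.OddRoot × (τ.EvenRoot → ℕ)) :=
  {p | Sum.elim (fun r => (p.2 r : ℝ)) (Set.indicator (p.1 : Set τ.OddRoot) 1) ∈ τ.polytope a}

end KFType

end SuperToric
end

open scoped BigOperators

noncomputable section

namespace SuperToric

universe u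

/-! ### Superrings with integral body -/

section Integral

variable {A : Type*} [Ring A] [Algebra ℂ A] [SuperCommAlgebra A]

/-! Let S be the set of lattice points. The polytope enters through two properties: S is finite, and
S is a lower set, meaning that (I, m) ∈ S, I' ⊆ I and m' ≤ m imply (I', m') ∈ S. Both are visible in
the inequalities: they bound sums of coordinates with nonnegative coefficients from above, and
together they bound every even coordinate. The rest is a theorem about the monomial superalgebra A
of any finite lower set S (`isFaithfulToricSupervariety_of_isLowerSet`).

Along with a monomial ξ^I x^m v, a lower set contains v, and it contains x_e v and ξ_o v for every
variable that occurs. Let f be the product of v and of all such x_e v. Dividing by v shows that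
A[f⁻¹] is the full Laurent superalgebra in the variables that occur, and A embeds into it
(`isPrincipalLocalization_monomialHom`). This Laurent superalgebra is the coordinate superalgebra of
a supertorus with zero bracket, so inverting f is the required open immersion. The supertorus acts
on A itself: A is spanned by weight vectors, hence stable under translations, and the odd Lie
algebra acts by -∂/∂ξ_i, which only removes odd factors from a generator and so stays inside a lower
set. These facts suffice by `isFaithfulToricSupervariety_of_isPrincipalLocalization`.

That Spec A is an irreducible supervariety is also inherited from A[f⁻¹]. The predicate
`IsIntegralSuperring` holds for the Laurent superalgebra (`isIntegralSuperring_superPoly`), descends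
from A[f⁻¹] to A (`IsPrincipalLocalization.isIntegralSuperring`), passes to every nonempty affine
open (`IsIntegralSuperring.of_isOpenImmersion`), and implies reducedness
(`IsIntegralSuperring.isReducedSuperring`). For generic fermionic regularity one dense point is
enough: the stalk at the generic point is an exterior algebra over the fraction field of the even
Laurent polynomials (`IsPrincipalLocalization.isFermionicallyRegular_stalk`). -/

theorem exists_parts (a : A) : ∃ a₀ ∈ part A 0, ∃ a₁ ∈ part A 1, a = a₀ + a₁ := by
  have ha : a ∈ part A 0 ⊔ part A 1 := by
    rw [(SuperCommAlgebra.isCompl (A := A)).sup_eq_top]; trivial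
  obtain ⟨a₀, h₀, a₁, h₁, rfl⟩ := Submodule.mem_sup.1 ha
  exact ⟨a₀, h₀, a₁, h₁, rfl⟩

theorem eq_zero_of_mem_parts {a : A} (h₀ : a ∈ part A 0) (h₁ : a ∈ part A 1) : a = 0 :=
  (Submodule.disjoint_def.1 (SuperCommAlgebra.isCompl (A := A)).disjoint) a h₀ h₁

theorem parts_ext {a₀ a₁ b₀ b₁ : A} (h : a₀ + a₁ = b₀ + b₁) (ha₀ : a₀ ∈ part A 0)
    (ha₁ : a₁ ∈ part A 1) (hb₀ : b₀ ∈ part A 0) (hb₁ : b₁ ∈ part A 1) : a₀ = b₀ ∧ a₁ = b₁ := by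
  have e : a₀ - b₀ = b₁ - a₁ := by
    rw [sub_eq_sub_iff_add_eq_add, h, add_comm]
  have z : a₀ - b₀ = 0 :=
    eq_zero_of_mem_parts (sub_mem ha₀ hb₀) (e ▸ sub_mem hb₁ ha₁)
  exact ⟨sub_eq_zero.1 z, (sub_eq_zero.1 (e ▸ z)).symm⟩

theorem even_mul_part {i : ZMod 2} {a b : A} (ha : a ∈ part A 0) (hb : b ∈ part A i) :
    a * b ∈ part A i := by
  simpa using SuperCommAlgebra.mul_mem ha hb

theorem odd_mul_odd {a b : A} (ha : a ∈ part A 1) (hb : b ∈ part A 1) : a * b ∈ part A 0 :=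
  SuperCommAlgebra.mul_mem (i := 1) (j := 1) ha hb

theorem odd_mul_even {a b : A} (ha : a ∈ part A 1) (hb : b ∈ part A 0) : a * b ∈ part A 1 := by
  simpa using SuperCommAlgebra.mul_mem ha hb

theorem odd_anticomm {a b : A} (ha : a ∈ part A 1) (hb : b ∈ part A 1) : a * b = -(b * a) := by
  simpa [ZMod.val_one] using SuperCommAlgebra.comm ha hb

theorem odd_mul_self {a : A} (ha : a ∈ part A 1) : a * a = 0 := by
  have h : a * a + a * a = 0 := by
    conv_lhs => enter [1]; rw [odd_anticomm ha ha]
    exact neg_add_cancel _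
  have h2 : (2 : ℂ) • (a * a) = 0 := by rw [two_smul]; exact h
  exact (smul_eq_zero.1 h2).resolve_left two_ne_zero

theorem isNilpotent_of_odd {a : A} (ha : a ∈ part A 1) : IsNilpotent a :=
  ⟨2, by rw [pow_two, odd_mul_self ha]⟩

/-- The odd part squares to zero and commutes with the even part, so adding or removing it does not
affect nilpotency. This reduces questions about nilpotents to the commutative ring of even elements.
-/
theorem isNilpotent_even_part_iff {a₀ a₁ : A} (h₀ : a₀ ∈ part A 0) (h₁ : a₁ ∈ part A 1) :
    IsNilpotent (a₀ + a₁) ↔ IsNilpotent a₀ := by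
  have hc : Commute a₀ a₁ := even_comm h₀ a₁
  refine ⟨fun h => ?_, fun h => hc.isNilpotent_add h (isNilpotent_of_odd h₁)⟩
  have := (Commute.add_left hc (Commute.refl a₁)).isNilpotent_sub h (isNilpotent_of_odd h₁)
  rwa [add_sub_cancel_right] at this

theorem isNilpotent_evenSub_iff {a : evenSub A} : IsNilpotent a ↔ IsNilpotent a.1 :=
  exists_congr fun _ => Subtype.ext_iff

theorem not_isNilpotent_of_notMem {x : SpecTop A} {s : evenSub A} (hs : s ∉ x.asIdeal) :
    ¬ IsNilpotent s := fun h => hs (nilpotent_iff_mem_prime.1 h _ x.2)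

variable (A) in
/-- The ideal of a commutative superalgebra generated by its odd elements. -/
def oddIdeal : Submodule ℂ A := part A 1 * ⊤

theorem odd_mem_oddIdeal {a : A} (ha : a ∈ part A 1) : a ∈ oddIdeal A := by
  simpa [oddIdeal] using Submodule.mul_mem_mul ha (Submodule.mem_top (x := (1 : A)))

theorem oddIdeal_mul_mem {a : A} (ha : a ∈ oddIdeal A) (b : A) : a * b ∈ oddIdeal A := by
  have h := Submodule.mul_mem_mul ha (Submodule.mem_top (x := b))
  rw [oddIdeal, mul_assoc] at h
  exact (mul_le_mul_right (le_top : ⊤ * ⊤ ≤ (⊤ : Submodule ℂ A)) (part A 1) :) h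

theorem mul_oddIdeal_mem {a : A} (ha : a ∈ oddIdeal A) (b : A) : b * a ∈ oddIdeal A := by
  induction ha using Submodule.mul_induction_on' with
  | mem_mul_mem o ho x _ =>
    obtain ⟨b₀, h₀, b₁, h₁, rfl⟩ := exists_parts b
    rw [← mul_assoc, add_mul, even_comm h₀, odd_anticomm h₁ ho, ← mul_neg, ← mul_add, mul_assoc]
    exact Submodule.mul_mem_mul ho trivial
  | add x _ y _ hx hy => rw [mul_add]; exact add_mem hx hy

/-- The even part of such an element is a sum of products of two odd elements. Each product squares
to zero, and even elements commute, so the sum is nilpotent; the odd part is harmless. -/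
theorem isNilpotent_of_mem_oddIdeal {a : A} (ha : a ∈ oddIdeal A) : IsNilpotent a := by
  suffices h : ∃ a₀ ∈ part A 0, ∃ a₁ ∈ part A 1, IsNilpotent a₀ ∧ a = a₀ + a₁ by
    obtain ⟨a₀, h₀, a₁, h₁, hn, rfl⟩ := h
    exact (isNilpotent_even_part_iff h₀ h₁).2 hn
  induction ha using Submodule.mul_induction_on' with
  | mem_mul_mem o ho x _ =>
    obtain ⟨x₀, h₀, x₁, h₁, rfl⟩ := exists_parts x
    refine ⟨o * x₁, odd_mul_odd ho h₁, o * x₀, odd_mul_even ho h₀, ⟨2, ?_⟩, by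
      rw [mul_add, add_comm]⟩
    rw [pow_two, ← mul_assoc, mul_assoc o x₁ o, odd_anticomm h₁ ho, mul_neg, ← mul_assoc,
      odd_mul_self ho]
    simp
  | add x _ y _ hx hy =>
    obtain ⟨x₀, h₀, x₁, h₁, hn, rfl⟩ := hx
    obtain ⟨y₀, h₀', y₁, h₁', hn', rfl⟩ := hy
    exact ⟨_, add_mem h₀ h₀', _, add_mem h₁ h₁',
      Commute.isNilpotent_add (even_comm h₀ y₀) hn hn', add_add_add_comm _ _ _ _⟩

/-- The ideal of a localization generated by the odd elements, in terms of fractions. -/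
theorem exists_of_mem_span_locPart {S : Submonoid (evenSub A)} {z : LocalizedModule S A}
    (hz : z ∈ TwoSidedIdeal.span (locPart S 1)) :
    ∃ a ∈ oddIdeal A, ∃ s : S, z = LocalizedModule.mk a s := by
  -- Fractions with numerator in the odd ideal form a two-sided ideal of the localization that
  -- contains the odd fractions, so it contains the ideal they span.
  let C : Set (LocalizedModule S A) := {z | ∃ a ∈ oddIdeal A, ∃ s : S, z = LocalizedModule.mk a s}
  have hadd : ∀ {x y}, x ∈ C → y ∈ C → x + y ∈ C := by
    rintro _ _ ⟨a, ha, s, rfl⟩ ⟨b, hb, t, rfl⟩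
    exact ⟨_, add_mem (mul_oddIdeal_mem ha t.1.1) (mul_oddIdeal_mem hb s.1.1), s * t,
      LocalizedModule.mk_add_mk⟩
  have hneg : ∀ {x}, x ∈ C → -x ∈ C := by
    rintro _ ⟨a, ha, s, rfl⟩
    exact ⟨-a, neg_mem ha, s, (LocalizedModule.mk_neg).symm⟩
  have hl : ∀ {x y}, y ∈ C → x * y ∈ C := by
    rintro x _ ⟨b, hb, t, rfl⟩
    induction x using LocalizedModule.induction_on with
    | h a s => exact ⟨_, mul_oddIdeal_mem hb a, s * t, LocalizedModule.mk_mul_mk⟩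
  have hr : ∀ {x y}, x ∈ C → x * y ∈ C := by
    rintro _ y ⟨a, ha, s, rfl⟩
    induction y using LocalizedModule.induction_on with
    | h b t => exact ⟨_, oddIdeal_mul_mem ha b, s * t, LocalizedModule.mk_mul_mk⟩
  have h0 : (0 : LocalizedModule S A) ∈ C := ⟨0, zero_mem _, 1, (LocalizedModule.zero_mk 1).symm⟩
  have h := TwoSidedIdeal.mem_span_iff.1 hz (TwoSidedIdeal.mk' C h0 hadd hneg hl hr) (by
    rintro _ ⟨a, ha, s, rfl⟩
    simp only [TwoSidedIdeal.coe_mk']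
    exact ⟨a, odd_mem_oddIdeal ha, s, rfl⟩)
  rwa [TwoSidedIdeal.mem_mk'] at h

/-- Clearing denominators turns membership in an ideal of the total superring of fractions into a
condition inside `A`. -/
theorem mem_bodyIdeal_iff {b : A} :
    b ∈ bodyIdeal A ↔ ∃ s ∈ nonzdiv A, s.1 * b ∈ oddIdeal A := by
  rw [bodyIdeal, TwoSidedIdeal.mem_comap]
  constructor
  · intro h
    obtain ⟨a, ha, s, e⟩ := exists_of_mem_span_locPart h
    obtain ⟨u, hu⟩ := LocalizedModule.mk_eq.1 e
    have hu' : u.1.1 * (s.1.1 * b) = u.1.1 * ((1 : evenSub A).1 * a) := hu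
    refine ⟨u.1 * s.1, mul_mem u.2 s.2, ?_⟩
    change u.1.1 * s.1.1 * b ∈ _
    rw [mul_assoc, hu']
    exact mul_oddIdeal_mem (mul_oddIdeal_mem ha _) _
  · rintro ⟨s, hs, h⟩
    have key : ∀ a ∈ oddIdeal A,
        toLoc (nonzdiv A) a ∈ TwoSidedIdeal.span (locPart (nonzdiv A) 1) := by
      intro a ha
      induction ha using Submodule.mul_induction_on' with
      | mem_mul_mem o ho x _ =>
        rw [map_mul]
        exact TwoSidedIdeal.mul_mem_right _ _ _ (TwoSidedIdeal.subset_span ⟨o, ho, 1, rfl⟩)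
      | add x _ y _ hx hy => rw [map_add]; exact add_mem hx hy
    have e : toLoc (nonzdiv A) b =
        LocalizedModule.mk 1 ⟨s, hs⟩ * toLoc (nonzdiv A) (s.1 * b) := by
      change LocalizedModule.mk b 1 = LocalizedModule.mk 1 _ * LocalizedModule.mk (s.1 * b) 1
      rw [LocalizedModule.mk_mul_mk, LocalizedModule.mk_eq]
      refine ⟨1, ?_⟩
      change (1 : A) * ((s.1 * 1) * b) = 1 * (1 * (1 * (s.1 * b)))
      simp
    rw [e]
    exact TwoSidedIdeal.mul_mem_left _ _ _ (key _ h)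

variable (A) in
/-- A commutative superalgebra whose even part is a domain up to nilpotents, whose non-nilpotent
even elements are regular, and whose nilpotent even elements are generically in the ideal generated
by the odd elements. -/
structure IsIntegralSuperring : Prop where
  nilradical_prime : (nilradical (evenSub A)).IsPrime
  regular : ∀ s : evenSub A, ¬ IsNilpotent s → ∀ a : A, s.1 * a = 0 → a = 0
  mem_oddIdeal : ∀ a : evenSub A, IsNilpotent a →
    ∃ t : evenSub A, ¬ IsNilpotent t ∧ t.1 * a.1 ∈ oddIdeal A

namespace IsIntegralSuperring

theorem not_isNilpotent_one (hA : IsIntegralSuperring A) : ¬ IsNilpotent (1 : evenSub A) := fun h =>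
  hA.nilradical_prime.ne_top ((Ideal.eq_top_iff_one _).2 (mem_nilradical.2 h))

theorem one_ne_zero (hA : IsIntegralSuperring A) : (1 : A) ≠ 0 := fun h =>
  hA.not_isNilpotent_one ⟨1, Subtype.ext (by simpa using h)⟩

theorem not_isNilpotent_mul (hA : IsIntegralSuperring A) {s t : evenSub A} (hs : ¬ IsNilpotent s)
    (ht : ¬ IsNilpotent t) :
    ¬ IsNilpotent (s * t) := fun h =>
  (hA.nilradical_prime.mem_or_mem (mem_nilradical.2 h)).elim (fun h => hs (mem_nilradical.1 h))
    fun h => ht (mem_nilradical.1 h)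

/-- If `s` is regular and `s a` is nilpotent, then cancelling a power of `s` makes `a` nilpotent.
The converse is what the third condition of `IsIntegralSuperring` provides, since its multiplier `t`
is regular by the second. -/
theorem mem_bodyIdeal_iff_isNilpotent (hA : IsIntegralSuperring A) (a : A) :
    a ∈ bodyIdeal A ↔ IsNilpotent a := by
  rw [mem_bodyIdeal_iff]
  constructor
  · rintro ⟨s, hs, h⟩
    obtain ⟨k, hk⟩ := isNilpotent_of_mem_oddIdeal h
    rw [(show Commute s.1 a from even_comm s.2 a).mul_pow] at hk
    exact ⟨k, (pow_mem hs k : s ^ k ∈ nonzdiv A) _ (by simpa using hk)⟩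
  · intro h
    obtain ⟨a₀, h₀, a₁, h₁, rfl⟩ := exists_parts a
    obtain ⟨t, ht, hm⟩ := hA.mem_oddIdeal ⟨a₀, h₀⟩
      (isNilpotent_evenSub_iff.2 ((isNilpotent_even_part_iff h₀ h₁).1 h))
    refine ⟨t, hA.regular t ht, ?_⟩
    rw [mul_add]
    exact add_mem hm (mul_oddIdeal_mem (odd_mem_oddIdeal h₁) _)

/-- The even part of the product is `a₀ b₀ + a₁ b₁`, where `a₁ b₁` is nilpotent. Hence `a₀ b₀` is
nilpotent, and primality of the even nilradical applies. -/
theorem isNilpotent_or_of_mul (hA : IsIntegralSuperring A) {a b : A} (h : IsNilpotent (a * b)) :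
    IsNilpotent a ∨ IsNilpotent b := by
  obtain ⟨a₀, h₀, a₁, h₁, rfl⟩ := exists_parts a
  obtain ⟨b₀, k₀, b₁, k₁, rfl⟩ := exists_parts b
  rw [isNilpotent_even_part_iff h₀ h₁, isNilpotent_even_part_iff k₀ k₁]
  have e : (a₀ + a₁) * (b₀ + b₁) = (a₀ * b₀ + a₁ * b₁) + (a₀ * b₁ + a₁ * b₀) := by
    simp only [add_mul, mul_add]; abel
  rw [e, isNilpotent_even_part_iff (add_mem (even_mul_part h₀ k₀) (odd_mul_odd h₁ k₁))
    (add_mem (even_mul_part h₀ k₁) (odd_mul_even h₁ k₀))] at h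
  have hn : IsNilpotent (a₁ * b₁) :=
    isNilpotent_of_mem_oddIdeal (oddIdeal_mul_mem (odd_mem_oddIdeal h₁) _)
  have hc : Commute (a₀ * b₀ + a₁ * b₁) (a₁ * b₁) :=
    even_comm (add_mem (even_mul_part h₀ k₀) (odd_mul_odd h₁ k₁)) _
  have h' := hc.isNilpotent_sub h hn
  rw [add_sub_cancel_right] at h'
  by_contra! hcon
  exact hA.not_isNilpotent_mul (s := ⟨a₀, h₀⟩) (t := ⟨b₀, k₀⟩)
    (fun h => hcon.1 (isNilpotent_evenSub_iff.1 h))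
    (fun h => hcon.2 (isNilpotent_evenSub_iff.1 h)) (isNilpotent_evenSub_iff.2 h')

theorem isNilpotent_of_mem_zdiv (hA : IsIntegralSuperring A) {a : A} (ha : a ∈ zdiv A) :
    IsNilpotent a := by
  obtain ⟨c, hc, h⟩ := ha
  obtain ⟨a₀, h₀, a₁, h₁, rfl⟩ := exists_parts a
  rw [isNilpotent_even_part_iff h₀ h₁]
  by_contra hn
  have reg : ∀ x, a₀ * x = 0 → x = 0 :=
    hA.regular ⟨a₀, h₀⟩ (fun h => hn (isNilpotent_evenSub_iff.1 h))
  -- From `(a₀ + a₁) c = 0` one gets `a₀ c = -a₁ c`, hence `a₀² c = a₁² c = 0`; the case of `c (a₀ +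
  -- a₁) = 0` is symmetric.
  refine hc (reg _ (reg _ ?_))
  rcases h with h | h
  · rw [add_mul, add_eq_zero_iff_eq_neg] at h
    rw [h, mul_neg, ← mul_assoc, even_comm h₀, mul_assoc, h, mul_neg, ← mul_assoc,
      odd_mul_self h₁]
    simp
  · rw [mul_add, add_eq_zero_iff_eq_neg] at h
    rw [even_comm h₀ c, h, mul_neg, ← mul_assoc, even_comm h₀ c, h, neg_mul, mul_assoc,
      odd_mul_self h₁]
    simp

/-- Zero-divisors of `A` are nilpotent, so they die modulo the body ideal, and the quotient has no
zero-divisors except zero. Both sets being compared are therefore `{0}`. -/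
theorem isReducedSuperring (hA : IsIntegralSuperring A) : IsReducedSuperring A := by
  refine ⟨hA.mem_bodyIdeal_iff_isNilpotent, ?_⟩
  have hz : ∀ a : A, (bodyIdeal A).ringCon.mk' a = 0 ↔ IsNilpotent a := fun a => by
    rw [← hA.mem_bodyIdeal_iff_isNilpotent, TwoSidedIdeal.mem_iff]
    exact RingCon.eq _
  have h1 : (1 : (bodyIdeal A).ringCon.Quotient) ≠ 0 := fun h =>
    hA.not_isNilpotent_one (isNilpotent_evenSub_iff.2 ((hz 1).1 (by rw [map_one, h])))
  ext x
  constructor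
  · rintro ⟨a, ha, rfl⟩
    exact ⟨1, h1, Or.inl (by rw [(hz a).2 (hA.isNilpotent_of_mem_zdiv ha), zero_mul])⟩
  · rintro ⟨y, hy, hxy⟩
    obtain ⟨a, rfl⟩ := (bodyIdeal A).ringCon.mk'_surjective x
    obtain ⟨b, rfl⟩ := (bodyIdeal A).ringCon.mk'_surjective y
    have hx : (bodyIdeal A).ringCon.mk' a = 0 := by
      rw [hz]
      simp only [← map_mul, hz] at hxy
      rw [Ne, hz] at hy
      rcases hxy with h | h
      · exact (hA.isNilpotent_or_of_mul h).resolve_right hy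
      · exact (hA.isNilpotent_or_of_mul h).resolve_left hy
    exact ⟨0, ⟨1, hA.one_ne_zero, Or.inl (zero_mul 1)⟩, by rw [hx, map_zero]⟩

theorem irreducibleSpace (hA : IsIntegralSuperring A) : IrreducibleSpace (SpecTop A) :=
  PrimeSpectrum.irreducibleSpace_iff_isPrime_nilradical.2 hA.nilradical_prime

end IsIntegralSuperring

end Integral

/-! ### Stalks and open immersions -/

namespace SuperHom

variable {A B : Type*} [Ring A] [Algebra ℂ A] [SuperCommAlgebra A]
  [Ring B] [Algebra ℂ B] [SuperCommAlgebra B] {φ : SuperHom A B} {y : SpecTop B}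

theorem exists_of_stalkMap_surjective (h : Function.Surjective (φ.stalkMap y)) (b : B) :
    ∃ t ∉ y.asIdeal, ∃ s ∉ (φ.specMap y).asIdeal, ∃ a : A,
      t.1 * (φ.toAlgHom s.1 * b) = t.1 * φ.toAlgHom a := by
  obtain ⟨z, hz⟩ := h (LocalizedModule.mk b 1)
  induction z using LocalizedModule.induction_on with
  | h a s =>
    change LocalizedModule.mk (φ.toAlgHom a) _ = LocalizedModule.mk b 1 at hz
    obtain ⟨u, hu⟩ := LocalizedModule.mk_eq.1 hz
    have hu' : u.1.1 * ((1 : B) * φ.toAlgHom a) = u.1.1 * (φ.toAlgHom s.1.1 * b) := hu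
    exact ⟨u.1, u.2, s.1, s.2, a, by rw [← hu', one_mul]⟩

/-- For an even `b`, comparing even parts allows the numerator to be chosen even. -/
theorem exists_even_of_stalkMap_surjective (h : Function.Surjective (φ.stalkMap y))
    (b : evenSub B) : ∃ t ∉ y.asIdeal, ∃ s ∉ (φ.specMap y).asIdeal, ∃ a : evenSub A,
      t * (φ.even s * b) = t * φ.even a := by
  obtain ⟨t, ht, s, hs, a, e⟩ := exists_of_stalkMap_surjective h b.1
  obtain ⟨a₀, h₀, a₁, h₁, rfl⟩ := exists_parts a
  refine ⟨t, ht, s, hs, ⟨a₀, h₀⟩, Subtype.ext ?_⟩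
  rw [map_add, mul_add, ← add_zero (t.1 * _)] at e
  exact (parts_ext e (even_mul_part t.2 (even_mul_part (φ.map_part 0 _ s.2) b.2)) (zero_mem _)
    (even_mul_part t.2 (φ.map_part 0 _ h₀)) (even_mul_part t.2 (φ.map_part 1 _ h₁))).1

theorem exists_of_stalkMap_injective (h : Function.Injective (φ.stalkMap y)) {a : A}
    {t : evenSub B} (ht : t ∉ y.asIdeal) (e : t.1 * φ.toAlgHom a = 0) :
    ∃ u ∉ (φ.specMap y).asIdeal, u.1 * a = 0 := by
  have h' : φ.stalkMap y (LocalizedModule.mk a 1) = φ.stalkMap y (LocalizedModule.mk 0 1) := by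
    change LocalizedModule.mk (φ.toAlgHom a) _ = LocalizedModule.mk (φ.toAlgHom 0) _
    rw [LocalizedModule.mk_eq]
    refine ⟨⟨t, ht⟩, ?_⟩
    change t.1 * (φ.toAlgHom 1 * φ.toAlgHom a) = t.1 * (φ.toAlgHom 1 * φ.toAlgHom 0)
    rw [map_one, one_mul, e, map_zero]; simp
  obtain ⟨u, hu⟩ := LocalizedModule.mk_eq.1 (h h')
  have hu' : u.1.1 * ((1 : A) * a) = u.1.1 * ((1 : A) * 0) := hu
  exact ⟨u.1, u.2, by simpa using hu'⟩

theorem map_mem_oddIdeal {a : A} (ha : a ∈ oddIdeal A) : φ.toAlgHom a ∈ oddIdeal B := by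
  induction ha using Submodule.mul_induction_on' with
  | mem_mul_mem o ho x _ =>
    rw [map_mul]; exact oddIdeal_mul_mem (odd_mem_oddIdeal (φ.map_part 1 o ho)) _
  | add x _ y _ hx hy => rw [map_add]; exact add_mem hx hy

end SuperHom

namespace IsIntegralSuperring

variable {A B : Type*} [Ring A] [Algebra ℂ A] [SuperCommAlgebra A]
  [Ring B] [Algebra ℂ B] [SuperCommAlgebra B] {φ : SuperHom A B}

/-- One point is enough: an element of the kernel is killed by some `u` outside a prime ideal, and
such a `u` is not nilpotent, hence regular. -/
theorem injective_of_stalkMap_injective (hA : IsIntegralSuperring A) {y : SpecTop B}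
    (h : Function.Injective (φ.stalkMap y)) : Function.Injective φ.toAlgHom := by
  rw [injective_iff_map_eq_zero]
  intro a ha
  obtain ⟨u, hu, e⟩ := SuperHom.exists_of_stalkMap_injective h
    (fun h1 => y.2.ne_top ((Ideal.eq_top_iff_one _).2 h1)) (t := 1) (a := a) (by rw [ha, mul_zero])
  exact hA.regular u (not_isNilpotent_of_notMem hu) a e

/-- Irreducibility passes to a nonempty open subset. The other two conditions are moved to `A` by
writing elements of `B` as fractions of elements of `A` in the stalks. Regularity needs a
well-chosen point; for the condition on nilpotents any point will do. -/
theorem of_isOpenImmersion (hA : IsIntegralSuperring A) (hφ : φ.IsOpenImmersion)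
    [Nonempty (SpecTop B)] : IsIntegralSuperring B := by
  have hinj : Function.Injective φ.even := by
    have h := hA.injective_of_stalkMap_injective (hφ.2 (Classical.arbitrary _)).1
    exact fun a b e => Subtype.ext (h (congrArg Subtype.val e))
  have hnil : ∀ {a : evenSub A}, IsNilpotent (φ.even a) ↔ IsNilpotent a :=
    IsNilpotent.map_iff hinj
  have hprime : (nilradical (evenSub B)).IsPrime := by
    rw [← PrimeSpectrum.irreducibleSpace_iff_isPrime_nilradical]
    have := hA.irreducibleSpace
    have hp : PreirreducibleSpace (SpecTop B) := ⟨by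
      have h := (PreirreducibleSpace.isPreirreducible_univ (X := SpecTop A)).preimage hφ.1
      simpa using h⟩
    exact { toPreirreducibleSpace := hp, toNonempty := inferInstance }
  have hmul : ∀ {s t : evenSub B}, ¬ IsNilpotent s → ¬ IsNilpotent t → ¬ IsNilpotent (s * t) :=
    fun hs ht h => (hprime.mem_or_mem (mem_nilradical.2 h)).elim
      (fun h => hs (mem_nilradical.1 h)) fun h => ht (mem_nilradical.1 h)
  refine ⟨hprime, fun s hs b hb => ?_, fun b hb => ?_⟩
  · by_contra hb0
    -- The even annihilator of `b`. If `b ≠ 0` it lies in a maximal ideal, and the contradiction is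
    -- found at that point by producing an annihilator of `b` outside the ideal.
    let I : Ideal (evenSub B) :=
      { carrier := {r | r.1 * b = 0}
        add_mem' := fun {r r'} h h' => by
          change (r.1 + r'.1) * b = 0
          rw [add_mul, show r.1 * b = 0 from h, show r'.1 * b = 0 from h', add_zero]
        zero_mem' := zero_mul b
        smul_mem' := fun c r h => by
          change (c.1 * r.1) * b = 0
          rw [mul_assoc, show r.1 * b = 0 from h, mul_zero] }
    have hI : I ≠ ⊤ := fun h => hb0 (by
      have : (1 : evenSub B) ∈ I := h ▸ Submodule.mem_top
      simpa using (show (1 : B) * b = 0 from this))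
    obtain ⟨P, hP, hIP⟩ := Ideal.exists_le_maximal I hI
    let y : SpecTop B := ⟨P, hP.isPrime⟩
    obtain ⟨t, ht, s', hs', a, e⟩ := SuperHom.exists_even_of_stalkMap_surjective (hφ.2 y).2 s
    obtain ⟨t', ht', s'', hs'', c, e'⟩ := SuperHom.exists_of_stalkMap_surjective (hφ.2 y).2 b
    have ha : ¬ IsNilpotent a := by
      intro h
      refine hmul (not_isNilpotent_of_notMem ht)
        (hmul (mt hnil.1 (not_isNilpotent_of_notMem hs')) hs) ?_
      rw [e]
      exact (Commute.all _ _).isNilpotent_mul_left (hnil.2 h)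
    have htt : t * t' ∉ y.asIdeal := fun h => (y.2.mem_or_mem h).elim ht ht'
    -- At `y`, `s` is the fraction `a / s'` and `b` is `c / s''`, so `s b = 0` forces the image of
    -- `a c` to vanish after multiplication by `t t'`. Since `a` is not nilpotent, this gives `c =
    -- 0` in `A`.
    have e2 : (t * t').1 * φ.toAlgHom (a.1 * c) = 0 := by
      have e1 : t.1 * (φ.toAlgHom s'.1 * s.1) = t.1 * φ.toAlgHom a.1 := congrArg Subtype.val e
      calc t.1 * t'.1 * φ.toAlgHom (a.1 * c)
          = t.1 * φ.toAlgHom a.1 * (t'.1 * φ.toAlgHom c) := by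
            rw [map_mul, mul_assoc, mul_assoc, ← mul_assoc t'.1, even_comm t'.2, mul_assoc]
        _ = t.1 * (φ.toAlgHom s'.1 * s.1) * (t'.1 * (φ.toAlgHom s''.1 * b)) := by rw [e1, e']
        _ = t.1 * φ.toAlgHom s'.1 * t'.1 * φ.toAlgHom s''.1 * (s.1 * b) := by
            simp only [mul_assoc]
            rw [← mul_assoc s.1 t'.1, even_comm s.2 t'.1, mul_assoc, ← mul_assoc s.1,
              even_comm s.2 (φ.toAlgHom s''.1), mul_assoc]
        _ = 0 := by rw [hb, mul_zero]
    obtain ⟨u, hu, e3⟩ := SuperHom.exists_of_stalkMap_injective (hφ.2 y).1 htt e2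
    have hc : c = 0 := hA.regular a ha _ (hA.regular u (not_isNilpotent_of_notMem hu) _ e3)
    have hmem : t' * φ.even s'' ∈ I := by
      change t'.1 * φ.toAlgHom s''.1 * b = 0
      rw [mul_assoc, e', hc, map_zero, mul_zero]
    exact (y.2.mem_or_mem (hIP hmem)).elim ht' hs''
  · let y : SpecTop B := Classical.arbitrary _
    obtain ⟨t, ht, s, hs, a, e⟩ := SuperHom.exists_even_of_stalkMap_surjective (hφ.2 y).2 b
    have ht' := not_isNilpotent_of_notMem ht
    have ha : IsNilpotent a := by
      by_contra ha
      refine hmul ht' (mt hnil.1 ha) ?_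
      rw [← e]
      exact (Commute.all _ _).isNilpotent_mul_left ((Commute.all _ _).isNilpotent_mul_left hb)
    obtain ⟨r, hr, hra⟩ := hA.mem_oddIdeal a ha
    refine ⟨φ.even r * (t * φ.even s), hmul (mt hnil.1 hr)
      (hmul ht' (mt hnil.1 (not_isNilpotent_of_notMem hs))), ?_⟩
    have e1 : t.1 * (φ.toAlgHom s.1 * b.1) = t.1 * φ.toAlgHom a.1 := congrArg Subtype.val e
    have e2 : (φ.even r * (t * φ.even s)).1 * b.1 = t.1 * φ.toAlgHom (r.1 * a.1) := by
      change φ.toAlgHom r.1 * (t.1 * φ.toAlgHom s.1) * b.1 = _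
      rw [mul_assoc, mul_assoc, e1, map_mul, ← mul_assoc, even_comm t.2 (φ.toAlgHom r.1 * _),
        mul_assoc, even_comm t.2 (φ.toAlgHom a.1), mul_assoc]
    rw [e2]
    exact mul_oddIdeal_mem (SuperHom.map_mem_oddIdeal hra) _

/-- A superscheme `Spec A` with `A` integral is reduced. -/
theorem specIsReduced {A : Type u} [Ring A] [Algebra ℂ A] [SuperCommAlgebra A]
    (hA : IsIntegralSuperring A) : SpecIsReduced A := by
  intro B _ _ _ φ hφ
  -- The empty open subset corresponds to the zero ring, which is reduced for trivial reasons but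
  -- not integral.
  rcases isEmpty_or_nonempty (SpecTop B) with h | h
  · have h0 : Subsingleton (evenSub B) := PrimeSpectrum.isEmpty_iff_subsingleton.1 h
    have h1 : (1 : B) = 0 := congrArg Subtype.val (Subsingleton.elim (1 : evenSub B) 0)
    have hB : Subsingleton B := subsingleton_of_zero_eq_one h1.symm
    have hQ : Subsingleton (bodyIdeal B).ringCon.Quotient :=
      ((bodyIdeal B).ringCon.mk'_surjective).subsingleton
    refine ⟨fun a => ?_, ?_⟩
    · rw [Subsingleton.elim a 0]
      exact ⟨fun _ => IsNilpotent.zero, fun _ => zero_mem _⟩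
    · have e : ∀ (R : Type u) [Ring R] [Subsingleton R], zdiv R = ∅ := fun R _ _ =>
        Set.eq_empty_of_forall_notMem fun a ⟨b, hb, _⟩ => hb (Subsingleton.elim _ _)
      rw [e B, e, Set.image_empty]
  · exact (hA.of_isOpenImmersion hφ).isReducedSuperring

end IsIntegralSuperring

/-! ### Principal localizations -/

section PrincipalLocalization

variable {A B : Type*} [Ring A] [Algebra ℂ A] [SuperCommAlgebra A]
  [Ring B] [Algebra ℂ B] [SuperCommAlgebra B]

/-- A homomorphism `φ : A → B` that identifies `B` with `A[f⁻¹]`, where `f ∈ A₀` is regular. -/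
structure IsPrincipalLocalization (φ : SuperHom A B) (f : evenSub A) : Prop where
  injective : Function.Injective φ.toAlgHom
  isUnit : IsUnit (φ.toAlgHom f.1)
  exists_pow : ∀ b : B, ∃ (n : ℕ) (a : A), φ.toAlgHom a = φ.toAlgHom f.1 ^ n * b

namespace IsPrincipalLocalization

variable {φ : SuperHom A B} {f : evenSub A}

theorem even_injective (h : IsPrincipalLocalization φ f) : Function.Injective φ.even := fun _ _ e =>
  Subtype.ext (h.injective (congrArg Subtype.val e))

theorem isNilpotent_iff (h : IsPrincipalLocalization φ f) {a : evenSub A} :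
    IsNilpotent (φ.even a) ↔ IsNilpotent a :=
  IsNilpotent.map_iff h.even_injective

/-- `fⁿ b` is homogeneous, so the component of the numerator of the same parity already maps to it.
-/
theorem exists_pow_of_mem_part (h : IsPrincipalLocalization φ f) {i : ZMod 2} {b : B}
    (hb : b ∈ part B i) :
    ∃ (n : ℕ) (a : A), a ∈ part A i ∧ φ.toAlgHom a = φ.toAlgHom f.1 ^ n * b := by
  obtain ⟨n, a, e⟩ := h.exists_pow b
  obtain ⟨a₀, h₀, a₁, h₁, rfl⟩ := exists_parts a
  have hf : φ.toAlgHom f.1 ^ n ∈ part B 0 := (φ.even f ^ n).2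
  have hfb := even_mul_part hf hb
  have key : ∀ k : ZMod 2, k = 0 ∨ k = 1 := by decide
  rw [map_add] at e
  obtain rfl | rfl := key i
  · exact ⟨n, a₀, h₀, (parts_ext (e.trans (add_zero _).symm) (φ.map_part 0 _ h₀)
      (φ.map_part 1 _ h₁) hfb (zero_mem _)).1⟩
  · exact ⟨n, a₁, h₁, (parts_ext (e.trans (zero_add _).symm) (φ.map_part 0 _ h₀)
      (φ.map_part 1 _ h₁) (zero_mem _) hfb).2⟩

/-- The even component of an inverse of an even element is again an inverse. -/
theorem even_isUnit (h : IsPrincipalLocalization φ f) : IsUnit (φ.even f) := by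
  obtain ⟨u, hu⟩ := h.isUnit
  obtain ⟨b₀, h₀, b₁, h₁, e⟩ := exists_parts (↑u⁻¹ : B)
  have e1 : φ.toAlgHom f.1 * b₀ + φ.toAlgHom f.1 * b₁ = 1 + 0 := by
    rw [← mul_add, ← e, ← hu, Units.mul_inv, add_zero]
  have hf := φ.map_part 0 _ f.2
  exact IsUnit.of_mul_eq_one (⟨b₀, h₀⟩ : evenSub B) (Subtype.ext
    (parts_ext e1 (even_mul_part hf h₀) (even_mul_part hf h₁)
      SuperCommAlgebra.one_mem (zero_mem _)).1)

theorem exists_pow_even (h : IsPrincipalLocalization φ f) (b : evenSub B) :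
    ∃ (n : ℕ) (a : evenSub A), φ.even a = φ.even f ^ n * b := by
  obtain ⟨n, a, ha, e⟩ := h.exists_pow_of_mem_part b.2
  exact ⟨n, ⟨a, ha⟩, Subtype.ext e⟩

/-- On even parts this is an ordinary localization at one element, whence the open embedding. On
stalks, powers of `f` avoid every prime of `B`, so they can be used freely to clear denominators. -/
theorem isOpenImmersion (h : IsPrincipalLocalization φ f) : φ.IsOpenImmersion := by
  constructor
  · let _ : Algebra (evenSub A) (evenSub B) := φ.even.toAlgebra
    have : IsLocalization.Away f (evenSub B) := by
      refine ⟨?_, ?_, ?_⟩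
      · rintro ⟨_, n, rfl⟩
        change IsUnit (φ.even (f ^ n))
        rw [map_pow]
        exact h.even_isUnit.pow n
      · intro b
        obtain ⟨n, a, e⟩ := h.exists_pow_even b
        refine ⟨⟨a, ⟨f ^ n, n, rfl⟩⟩, ?_⟩
        change b * φ.even (f ^ n) = φ.even a
        rw [e, map_pow, mul_comm]
      · intro a b e
        exact ⟨1, by rw [h.even_injective e]⟩
    exact PrimeSpectrum.localization_away_isOpenEmbedding (evenSub B) f
  · intro y
    have hfy : ∀ n, φ.even f ^ n ∉ y.asIdeal := fun n hn =>
      y.2.ne_top (Ideal.eq_top_of_isUnit_mem _ hn (h.even_isUnit.pow n))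
    constructor
    · intro z z' e
      induction z using LocalizedModule.induction_on with
      | h a s =>
      induction z' using LocalizedModule.induction_on with
      | h b t =>
        change LocalizedModule.mk (φ.toAlgHom a) _ = LocalizedModule.mk (φ.toAlgHom b) _ at e
        obtain ⟨u, hu⟩ := LocalizedModule.mk_eq.1 e
        have hu' : u.1.1 * (φ.toAlgHom t.1.1 * φ.toAlgHom a) =
          u.1.1 * (φ.toAlgHom s.1.1 * φ.toAlgHom b) := hu
        obtain ⟨n, c, hc⟩ := h.exists_pow_even u.1
        have hcy : c ∉ (φ.specMap y).asIdeal := by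
          change φ.even c ∉ y.asIdeal
          rw [hc]
          exact fun hm => (y.2.mem_or_mem hm).elim (hfy n) u.2
        refine LocalizedModule.mk_eq.2 ⟨⟨c, hcy⟩, ?_⟩
        change c.1 * (t.1.1 * a) = c.1 * (s.1.1 * b)
        apply h.injective
        have hc' : φ.toAlgHom c.1 = φ.toAlgHom f.1 ^ n * u.1.1 := congrArg Subtype.val hc
        simp only [map_mul, hc', mul_assoc, hu']
    · intro z
      induction z using LocalizedModule.induction_on with
      | h b u =>
        obtain ⟨n, a, ha⟩ := h.exists_pow b
        obtain ⟨k, c, hc⟩ := h.exists_pow_even u.1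
        have hcy : c * f ^ n ∉ (φ.specMap y).asIdeal := by
          change φ.even (c * f ^ n) ∉ y.asIdeal
          rw [map_mul, hc, map_pow]
          exact fun hm => (y.2.mem_or_mem hm).elim
            (fun hm => (y.2.mem_or_mem hm).elim (hfy k) u.2) (hfy n)
        -- Here `a` maps to `fⁿ b` and `c` to `fᵏ u`, so `fᵏ a / (c fⁿ)` maps to `b / u`.
        refine ⟨LocalizedModule.mk (f.1 ^ k * a) ⟨c * f ^ n, hcy⟩, ?_⟩
        change LocalizedModule.mk (φ.toAlgHom (f.1 ^ k * a)) _ = LocalizedModule.mk b u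
        refine LocalizedModule.mk_eq.2 ⟨1, ?_⟩
        have hc' : φ.toAlgHom c.1 = φ.toAlgHom f.1 ^ k * u.1.1 := congrArg Subtype.val hc
        change (1 : B) * (u.1.1 * φ.toAlgHom (f.1 ^ k * a)) =
          1 * (φ.toAlgHom (c.1 * f.1 ^ n) * b)
        have hfk : φ.toAlgHom f.1 ^ k ∈ part B 0 := (φ.even f ^ k).2
        simp only [one_mul, map_mul, map_pow, ha, hc', mul_assoc]
        rw [← mul_assoc, ← even_comm hfk, mul_assoc]

theorem exists_not_isNilpotent (h : IsPrincipalLocalization φ f) {b : evenSub B}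
    (hb : ¬ IsNilpotent b) :
    ∃ (n : ℕ) (a : evenSub A), ¬ IsNilpotent a ∧ φ.even a = φ.even f ^ n * b := by
  obtain ⟨n, a, e⟩ := h.exists_pow_even b
  refine ⟨n, a, fun ha => hb ?_, e⟩
  obtain ⟨u, hu⟩ := h.even_isUnit.pow n
  have hn := (Commute.all (↑u⁻¹ : evenSub B) _).isNilpotent_mul_left (h.isNilpotent_iff.2 ha)
  rwa [e, ← hu, Units.inv_mul_cancel_left] at hn

theorem not_isNilpotent_pow (h : IsPrincipalLocalization φ f) (hB : IsIntegralSuperring B)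
    (k : ℕ) : ¬ IsNilpotent (f ^ k) :=
  fun hf => hB.not_isNilpotent_one <| by
    have hn := h.isNilpotent_iff.2 hf
    obtain ⟨u, hu⟩ := h.even_isUnit.pow k
    have := (Commute.all (↑u⁻¹ : evenSub B) _).isNilpotent_mul_left hn
    rwa [map_pow, ← hu, Units.inv_mul] at this

/-- Primality and regularity are contracted along the injection. For the third condition, an element
of the odd ideal of `B` comes from the odd ideal of `A` after multiplication by a power of `f`. -/
theorem isIntegralSuperring (h : IsPrincipalLocalization φ f) (hB : IsIntegralSuperring B) :
    IsIntegralSuperring A := by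
  refine ⟨?_, fun s hs a ha => ?_, fun a ha => ?_⟩
  · have := hB.nilradical_prime
    have e : nilradical (evenSub A) = (nilradical (evenSub B)).comap φ.even := by
      ext a
      rw [Ideal.mem_comap, mem_nilradical, mem_nilradical, h.isNilpotent_iff]
    rw [e]
    exact Ideal.IsPrime.comap _
  · apply h.injective
    rw [map_zero]
    refine hB.regular (φ.even s) (mt h.isNilpotent_iff.1 hs) _ ?_
    change φ.toAlgHom s.1 * _ = 0
    rw [← map_mul, ha, map_zero]
  · have key : ∀ b ∈ oddIdeal B, ∃ (n : ℕ), ∃ a ∈ oddIdeal A,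
        φ.toAlgHom a = φ.toAlgHom f.1 ^ n * b := by
      intro b hb
      have hfk : ∀ k, φ.toAlgHom f.1 ^ k ∈ part B 0 := fun k => (φ.even f ^ k).2
      induction hb using Submodule.mul_induction_on' with
      | mem_mul_mem o ho x _ =>
        obtain ⟨n, a, ha, e⟩ := h.exists_pow_of_mem_part ho
        obtain ⟨k, c, e'⟩ := h.exists_pow x
        refine ⟨n + k, a * c, oddIdeal_mul_mem (odd_mem_oddIdeal ha) c, ?_⟩
        rw [map_mul, e, e', pow_add, mul_assoc, ← mul_assoc o, ← even_comm (hfk k) o]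
        simp only [mul_assoc]
      | add x _ y _ hx hy =>
        obtain ⟨n, a, ha, e⟩ := hx
        obtain ⟨k, c, hc, e'⟩ := hy
        refine ⟨n + k, f.1 ^ k * a + f.1 ^ n * c,
          add_mem (mul_oddIdeal_mem ha _) (mul_oddIdeal_mem hc _), ?_⟩
        simp only [map_add, map_mul, map_pow, e, e', mul_add, ← mul_assoc, ← pow_add]
        rw [add_comm k n]
    obtain ⟨t, ht, hm⟩ := hB.mem_oddIdeal _ (h.isNilpotent_iff.2 ha)
    obtain ⟨n, c, hcn, hc⟩ := h.exists_not_isNilpotent ht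
    obtain ⟨k, a', ha', e⟩ := key _ hm
    have hA' : φ.toAlgHom (f.1 ^ k * c.1 * a.1) = φ.toAlgHom (f.1 ^ n * a') := by
      have hc' : φ.toAlgHom c.1 = φ.toAlgHom f.1 ^ n * t.1 := congrArg Subtype.val hc
      simp only [map_mul, map_pow, hc', e, ← mul_assoc, ← pow_add]
      rw [add_comm k n]
      rfl
    refine ⟨f ^ k * c, fun hn => ?_, ?_⟩
    · rw [← h.isNilpotent_iff, map_mul] at hn
      exact hB.not_isNilpotent_mul (mt h.isNilpotent_iff.1 (h.not_isNilpotent_pow hB k))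
        (mt h.isNilpotent_iff.1 hcn) hn
    · change f.1 ^ k * c.1 * a.1 ∈ _
      rw [h.injective hA']
      exact mul_oddIdeal_mem ha' _

end IsPrincipalLocalization

end PrincipalLocalization

/-! ### Localizations as rings -/

section LocalizedRing

variable {A : Type*} [Ring A] [Algebra ℂ A] [SuperCommAlgebra A]

/-- A recognition principle for localizations as rings: `S` becomes invertible and central in `E`,
and every element of `E` has a denominator in `S`. The module isomorphism is multiplicative because
this can be tested after multiplying by the unit `g (s t)`. -/
theorem exists_localization_equiv {E : Type*} [Ring E] (S : Submonoid (evenSub A)) (g : A →+* E)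
    (hinj : Function.Injective g) (hcomm : ∀ (s : evenSub A) (x : E), g s.1 * x = x * g s.1)
    (hunit : ∀ s ∈ S, IsUnit (g s.1)) (hsurj : ∀ x : E, ∃ s ∈ S, ∃ a : A, g s.1 * x = g a) :
    ∃ e : LocalizedModule S A ≃+* E,
      ∀ (a : A) (s : S), g s.1.1 * e (LocalizedModule.mk a s) = g a := by
  let _ : Module (evenSub A) E := Module.compHom E (g.comp (evenSub A).val.toRingHom)
  let G : A →ₗ[evenSub A] E :=
    { toFun := g, map_add' := map_add g, map_smul' := fun s a => map_mul g s.1 a }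
  have hG : IsLocalizedModule S G := by
    refine ⟨fun s => ?_, fun x => ?_, fun {a b} e => ⟨1, by rw [hinj e]⟩⟩
    · rw [Module.End.isUnit_iff]
      exact IsUnit.isUnit_iff_mulLeft_bijective.1 (hunit _ s.2)
    · obtain ⟨s, hs, a, e⟩ := hsurj x
      exact ⟨⟨a, ⟨s, hs⟩⟩, e⟩
  have hmk : ∀ (a : A) (s : S),
      g s.1.1 * IsLocalizedModule.iso S G (LocalizedModule.mk a s) = g a := by
    intro a s
    obtain ⟨u, hu⟩ := hunit _ s.2
    have hx : g s.1.1 * (↑u⁻¹ * g a) = g a := by rw [← hu, Units.mul_inv_cancel_left]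
    rw [← IsLocalizedModule.iso_symm_apply' S G (↑u⁻¹ * g a) a s hx, LinearEquiv.apply_symm_apply,
      hx]
  refine ⟨{ (IsLocalizedModule.iso S G).toAddEquiv with map_mul' := fun z w => ?_ }, hmk⟩
  induction z using LocalizedModule.induction_on with
  | h a s =>
  induction w using LocalizedModule.induction_on with
  | h b t =>
    change IsLocalizedModule.iso S G (LocalizedModule.mk a s * LocalizedModule.mk b t) =
      IsLocalizedModule.iso S G (LocalizedModule.mk a s) *
        IsLocalizedModule.iso S G (LocalizedModule.mk b t)
    apply ((hunit _ (s * t).2).mul_right_injective)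
    beta_reduce
    rw [LocalizedModule.mk_mul_mk, hmk]
    change g (a * b) = g (s.1.1 * t.1.1) * _
    rw [map_mul, map_mul, mul_assoc, ← mul_assoc (g t.1.1), hcomm t.1, mul_assoc, hmk,
      ← mul_assoc, hmk]

end LocalizedRing

/-! ### The body of a superalgebra of (Laurent) polynomials -/

section Body

open AddMonoidAlgebra

variable {M ι : Type*} [AddCommMonoid M]

variable (M ι) in
/-- The homomorphism setting the odd variables to zero. -/
def body : SuperPoly M ι →ₐ[ℂ] AddMonoidAlgebra ℂ M :=
  mapAlgHom M ExteriorAlgebra.algebraMapInv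

variable (M ι) in
/-- The inclusion of the polynomials in the even variables. -/
def ofBody : AddMonoidAlgebra ℂ M →ₐ[ℂ] SuperPoly M ι :=
  mapAlgHom M (Algebra.ofId ℂ _)

theorem ofBody_single (m : M) (c : ℂ) :
    ofBody M ι (single m c) = single m (algebraMap ℂ _ c) := by
  simp [ofBody, Algebra.ofId_apply]

theorem ofBody_mem (p : AddMonoidAlgebra ℂ M) : ofBody M ι p ∈ part (SuperPoly M ι) 0 := by
  induction p using AddMonoidAlgebra.induction_linear with
  | zero => rw [map_zero]; exact zero_mem _
  | add f g hf hg => rw [map_add]; exact add_mem hf hg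
  | single m c =>
    rw [ofBody_single]
    exact single_mem_polyPart (CliffordAlgebra.even (0 : QuadraticForm ℂ (ι → ℂ)) |>.algebraMap_mem c) m

theorem body_ofBody (p : AddMonoidAlgebra ℂ M) : body M ι (ofBody M ι p) = p := by
  induction p using AddMonoidAlgebra.induction_linear with
  | zero => simp
  | add f g hf hg => rw [map_add, map_add, hf, hg]
  | single m c =>
    rw [ofBody_single, body, mapAlgHom_single, ExteriorAlgebra.algebraMap_leftInverse]

theorem sub_ofBody_body_mem (f : SuperPoly M ι) :
    f - ofBody M ι (body M ι f) ∈ oddIdeal (SuperPoly M ι) := by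
  induction f using AddMonoidAlgebra.induction_linear with
  | zero => simp
  | add f g hf hg =>
    rw [map_add, map_add, add_sub_add_comm]; exact add_mem hf hg
  | single m c =>
    rw [body, mapAlgHom_single, ofBody_single, ← single_sub]
    induction c using ExteriorAlgebra.induction with
    | algebraMap r => rw [AlgHom.commutes]; simp
    | ι v =>
      have : ExteriorAlgebra.algebraMapInv (ExteriorAlgebra.ι ℂ v) = 0 := by
        simp [ExteriorAlgebra.algebraMapInv]
      rw [this, map_zero, sub_zero]
      exact odd_mem_oddIdeal (single_mem_polyPart (CliffordAlgebra.ι_mem_evenOdd_one _ _) m)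
    | mul a b ha hb =>
      -- With ε the augmentation, `ab - ε(ab) = (a - ε(a)) b + ε(a) (b - ε(b))`, which carries the
      -- claim from factors to products.
      have e : single m (a * b - algebraMap ℂ _ (ExteriorAlgebra.algebraMapInv (a * b))) =
          single m (a - algebraMap ℂ _ (ExteriorAlgebra.algebraMapInv a)) * single 0 b +
          ExteriorAlgebra.algebraMapInv a •
            single m (b - algebraMap ℂ _ (ExteriorAlgebra.algebraMapInv b)) := by
        rw [single_mul_single, add_zero, smul_single, ← single_add, map_mul, map_mul,
          Algebra.smul_def]
        congr 1
        simp only [sub_mul, mul_sub]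
        abel
      rw [e]
      exact add_mem (oddIdeal_mul_mem ha _) (Submodule.smul_mem _ _ hb)
    | add a b ha hb =>
      rw [map_add, map_add, add_sub_add_comm, single_add]; exact add_mem ha hb

/-- The coefficientwise application of a linear functional. -/
def coeffFunctional (ℓ : Module.Dual ℂ (ExteriorAlgebra ℂ (ι → ℂ))) :
    SuperPoly M ι →ₗ[ℂ] AddMonoidAlgebra ℂ M :=
  (coeffLinearEquiv ℂ).symm.toLinearMap ∘ₗ Finsupp.mapRange.linearMap ℓ ∘ₗ
    (coeffLinearEquiv ℂ).toLinearMap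

theorem coeffFunctional_single (ℓ : Module.Dual ℂ (ExteriorAlgebra ℂ (ι → ℂ))) (m : M)
    (c : ExteriorAlgebra ℂ (ι → ℂ)) : coeffFunctional ℓ (single m c) = single m (ℓ c) := by
  ext n
  simp [coeffFunctional]

/-- Linear functionals separate the points of a complex vector space. Applying them coefficientwise
moves torsion questions from `SuperPoly M ι` to the commutative ring of even polynomials, without
choosing a basis of the exterior algebra. -/
theorem eq_zero_of_coeffFunctional {f : SuperPoly M ι}
    (h : ∀ ℓ : Module.Dual ℂ (ExteriorAlgebra ℂ (ι → ℂ)), coeffFunctional ℓ f = 0) : f = 0 := by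
  ext m
  rw [coeff_zero, Finsupp.zero_apply, ← Module.forall_dual_apply_eq_zero_iff ℂ]
  intro ℓ
  simpa [coeffFunctional] using DFunLike.congr_fun (congrArg coeff (h ℓ)) m

theorem coeffFunctional_ofBody_mul (ℓ : Module.Dual ℂ (ExteriorAlgebra ℂ (ι → ℂ)))
    (p : AddMonoidAlgebra ℂ M) (f : SuperPoly M ι) :
    coeffFunctional ℓ (ofBody M ι p * f) = p * coeffFunctional ℓ f := by
  induction p using AddMonoidAlgebra.induction_linear with
  | zero => simp
  | add p q hp hq => rw [map_add, add_mul, map_add, hp, hq, add_mul]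
  | single m c =>
    induction f using AddMonoidAlgebra.induction_linear with
    | zero => simp
    | add f g hf hg => rw [mul_add, map_add, hf, hg, map_add, mul_add]
    | single n d =>
      rw [ofBody_single, single_mul_single, coeffFunctional_single, coeffFunctional_single,
        single_mul_single, ← Algebra.smul_def, map_smul, smul_eq_mul]

variable [IsDomain (AddMonoidAlgebra ℂ M)]

theorem isNilpotent_iff_body {f : SuperPoly M ι} : IsNilpotent f ↔ body M ι f = 0 := by
  refine ⟨fun h => (h.map (body M ι)).eq_zero, fun h => ?_⟩
  have := sub_ofBody_body_mem f
  rw [h, map_zero, sub_zero] at this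
  exact isNilpotent_of_mem_oddIdeal this

/-- Nilpotents are exactly the elements with zero body, so primality comes from the body being a
domain. A non-nilpotent even `s` differs from its nonzero body by a nilpotent, hence divides a power
of the body, and the body acts without torsion. -/
theorem isIntegralSuperring_superPoly : IsIntegralSuperring (SuperPoly M ι) := by
  have hnil : ∀ {s : evenSub (SuperPoly M ι)}, IsNilpotent s ↔ body M ι s.1 = 0 :=
    isNilpotent_evenSub_iff.trans isNilpotent_iff_body
  have h1 : ¬ IsNilpotent (1 : evenSub (SuperPoly M ι)) := by
    rw [hnil]; simp
  refine ⟨⟨fun h => h1 (mem_nilradical.1 (h ▸ Submodule.mem_top)), fun {a b} h => ?_⟩,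
    fun s hs a ha => ?_, fun a ha => ⟨1, h1, ?_⟩⟩
  · simp only [mem_nilradical, hnil] at h ⊢
    exact mul_eq_zero.1 ((map_mul (body M ι) a.1 b.1).symm.trans h)
  · rw [hnil] at hs
    set β := body M ι s.1 with hβ
    let b : evenSub (SuperPoly M ι) := ⟨ofBody M ι β, ofBody_mem β⟩
    obtain ⟨k, hk⟩ : IsNilpotent (b - s) := hnil.2 (by
      change body M ι (ofBody M ι β - s.1) = 0
      rw [map_sub, body_ofBody, hβ, sub_self])
    -- `b - (b - s)` divides `bᵏ - (b - s)ᵏ`, and the last power is zero.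
    have hd : s ∣ b ^ k := by
      have := sub_dvd_pow_sub_pow b (b - s) k
      rwa [hk, sub_zero, sub_sub_cancel] at this
    obtain ⟨r, hr⟩ := hd
    have hz : ofBody M ι (β ^ k) * a = 0 := by
      have : ofBody M ι (β ^ k) = s.1 * r.1 := by
        rw [map_pow]; exact congrArg Subtype.val hr
      rw [this, even_comm s.2, mul_assoc, ha, mul_zero]
    refine eq_zero_of_coeffFunctional fun ℓ => ?_
    have := congrArg (coeffFunctional ℓ) hz
    rw [coeffFunctional_ofBody_mul, map_zero] at this
    exact (mul_eq_zero.1 this).resolve_left (pow_ne_zero _ hs)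
  · have := sub_ofBody_body_mem a.1
    rw [hnil.1 ha, map_zero, sub_zero] at this
    simpa using this

end Body

/-! ### The generic stalk -/

section Generic

open AddMonoidAlgebra TensorProduct

theorem baseChange_zero (R : Type*) [CommRing R] [Algebra ℂ R] (V : Type*) [AddCommGroup V]
    [Module ℂ V] : QuadraticForm.baseChange R (0 : QuadraticForm ℂ V) = 0 := by
  simp [QuadraticForm.baseChange, QuadraticForm.tmul]

/-- Base change of exterior algebras, with its compatibility with parities. -/
theorem exists_exteriorAlgebra_baseChange (R : Type*) [CommRing R] [Algebra ℂ R] (V : Type*)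
    [AddCommGroup V] [Module ℂ V] :
    ∃ e : R ⊗[ℂ] ExteriorAlgebra ℂ V ≃ₐ[R] ExteriorAlgebra R (R ⊗[ℂ] V),
      ∀ (i : ZMod 2) (r : R) (c : ExteriorAlgebra ℂ V),
        c ∈ CliffordAlgebra.evenOdd (0 : QuadraticForm ℂ V) i →
        e (r ⊗ₜ c) ∈ CliffordAlgebra.evenOdd (0 : QuadraticForm R (R ⊗[ℂ] V)) i := by
  obtain ⟨e, he⟩ : ∃ e : R ⊗[ℂ] ExteriorAlgebra ℂ V ≃ₐ[R] ExteriorAlgebra R (R ⊗[ℂ] V),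
      ∀ v : V, e (1 ⊗ₜ CliffordAlgebra.ι 0 v) = CliffordAlgebra.ι 0 (1 ⊗ₜ v) := by
    -- The base change of the zero form equals the zero form only propositionally; stating the claim
    -- for a variable form `Q` allows substitution inside the type of Clifford algebras.
    have key : ∀ Q : QuadraticForm R (R ⊗[ℂ] V),
        QuadraticForm.baseChange R (0 : QuadraticForm ℂ V) = Q →
        ∃ e : R ⊗[ℂ] CliffordAlgebra (0 : QuadraticForm ℂ V) ≃ₐ[R] CliffordAlgebra Q,
          ∀ v : V, e (1 ⊗ₜ CliffordAlgebra.ι 0 v) = CliffordAlgebra.ι Q (1 ⊗ₜ v) := by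
      rintro _ rfl
      exact ⟨(CliffordAlgebra.equivBaseChange R 0).symm, fun v =>
        CliffordAlgebra.ofBaseChange_tmul_ι R 0 1 v⟩
    exact key 0 (baseChange_zero R V)
  have hι : ∀ v w (x : ExteriorAlgebra ℂ V),
      e (1 ⊗ₜ (CliffordAlgebra.ι 0 v * CliffordAlgebra.ι 0 w * x)) =
        CliffordAlgebra.ι 0 (1 ⊗ₜ v) * CliffordAlgebra.ι 0 (1 ⊗ₜ w) * e (1 ⊗ₜ x) := by
    have hm : ∀ a b : ExteriorAlgebra ℂ V, e (1 ⊗ₜ (a * b)) = e (1 ⊗ₜ a) * e (1 ⊗ₜ b) := by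
      intro a b
      rw [← map_mul e, Algebra.TensorProduct.tmul_mul_tmul, one_mul]
    intro v w x
    rw [hm, hm, he, he]
  have hmul : ∀ (i : ZMod 2) v w (x : ExteriorAlgebra R (R ⊗[ℂ] V)),
      x ∈ CliffordAlgebra.evenOdd (0 : QuadraticForm R (R ⊗[ℂ] V)) i →
      CliffordAlgebra.ι 0 v * CliffordAlgebra.ι 0 w * x ∈
        CliffordAlgebra.evenOdd (0 : QuadraticForm R (R ⊗[ℂ] V)) i := by
    intro i v w x hx
    have := SetLike.mul_mem_graded (CliffordAlgebra.ι_mul_ι_mem_evenOdd_zero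
      (0 : QuadraticForm R (R ⊗[ℂ] V)) v w) hx
    rwa [zero_add] at this
  refine ⟨e, fun i r c hc => ?_⟩
  have e1 : r ⊗ₜ[ℂ] c = r • ((1 : R) ⊗ₜ[ℂ] c) := by
    rw [TensorProduct.smul_tmul', smul_eq_mul, mul_one]
  rw [e1, map_smul]
  refine Submodule.smul_mem _ _ ?_
  clear e1
  have key : ∀ k : ZMod 2, k = 0 ∨ k = 1 := by decide
  obtain rfl | rfl := key i
  · induction c, hc using CliffordAlgebra.even_induction with
    | algebraMap z =>
      have : (1 : R) ⊗ₜ[ℂ] algebraMap ℂ (CliffordAlgebra (0 : QuadraticForm ℂ V)) z =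
          algebraMap R _ (algebraMap ℂ R z) := by
        rw [Algebra.algebraMap_eq_smul_one, ← TensorProduct.smul_tmul,
          Algebra.TensorProduct.algebraMap_apply, ← Algebra.algebraMap_eq_smul_one]
        rfl
      rw [this]
      erw [AlgEquiv.commutes]
      exact (CliffordAlgebra.even (0 : QuadraticForm R (R ⊗[ℂ] V))).algebraMap_mem _
    | add x y _ _ hx hy =>
      rw [TensorProduct.tmul_add, map_add]; exact add_mem hx hy
    | ι_mul_ι_mul v w x _ hx => rw [hι]; exact hmul 0 _ _ _ hx
  · induction c, hc using CliffordAlgebra.odd_induction with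
    | ι v => rw [he]; exact CliffordAlgebra.ι_mem_evenOdd_one _ _
    | add x y _ _ hx hy =>
      rw [TensorProduct.tmul_add, map_add]; exact add_mem hx hy
    | ι_mul_ι_mul v w x _ hx => rw [hι]; exact hmul 1 _ _ _ hx

variable {M ι : Type*} [AddCommMonoid M] (R : Type*) [CommRing R] [Algebra ℂ R]
  [Algebra (AddMonoidAlgebra ℂ M) R]

/-- The inclusion of the polynomials with odd variables into the exterior algebra over an
extension ring of the ring of polynomials in the even variables. -/
def toTensor : SuperPoly M ι →+* R ⊗[ℂ] ExteriorAlgebra ℂ (ι → ℂ) :=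
  AddMonoidAlgebra.liftNCRingHom
    (Algebra.TensorProduct.includeRight : ExteriorAlgebra ℂ (ι → ℂ) →ₐ[ℂ] _).toRingHom
    ((Algebra.TensorProduct.includeLeft (R := ℂ) (S := R) (A := R)
        (B := ExteriorAlgebra ℂ (ι → ℂ))).toMonoidHom.comp
      (((algebraMap (AddMonoidAlgebra ℂ M) R) : AddMonoidAlgebra ℂ M →* R).comp (of ℂ M)))
    (fun c m => by
      change (1 ⊗ₜ c) * (_ ⊗ₜ 1) = (_ ⊗ₜ 1) * (1 ⊗ₜ c)
      simp)

theorem toTensor_single (m : M) (c : ExteriorAlgebra ℂ (ι → ℂ)) :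
    toTensor R (single m c) = algebraMap (AddMonoidAlgebra ℂ M) R (single m 1) ⊗ₜ c := by
  refine (liftNC_single _ _ m c).trans ?_
  change (1 ⊗ₜ c) * (algebraMap (AddMonoidAlgebra ℂ M) R (single m 1) ⊗ₜ 1) = _
  simp

variable [IsScalarTower ℂ (AddMonoidAlgebra ℂ M) R]

theorem toTensor_ofBody (p : AddMonoidAlgebra ℂ M) :
    toTensor R (ofBody M ι p) = algebraMap (AddMonoidAlgebra ℂ M) R p ⊗ₜ 1 := by
  induction p using AddMonoidAlgebra.induction_linear with
  | zero => simp
  | add p q hp hq => rw [map_add, map_add, hp, hq, map_add, TensorProduct.add_tmul]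
  | single m z =>
    rw [ofBody_single, toTensor_single, Algebra.algebraMap_eq_smul_one (R := ℂ),
      ← TensorProduct.smul_tmul]
    congr 1
    rw [← IsScalarTower.coe_toAlgHom' ℂ (AddMonoidAlgebra ℂ M) R, ← map_smul, smul_single,
      smul_eq_mul, mul_one]

/-- Applying a functional to the exterior factor of the tensor product recovers the coefficientwise
functional, viewed in `R`. So an element of the kernel is killed by all coefficient functionals. -/
theorem toTensor_injective (hinj : Function.Injective (algebraMap (AddMonoidAlgebra ℂ M) R)) :
    Function.Injective (toTensor R : SuperPoly M ι →+* _) := by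
  rw [injective_iff_map_eq_zero]
  intro f hf
  refine eq_zero_of_coeffFunctional fun ℓ => hinj ?_
  have key : ∀ g : SuperPoly M ι, algebraMap (AddMonoidAlgebra ℂ M) R (coeffFunctional ℓ g) =
      TensorProduct.rid ℂ R (LinearMap.lTensor R ℓ (toTensor R g)) := by
    intro g
    induction g using AddMonoidAlgebra.induction_linear with
    | zero => simp
    | add g g' hg hg' => simp only [map_add, hg, hg']
    | single m c =>
      rw [coeffFunctional_single, toTensor_single, LinearMap.lTensor_tmul,
        TensorProduct.rid_tmul, ← IsScalarTower.coe_toAlgHom' ℂ (AddMonoidAlgebra ℂ M) R,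
        ← map_smul, smul_single, smul_eq_mul, mul_one]
  rw [key, hf, map_zero, map_zero, map_zero]

end Generic

/-! ### Generic fermionic regularity -/

section GenericRegularity

open AddMonoidAlgebra TensorProduct

variable {M ι : Type*} [AddCommMonoid M] (R : Type*) [CommRing R] [Algebra ℂ R]
  [Algebra (AddMonoidAlgebra ℂ M) R]

theorem toTensor_comm {f : SuperPoly M ι} (hf : f ∈ part (SuperPoly M ι) 0)
    (z : R ⊗[ℂ] ExteriorAlgebra ℂ (ι → ℂ)) : toTensor R f * z = z * toTensor R f := by
  refine polyPart_induction (p := fun f => toTensor R f * z = z * toTensor R f) hf ?_ ?_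
    fun m c hc => ?_
  · simp
  · intro f g hf hg
    beta_reduce at hf hg ⊢
    rw [map_add, add_mul, mul_add, hf, hg]
  · rw [toTensor_single]
    induction z using TensorProduct.induction_on with
    | zero => simp
    | tmul r d =>
      rw [Algebra.TensorProduct.tmul_mul_tmul, Algebra.TensorProduct.tmul_mul_tmul, mul_comm,
        even_central hc]
    | add z w hz hw => rw [mul_add, add_mul, hz, hw]

theorem toTensor_mem_parity {E : Type*} [Ring E] [Algebra R E] {P : Submodule R E}
    (e : R ⊗[ℂ] ExteriorAlgebra ℂ (ι → ℂ) ≃ₐ[R] E) {i : ZMod 2}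
    (he : ∀ (r : R) (c : ExteriorAlgebra ℂ (ι → ℂ)), c ∈ extPart ι i → e (r ⊗ₜ c) ∈ P)
    {f : SuperPoly M ι} (hf : f ∈ part (SuperPoly M ι) i) : e (toTensor R f) ∈ P := by
  refine polyPart_induction (p := fun f => e (toTensor R f) ∈ P) hf ?_ ?_ fun m c hc => ?_
  · rw [map_zero, map_zero]; exact zero_mem _
  · intro f g hf hg
    beta_reduce at hf hg ⊢
    rw [map_add, map_add]; exact add_mem hf hg
  · rw [toTensor_single]; exact he _ _ hc

end GenericRegularity

namespace IsPrincipalLocalization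

open AddMonoidAlgebra TensorProduct

variable {A M ι : Type} [Ring A] [Algebra ℂ A] [SuperCommAlgebra A] [AddCommMonoid M]
  [IsDomain (AddMonoidAlgebra ℂ M)] {φ : SuperHom A (SuperPoly M ι)} {f : evenSub A}

/-- At the generic point every non-nilpotent even element is inverted. With `R` the fraction field
of the body, the stalk becomes `R ⊗ Λ(ℂ^ι)`, that is, the exterior algebra of `R ⊗ ℂ^ι` over `R`. -/
theorem isFermionicallyRegular_stalk (h : IsPrincipalLocalization φ f) (x : SpecTop A)
    (hx : x.asIdeal = nilradical (evenSub A)) :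
    IsFermionicallyRegular (Stalk A x) (locPart x.asIdeal.primeCompl) := by
  let R := FractionRing (AddMonoidAlgebra ℂ M)
  have hB : IsIntegralSuperring (SuperPoly M ι) := isIntegralSuperring_superPoly
  have hA := h.isIntegralSuperring hB
  have hinjR : Function.Injective (algebraMap (AddMonoidAlgebra ℂ M) R) :=
    IsFractionRing.injective _ _
  let g : A →+* R ⊗[ℂ] ExteriorAlgebra ℂ (ι → ℂ) := (toTensor R).comp φ.toAlgHom.toRingHom
  have hg : ∀ a, g a = toTensor R (φ.toAlgHom a) := fun _ => rfl
  have hS : ∀ s : evenSub A, s ∈ x.asIdeal.primeCompl ↔ ¬ IsNilpotent s := fun s => by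
    rw [Ideal.mem_primeCompl_iff, hx, mem_nilradical]
  -- A nonzero body is a unit in the field `R`, and adding a commuting nilpotent preserves units.
  have hunit : ∀ q : evenSub (SuperPoly M ι), ¬ IsNilpotent q → IsUnit (toTensor R q.1) := by
    intro q hq
    rw [isNilpotent_evenSub_iff, isNilpotent_iff_body] at hq
    have hn : IsNilpotent (toTensor R (q.1 - ofBody M ι (body M ι q.1))) :=
      (isNilpotent_of_mem_oddIdeal (sub_ofBody_body_mem q.1)).map _
    have hu : IsUnit (toTensor R (ofBody M ι (body M ι q.1)) :
        R ⊗[ℂ] ExteriorAlgebra ℂ (ι → ℂ)) := by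
      rw [toTensor_ofBody]
      exact (IsUnit.mk0 _ ((map_ne_zero_iff _ hinjR).2 hq)).map
        (Algebra.TensorProduct.includeLeft (R := ℂ) (S := R) (A := R)
          (B := ExteriorAlgebra ℂ (ι → ℂ)))
    have := hn.isUnit_add_left_of_commute hu
      (toTensor_comm R (ofBody_mem _) _).symm
    rwa [← map_add, add_sub_cancel] at this
  have hdenom : ∀ z : R ⊗[ℂ] ExteriorAlgebra ℂ (ι → ℂ), ∃ p : AddMonoidAlgebra ℂ M, p ≠ 0 ∧
      ∃ q : SuperPoly M ι, toTensor R (ofBody M ι p) * z = toTensor R q := by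
    intro z
    induction z using TensorProduct.induction_on with
    | zero => exact ⟨1, one_ne_zero, 0, by simp⟩
    | tmul r c =>
      obtain ⟨⟨a, p⟩, e⟩ := IsLocalization.surj (nonZeroDivisors (AddMonoidAlgebra ℂ M)) r
      refine ⟨p.1, nonZeroDivisors.ne_zero p.2, ofBody M ι a * single 0 c, ?_⟩
      rw [map_mul, toTensor_ofBody, toTensor_ofBody, toTensor_single,
        Algebra.TensorProduct.tmul_mul_tmul, Algebra.TensorProduct.tmul_mul_tmul, ← one_def,
        map_one, mul_one, mul_comm, e]
    | add z w hz hw =>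
      obtain ⟨p, hp, q, e⟩ := hz
      obtain ⟨p', hp', q', e'⟩ := hw
      refine ⟨p * p', mul_ne_zero hp hp', ofBody M ι p' * q + ofBody M ι p * q', ?_⟩
      rw [map_add, map_mul (toTensor R) _ q, map_mul (toTensor R) _ q', ← e, ← e', mul_add]
      simp only [← mul_assoc, ← map_mul]
      rw [mul_comm p' p]
  obtain ⟨e₁, he₁⟩ := exists_localization_equiv x.asIdeal.primeCompl g
    ((toTensor_injective R hinjR).comp h.injective)
    (fun s z => toTensor_comm R (φ.map_part 0 _ s.2) z)
    (fun s hs => hunit (φ.even s) (mt h.isNilpotent_iff.1 ((hS s).1 hs)))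
    (fun z => by
      obtain ⟨p, hp, q, e⟩ := hdenom z
      obtain ⟨n, s, hs, es⟩ := h.exists_not_isNilpotent
        (b := ⟨ofBody M ι p, ofBody_mem p⟩) (by
          rwa [isNilpotent_evenSub_iff, isNilpotent_iff_body, body_ofBody])
      obtain ⟨k, a, ea⟩ := h.exists_pow q
      refine ⟨f ^ k * s, (hS _).2 (hA.not_isNilpotent_mul (h.not_isNilpotent_pow hB k) hs),
        f.1 ^ n * a, ?_⟩
      have es' : φ.toAlgHom s.1 = φ.toAlgHom f.1 ^ n * ofBody M ι p := congrArg Subtype.val es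
      change g (f.1 ^ k * s.1) * z = _
      simp only [hg, map_mul, map_pow, es', ea, mul_assoc, e]
      simp only [← mul_assoc, ← pow_add]
      rw [add_comm])
  obtain ⟨e₂, he₂⟩ := exists_exteriorAlgebra_baseChange R (ι → ℂ)
  let P := CliffordAlgebra.evenOdd (0 : QuadraticForm R (R ⊗[ℂ] (ι → ℂ)))
  have hP : IsCompl (P 0) (P 1) := CliffordAlgebra.evenOdd_isCompl _
  have key : ∀ k : ZMod 2, k = 0 ∨ k = 1 := by decide
  let G : A → ExteriorAlgebra R (R ⊗[ℂ] (ι → ℂ)) := fun a => e₂ (g a)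
  have hGP : ∀ i a, a ∈ part A i → G a ∈ P i := fun i a ha =>
    toTensor_mem_parity R e₂ (he₂ i) (φ.map_part i a ha)
  have hG0 : ∀ a, G a = 0 → a = 0 := fun a ha => h.injective <| toTensor_injective R hinjR <| by
    rw [map_zero, map_zero]; exact e₂.injective (by rw [map_zero]; exact ha)
  have hGadd : ∀ a b, G (a + b) = G a + G b := fun a b => by simp only [G, map_add]
  have hGe : ∀ (a : A) (s : x.asIdeal.primeCompl),
      G s.1.1 * e₂ (e₁ (LocalizedModule.mk a s)) = G a := fun a s => by
    simp only [G]
    rw [← map_mul e₂, he₁]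
  have hGu : ∀ s : x.asIdeal.primeCompl, IsUnit (G s.1.1) := fun s =>
    (hunit (φ.even s.1) (mt h.isNilpotent_iff.1 ((hS _).1 s.2))).map e₂
  have hdisj : ∀ {y}, y ∈ P 0 → y ∈ P 1 → y = 0 := fun h₀ h₁ =>
    Submodule.disjoint_def.1 hP.disjoint _ h₀ h₁
  have hmulP : ∀ {i : ZMod 2} {y z}, y ∈ P 0 → z ∈ P i → y * z ∈ P i := fun {i y z} hy hz => by
    have := SetLike.mul_mem_graded hy hz
    rwa [zero_add] at this
  refine ⟨R, R ⊗[ℂ] (ι → ℂ), inferInstance, inferInstance, inferInstance,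
    e₁.trans e₂.toRingEquiv, fun i b => ⟨?_, fun hb => ?_⟩⟩
  · rintro ⟨a, ha, s, rfl⟩
    change e₂ (e₁ (LocalizedModule.mk a s)) ∈ P i
    have hy := hGe a s
    set y := e₂ (e₁ (LocalizedModule.mk a s))
    -- Multiplication by the even unit `G s` takes `y` to a homogeneous element, so it kills the
    -- component of `y` of the wrong parity; being a unit, it forces that component to vanish.
    have ht : y ∈ P 0 ⊔ P 1 := by rw [hP.sup_eq_top]; trivial
    obtain ⟨y₀, h₀, y₁, h₁, e⟩ := Submodule.mem_sup.1 ht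
    have hs0 : G s.1.1 ∈ P 0 := hGP 0 _ s.1.2
    have h₀' := hmulP hs0 h₀
    have h₁' := hmulP hs0 h₁
    have hGa := hGP i a ha
    rw [← hy, ← e, mul_add] at hGa
    rw [← e]
    obtain rfl | rfl := key i
    · have h₁'' : G s.1.1 * y₁ ∈ P 0 := by simpa using sub_mem hGa h₀'
      rw [(hGu s).mul_right_eq_zero.1 (hdisj h₁'' h₁'), add_zero]
      exact h₀
    · have h₀'' : G s.1.1 * y₀ ∈ P 1 := by simpa using sub_mem hGa h₁'
      rw [(hGu s).mul_right_eq_zero.1 (hdisj h₀' h₀''), zero_add]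
      exact h₁
  · induction b using LocalizedModule.induction_on with
    | h a s =>
    change e₂ (e₁ (LocalizedModule.mk a s)) ∈ P i at hb
    have hGa : G a ∈ P i := hGe a s ▸ hmulP (hGP 0 _ s.1.2) hb
    refine ⟨a, ?_, s, rfl⟩
    obtain ⟨a₀, h₀, a₁, h₁, rfl⟩ := exists_parts a
    rw [hGadd] at hGa
    obtain rfl | rfl := key i
    · have h₁' : G a₁ ∈ P 0 := by simpa using sub_mem hGa (hGP 0 _ h₀)
      rw [hG0 a₁ (hdisj h₁' (hGP 1 _ h₁)), add_zero]
      exact h₀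
    · have h₀' : G a₀ ∈ P 1 := by simpa using sub_mem hGa (hGP 1 _ h₁)
      rw [hG0 a₀ (hdisj (hGP 0 _ h₀) h₀'), zero_add]
      exact h₁

theorem specIsGFR (h : IsPrincipalLocalization φ f) : SpecIsGFR A := by
  have hA := h.isIntegralSuperring isIntegralSuperring_superPoly
  -- The nilradical is the generic point, whose closure is the whole spectrum.
  refine ⟨{⟨nilradical _, hA.nilradical_prime⟩}, fun x => ?_, ?_⟩
  · rw [← specializes_iff_mem_closure, ← PrimeSpectrum.le_iff_specializes]
    exact fun a ha => nilpotent_iff_mem_prime.1 (mem_nilradical.1 ha) _ x.2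
  · rintro x rfl
    exact h.isFermionicallyRegular_stalk _ rfl

theorem isIrreducibleSupervariety (h : IsPrincipalLocalization φ f)
    (hft : Algebra.FiniteType ℂ A) : IsIrreducibleSupervariety A where
  irreducible := (h.isIntegralSuperring isIntegralSuperring_superPoly).irreducibleSpace
  reduced := (h.isIntegralSuperring isIntegralSuperring_superPoly).specIsReduced
  gfr := h.specIsGFR
  finiteType := hft
  separated a := ⟨a ⊗ₜ 1, by simp⟩

end IsPrincipalLocalization

/-! ### Contractions on the exterior algebra -/

section Contraction

variable {ι : Type*} (d : Module.Dual ℂ (ι → ℂ))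

local notation "∂" => CliffordAlgebra.contractLeft (Q := (0 : QuadraticForm ℂ (ι → ℂ))) d

/-- The graded Leibniz rule for ∂, proved by peeling vectors off `a` from the left. It is the source
of the superderivation property of the action. -/
theorem contractLeft_mul (a b : ExteriorAlgebra ℂ (ι → ℂ)) :
    ∂ (a * b) = ∂ a * b + CliffordAlgebra.involute a * ∂ b := by
  induction a using CliffordAlgebra.left_induction with
  | algebraMap r =>
    rw [CliffordAlgebra.contractLeft_algebraMap_mul, CliffordAlgebra.contractLeft_algebraMap,
      AlgHom.commutes, zero_mul, zero_add]
  | add x y hx hy => simp only [add_mul, map_add, hx, hy]; abel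
  | ι_mul x m hx =>
    rw [mul_assoc, CliffordAlgebra.contractLeft_ι_mul, hx, CliffordAlgebra.contractLeft_ι_mul,
      map_mul, CliffordAlgebra.involute_ι]
    simp only [sub_mul, mul_add, smul_mul_assoc, neg_mul, mul_assoc]
    abel

theorem contractLeft_mem {i : ZMod 2} {a : ExteriorAlgebra ℂ (ι → ℂ)} (ha : a ∈ extPart ι i) :
    ∂ a ∈ extPart ι (i + 1) := by
  have hι : ∀ (i : ZMod 2) (v : ι → ℂ) {x : ExteriorAlgebra ℂ (ι → ℂ)}, x ∈ extPart ι i →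
      (CliffordAlgebra.ι 0 v * x : ExteriorAlgebra ℂ (ι → ℂ)) ∈ extPart ι (i + 1) := by
    intro i v x hx
    rw [add_comm]
    exact SetLike.mul_mem_graded (CliffordAlgebra.ι_mem_evenOdd_one _ _) hx
  have hstep : ∀ (i : ZMod 2) (v w : ι → ℂ) {x : ExteriorAlgebra ℂ (ι → ℂ)}, x ∈ extPart ι i →
      ∂ x ∈ extPart ι (i + 1) →
      ∂ (CliffordAlgebra.ι 0 v * CliffordAlgebra.ι 0 w * x) ∈ extPart ι (i + 1) := by
    intro i v w x hx hdx
    rw [mul_assoc, CliffordAlgebra.contractLeft_ι_mul, CliffordAlgebra.contractLeft_ι_mul]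
    refine sub_mem (Submodule.smul_mem _ _ (hι i w hx)) (hι i v (sub_mem ?_ ?_))
    · exact Submodule.smul_mem _ _ hx
    · have h2 : i + 1 + 1 = i := by rw [add_assoc, show (1 : ZMod 2) + 1 = 0 from rfl, add_zero]
      have := hι _ w hdx
      rwa [h2] at this
  have key : ∀ k : ZMod 2, k = 0 ∨ k = 1 := by decide
  obtain rfl | rfl := key i
  · induction a, ha using CliffordAlgebra.even_induction with
    | algebraMap r => rw [CliffordAlgebra.contractLeft_algebraMap]; exact zero_mem _
    | add x y _ _ hx hy => rw [map_add]; exact add_mem hx hy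
    | ι_mul_ι_mul v w x hx hdx => exact hstep 0 v w hx hdx
  · induction a, ha using CliffordAlgebra.odd_induction with
    | ι v =>
      rw [CliffordAlgebra.contractLeft_ι]
      exact (CliffordAlgebra.even (0 : QuadraticForm ℂ (ι → ℂ))).algebraMap_mem _
    | add x y _ _ hx hy => rw [map_add]; exact add_mem hx hy
    | ι_mul_ι_mul v w x hx hdx => exact hstep 1 v w hx hdx

theorem involute_eq_smul {i : ZMod 2} {a : ExteriorAlgebra ℂ (ι → ℂ)} (ha : a ∈ extPart ι i) :
    CliffordAlgebra.involute a = (-1 : ℂ) ^ i.val • a := by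
  have key : ∀ k : ZMod 2, k = 0 ∨ k = 1 := by decide
  obtain rfl | rfl := key i
  · simpa using CliffordAlgebra.involute_eq_of_mem_even ha
  · simpa [ZMod.val_one] using CliffordAlgebra.involute_eq_of_mem_odd ha

end Contraction

/-! ### The action of a supertorus on its coordinate superalgebra -/

section OddDeriv

open AddMonoidAlgebra

variable {M ι : Type*}

variable (M) in
/-- The odd derivation `-∂/∂ξ_i`. -/
def oddDeriv (i : ι) : SuperPoly M ι →ₗ[ℂ] SuperPoly M ι :=
  (coeffLinearEquiv ℂ).symm.toLinearMap ∘ₗ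
    Finsupp.mapRange.linearMap (-(CliffordAlgebra.contractLeft
      (Q := (0 : QuadraticForm ℂ (ι → ℂ))) (LinearMap.proj i))) ∘ₗ
    (coeffLinearEquiv ℂ).toLinearMap

theorem oddDeriv_single (i : ι) (m : M) (c : ExteriorAlgebra ℂ (ι → ℂ)) :
    oddDeriv M i (single m c) = single m (-(CliffordAlgebra.contractLeft
      (Q := (0 : QuadraticForm ℂ (ι → ℂ))) (LinearMap.proj i) c)) := by
  ext n
  simp [oddDeriv]

theorem oddDeriv_anticomm (i j : ι) (f : SuperPoly M ι) :
    oddDeriv M i (oddDeriv M j f) + oddDeriv M j (oddDeriv M i f) = 0 := by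
  induction f using AddMonoidAlgebra.induction_linear with
  | zero => simp
  | add f g hf hg =>
    simp only [map_add]
    rw [add_add_add_comm, hf, hg, add_zero]
  | single m c =>
    simp only [oddDeriv_single, map_neg, neg_neg]
    rw [← single_add, CliffordAlgebra.contractLeft_comm, neg_add_cancel, single_zero]

variable [AddCommMonoid M]

theorem oddDeriv_mem (i : ι) {k : ZMod 2} {f : SuperPoly M ι} (hf : f ∈ part (SuperPoly M ι) k) :
    oddDeriv M i f ∈ part (SuperPoly M ι) (k + 1) := by
  refine polyPart_induction (p := fun f => oddDeriv M i f ∈ polyPart M ι (k + 1)) hf ?_ ?_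
    fun m c hc => ?_
  · rw [map_zero]; exact zero_mem _
  · intro f g hf hg
    rw [map_add]; exact add_mem hf hg
  · rw [oddDeriv_single]
    exact single_mem_polyPart (neg_mem (contractLeft_mem _ hc)) m

theorem oddDeriv_mul (i : ι) {k : ZMod 2} {f : SuperPoly M ι} (hf : f ∈ part (SuperPoly M ι) k)
    (g : SuperPoly M ι) :
    oddDeriv M i (f * g) = oddDeriv M i f * g + (-1 : ℂ) ^ k.val • (f * oddDeriv M i g) := by
  refine polyPart_induction (p := fun f => oddDeriv M i (f * g) =
    oddDeriv M i f * g + (-1 : ℂ) ^ k.val • (f * oddDeriv M i g)) hf ?_ ?_ fun m c hc => ?_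
  · simp
  · intro f f' hf hf'
    simp only [add_mul, map_add, hf, hf', smul_add]
    abel
  · induction g using AddMonoidAlgebra.induction_linear with
    | zero => simp
    | add g g' hg hg' => simp only [mul_add, map_add, hg, hg', smul_add]; abel
    | single n c' =>
      simp only [oddDeriv_single, single_mul_single, smul_single, ← single_add]
      rw [contractLeft_mul, involute_eq_smul hc]
      congr 1
      simp only [neg_mul, mul_neg, smul_neg, smul_mul_assoc]
      abel

end OddDeriv

/-! ### Translations by the torus and the odd vector fields for zero bracket -/

section Translate

open AddMonoidAlgebra

theorem torusChar_zero {p : ℕ} (t : Fin p → ℂˣ) : torusChar 0 t = 1 := by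
  simp [torusChar]

theorem torusChar_add {p : ℕ} (m n : Fin p → ℤ) (t : Fin p → ℂˣ) :
    torusChar (m + n) t = torusChar m t * torusChar n t := by
  simp [torusChar, zpow_add, Finset.prod_mul_distrib]

theorem torusChar_mul {p : ℕ} (m : Fin p → ℤ) (t t' : Fin p → ℂˣ) :
    torusChar m (t * t') = torusChar m t * torusChar m t' := by
  simp [torusChar, mul_zpow, Finset.prod_mul_distrib]

theorem torusChar_one {p : ℕ} (m : Fin p → ℤ) : torusChar m (1 : Fin p → ℂˣ) = 1 := by
  simp [torusChar]

namespace Supertorus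

variable (T : Supertorus)

theorem translate_single (t : Fin T.p → ℂˣ) (m : Fin T.p → ℤ)
    (c : ExteriorAlgebra ℂ (Fin T.q → ℂ)) :
    T.translate t (single m c) = torusChar (-m) t • (single m c : T.Coord) := by
  rw [translate, coeff_single, Finsupp.sum_single_index, smul_single]
  simp

theorem translate_add (t : Fin T.p → ℂˣ) (f g : T.Coord) :
    T.translate t (f + g) = T.translate t f + T.translate t g := by
  classical
  rw [translate, coeff_add, Finsupp.sum_add_index']
  · rfl
  · simp
  · intro m a b; rw [smul_add, single_add]

theorem translate_zero (t : Fin T.p → ℂˣ) : T.translate t 0 = 0 := by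
  simp [translate]

theorem translate_smul (t : Fin T.p → ℂˣ) (c : ℂ) (f : T.Coord) :
    T.translate t (c • f) = c • T.translate t f := by
  induction f using AddMonoidAlgebra.induction_linear with
  | zero => rw [smul_zero, translate_zero, smul_zero]
  | add f g hf hg => rw [smul_add, translate_add, hf, hg, translate_add, smul_add]
  | single m a => rw [smul_single, translate_single, translate_single, ← smul_single, smul_comm]

theorem translate_mul (t : Fin T.p → ℂˣ) (f g : T.Coord) :
    T.translate t (f * g) = T.translate t f * T.translate t g := by
  induction f using AddMonoidAlgebra.induction_linear with
  | zero => rw [zero_mul, translate_zero, zero_mul]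
  | add f f' hf hf' => rw [add_mul, translate_add, hf, hf', translate_add, add_mul]
  | single m a =>
    induction g using AddMonoidAlgebra.induction_linear with
    | zero => rw [mul_zero, translate_zero, mul_zero]
    | add g g' hg hg' => rw [mul_add, translate_add, hg, hg', translate_add, mul_add]
    | single n b =>
      rw [single_mul_single, translate_single, translate_single, translate_single, neg_add,
        torusChar_add, smul_mul_smul_comm, single_mul_single]

/-- Translation by an element of the torus, as an endomorphism of the algebra of functions. -/
def translateHom (t : Fin T.p → ℂˣ) : T.Coord →ₐ[ℂ] T.Coord :=
  AlgHom.ofLinearMap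
    { toFun := T.translate t
      map_add' := T.translate_add t
      map_smul' := T.translate_smul t }
    (by
      change T.translate t (single 0 1) = single 0 1
      rw [translate_single, neg_zero, torusChar_zero, one_smul])
    (T.translate_mul t)

theorem translate_translate (t t' : Fin T.p → ℂˣ) (f : T.Coord) :
    T.translate (t * t') f = T.translate t (T.translate t' f) := by
  induction f using AddMonoidAlgebra.induction_linear with
  | zero => simp only [translate_zero]
  | add f g hf hg => simp only [translate_add, hf, hg]
  | single m a =>
    rw [translate_single, translate_single, translate_smul, translate_single, smul_smul,
      torusChar_mul, mul_comm]

theorem translate_one (f : T.Coord) : T.translate 1 f = f := by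
  induction f using AddMonoidAlgebra.induction_linear with
  | zero => simp only [translate_zero]
  | add f g hf hg => simp only [translate_add, hf, hg]
  | single m a => rw [translate_single, torusChar_one, one_smul]

theorem translate_mem (t : Fin T.p → ℂˣ) {k : ZMod 2} {f : T.Coord} (hf : f ∈ part T.Coord k) :
    T.translate t f ∈ part T.Coord k := by
  refine polyPart_induction (p := fun f => T.translate t f ∈ part T.Coord k) hf ?_ ?_
    fun m c hc => ?_
  · rw [translate_zero]; exact zero_mem _
  · intro f g hf hg
    rw [translate_add]; exact add_mem hf hg
  · rw [translate_single]
    exact Submodule.smul_mem _ _ (single_mem_polyPart hc m)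

theorem oddDeriv_translate (i : Fin T.q) (t : Fin T.p → ℂˣ) (f : T.Coord) :
    oddDeriv _ i (T.translate t f) = T.translate t (oddDeriv _ i f) := by
  induction f using AddMonoidAlgebra.induction_linear with
  | zero => simp only [translate_zero, map_zero]
  | add f g hf hg => simp only [translate_add, map_add, hf, hg]
  | single m a => rw [translate_single, map_smul, oddDeriv_single, translate_single]

/-- With zero bracket the term weighted by `t ∂/∂t` drops out and only `-∂/∂ξ_i` remains. -/
theorem oddField_of_bracket_eq_zero (hT : T.bracket = 0) (i : Fin T.q) (f : T.Coord) :
    T.oddField i f = oddDeriv _ i f := by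
  have h : ∀ f : T.Coord, T.oddField i f = f.coeff.sum fun m c =>
      oddDeriv _ i (single m c) := by
    intro f
    refine Finsupp.sum_congr fun m _ => ?_
    rw [oddDeriv_single, hT]
    simp [weightPairing]
  rw [h, ← map_finsuppSum]
  exact congrArg _ (AddMonoidAlgebra.sum_coeff_single f)

end Supertorus

end Translate

/-! ### A criterion for toric supervarieties -/

section Criterion

open AddMonoidAlgebra

variable {A : Type*} [Ring A] [Algebra ℂ A] {B : Type*} [Ring B] [Algebra ℂ B]

/-- The restriction of a linear map along an injective homomorphism whose range it preserves. -/
def restrictAlong (φ : A →ₐ[ℂ] B) (hφ : Function.Injective φ) (D : B →ₗ[ℂ] B)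
    (h : ∀ a, ∃ b, φ b = D (φ a)) : A →ₗ[ℂ] A where
  toFun a := (h a).choose
  map_add' a b := hφ (by
    rw [(h _).choose_spec, map_add, map_add, map_add, (h a).choose_spec, (h b).choose_spec])
  map_smul' c a := hφ (by
    rw [(h _).choose_spec, map_smul, map_smul, RingHom.id_apply, map_smul, (h a).choose_spec])

theorem map_restrictAlong (φ : A →ₐ[ℂ] B) (hφ : Function.Injective φ) (D : B →ₗ[ℂ] B)
    (h : ∀ a, ∃ b, φ b = D (φ a)) (a : A) : φ (restrictAlong φ hφ D h a) = D (φ a) :=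
  (h a).choose_spec

/-- The component of the wrong parity has an image that lies in both parts, so it is zero by
injectivity. The parity axioms of the action can thus be checked in the coordinate superalgebra. -/
theorem mem_part_of_map_mem {A B : Type*} [Ring A] [Algebra ℂ A] [SuperCommAlgebra A]
    [Ring B] [Algebra ℂ B] [SuperCommAlgebra B] {φ : SuperHom A B}
    (hφ : Function.Injective φ.toAlgHom) {i : ZMod 2} {a : A} (ha : φ.toAlgHom a ∈ part B i) :
    a ∈ part A i := by
  obtain ⟨a₀, h₀, a₁, h₁, rfl⟩ := exists_parts a
  have k₀ : φ.toAlgHom a₀ ∈ part B 0 := φ.map_part 0 _ h₀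
  have k₁ : φ.toAlgHom a₁ ∈ part B 1 := φ.map_part 1 _ h₁
  rw [map_add] at ha
  have key : ∀ k : ZMod 2, k = 0 ∨ k = 1 := by decide
  obtain rfl | rfl := key i
  · have h : φ.toAlgHom a₁ = 0 :=
      eq_zero_of_mem_parts (by simpa using sub_mem ha k₀) k₁
    rwa [(map_eq_zero_iff _ hφ).1 h, add_zero]
  · have h : φ.toAlgHom a₀ = 0 :=
      eq_zero_of_mem_parts k₀ (by simpa using sub_mem ha k₁)
    rwa [(map_eq_zero_iff _ hφ).1 h, zero_add]

/-- `Spec A` is a toric supervariety if `A` is finitely generated, a localization `A[f⁻¹]` is the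
coordinate superalgebra of a supertorus with zero bracket, and `A` is spanned by weight vectors and stable
under the odd derivations. -/
theorem isFaithfulToricSupervariety_of_isPrincipalLocalization {A : Type} [Ring A] [Algebra ℂ A]
    [SuperCommAlgebra A] (T : Supertorus) (hT : T.bracket = 0) (φ : SuperHom A T.Coord)
    {f : evenSub A} (h : IsPrincipalLocalization φ f)
    (hspan : ∀ a : A, a ∈ Submodule.span ℂ {a : A | ∃ m c, φ.toAlgHom a = single m c})
    (hodd : ∀ i a, ∃ b : A, φ.toAlgHom b = oddDeriv _ i (φ.toAlgHom a))
    (hft : Algebra.FiniteType ℂ A) : IsFaithfulToricSupervariety A := by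
  let ψ : A →ₐ[ℂ] T.Coord := φ.toAlgHom
  have hψ : Function.Injective ψ := h.injective
  have htr : ∀ t a, ∃ b : A, ψ b = T.translateHom t (ψ a) := by
    intro t a
    induction hspan a using Submodule.span_induction with
    | mem a ha =>
      obtain ⟨m, c, e⟩ := ha
      refine ⟨torusChar (-m) t • a, ?_⟩
      change _ = T.translate t (ψ a)
      have e' : ψ a = single m c := e
      rw [map_smul, e', T.translate_single]
    | zero => exact ⟨0, by simp⟩
    | add a b _ _ ha hb =>
      obtain ⟨a', ea⟩ := ha
      obtain ⟨b', eb⟩ := hb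
      exact ⟨a' + b', by simp only [map_add, ea, eb]⟩
    | smul c a _ ha =>
      obtain ⟨a', ea⟩ := ha
      exact ⟨c • a', by simp only [map_smul, ea]⟩
  let G (t : Fin T.p → ℂˣ) : A →ₗ[ℂ] A :=
    restrictAlong ψ hψ (T.translateHom t).toLinearMap (htr t)
  have hG : ∀ t a, ψ (G t a) = T.translate t (ψ a) := fun t a =>
    map_restrictAlong ψ hψ (T.translateHom t).toLinearMap (htr t) a
  let D (i : Fin T.q) : A →ₗ[ℂ] A := restrictAlong ψ hψ (oddDeriv _ i) (hodd i)
  have hD : ∀ i a, ψ (D i a) = oddDeriv _ i (ψ a) := fun i a =>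
    map_restrictAlong ψ hψ (oddDeriv _ i) (hodd i) a
  have hmem : ∀ {i : ZMod 2} {a : A}, ψ a ∈ part T.Coord i → a ∈ part A i := fun ha =>
    mem_part_of_map_mem h.injective ha
  have hmap : ∀ {i : ZMod 2} {a : A}, a ∈ part A i → ψ a ∈ part T.Coord i := fun ha =>
    φ.map_part _ _ ha
  let ρ : T.Action A :=
    { grp :=
        { toFun := fun t => AlgHom.ofLinearMap (G t)
            (hψ (by rw [hG, map_one]; exact map_one (T.translateHom t)))
            (fun a b => hψ (by
              rw [hG, map_mul, map_mul, hG, hG]; exact map_mul (T.translateHom t) _ _))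
          map_one' := AlgHom.ext fun a => hψ ((hG 1 a).trans (T.translate_one _))
          map_mul' := fun t t' => AlgHom.ext fun a => hψ (by
            change ψ (G (t * t') a) = ψ (G t (G t' a))
            rw [hG, hG, hG, T.translate_translate]) }
      grp_part := fun t i a ha => hmem (by
        change ψ (G t a) ∈ _
        rw [hG]; exact T.translate_mem t (hmap ha))
      rational := fun a => by
        refine Submodule.span_mono ?_ (hspan a)
        rintro b ⟨m, c, e⟩
        -- Left translation evaluates a function at `t⁻¹ x`, so the monomial with exponent `m` has
        -- weight `-m`.
        refine ⟨-m, fun t => hψ ?_⟩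
        have e' : ψ b = single m c := e
        change ψ (G t b) = _
        rw [hG, map_smul, e', T.translate_single]
      odd := D
      odd_part := fun k i a ha => hmem (by rw [hD]; exact oddDeriv_mem k (hmap ha))
      leibniz := fun k i a b ha => hψ (by
        rw [hD, map_mul, oddDeriv_mul k (hmap ha), map_add, map_mul, map_smul, map_mul, hD, hD])
      odd_grp := fun k t a => hψ (by
        change ψ (D k (G t a)) = ψ (G t (D k a))
        rw [hD, hG, hG, hD, T.oddDeriv_translate])
      odd_odd := fun k l m w _ => hψ (by
        rw [map_add, hD, hD, hD, hD, oddDeriv_anticomm, hT]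
        simp [weightPairing]) }
  refine ⟨h.isIrreducibleSupervariety hft, T, ρ, φ, hG, fun i a => ?_, h.isOpenImmersion⟩
  exact (hD i a).trans (T.oddField_of_bracket_eq_zero hT i _).symm

end Criterion

/-! ### Change of variables -/

section MapVars

open AddMonoidAlgebra

variable {M N ι κ : Type*} [AddCommMonoid M] [AddCommMonoid N]

/-- The homomorphism of superalgebras given by an additive map on exponents and a linear map on
the span of the odd variables. -/
def mapVars (w : M →+ N) (r : (ι → ℂ) →ₗ[ℂ] (κ → ℂ)) : SuperPoly M ι →ₐ[ℂ] SuperPoly N κ :=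
  (mapDomainAlgHom ℂ _ w).comp (mapAlgHom M (ExteriorAlgebra.map r))

theorem mapVars_single (w : M →+ N) (r : (ι → ℂ) →ₗ[ℂ] (κ → ℂ)) (m : M)
    (c : ExteriorAlgebra ℂ (ι → ℂ)) :
    mapVars w r (single m c) = single (w m) (ExteriorAlgebra.map r c) := by
  simp [mapVars]

theorem exteriorAlgebra_map_mem (r : (ι → ℂ) →ₗ[ℂ] (κ → ℂ)) {i : ZMod 2}
    {c : ExteriorAlgebra ℂ (ι → ℂ)} (hc : c ∈ extPart ι i) :
    ExteriorAlgebra.map r c ∈ extPart κ i := by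
  have hι : ∀ v, ExteriorAlgebra.map r (CliffordAlgebra.ι 0 v) = CliffordAlgebra.ι 0 (r v) :=
    ExteriorAlgebra.map_apply_ι r
  have hmul : ∀ (i : ZMod 2) v w (x : ExteriorAlgebra ℂ (κ → ℂ)), x ∈ extPart κ i →
      (CliffordAlgebra.ι 0 v * CliffordAlgebra.ι 0 w * x : ExteriorAlgebra ℂ (κ → ℂ)) ∈
        extPart κ i := by
    intro i v w x hx
    have := SetLike.mul_mem_graded (CliffordAlgebra.ι_mul_ι_mem_evenOdd_zero
      (0 : QuadraticForm ℂ (κ → ℂ)) v w) hx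
    rwa [zero_add] at this
  have key : ∀ k : ZMod 2, k = 0 ∨ k = 1 := by decide
  obtain rfl | rfl := key i
  · induction c, hc using CliffordAlgebra.even_induction with
    | algebraMap z =>
      erw [AlgHom.commutes]
      exact (CliffordAlgebra.even (0 : QuadraticForm ℂ (κ → ℂ))).algebraMap_mem _
    | add x y _ _ hx hy => rw [map_add]; exact add_mem hx hy
    | ι_mul_ι_mul v w x _ hx =>
      rw [map_mul, map_mul, hι, hι]; exact hmul 0 _ _ _ hx
  · induction c, hc using CliffordAlgebra.odd_induction with
    | ι v => rw [hι]; exact CliffordAlgebra.ι_mem_evenOdd_one _ _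
    | add x y _ _ hx hy => rw [map_add]; exact add_mem hx hy
    | ι_mul_ι_mul v w x _ hx =>
      rw [map_mul, map_mul, hι, hι]; exact hmul 1 _ _ _ hx

theorem mapVars_mem (w : M →+ N) (r : (ι → ℂ) →ₗ[ℂ] (κ → ℂ)) {i : ZMod 2} {f : SuperPoly M ι}
    (hf : f ∈ part (SuperPoly M ι) i) : mapVars w r f ∈ part (SuperPoly N κ) i := by
  refine polyPart_induction (p := fun f => mapVars w r f ∈ polyPart N κ i) hf ?_ ?_
    fun m c hc => ?_
  · rw [map_zero]; exact zero_mem _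
  · intro f g hf hg
    rw [map_add]; exact add_mem hf hg
  · rw [mapVars_single]
    exact single_mem_polyPart (exteriorAlgebra_map_mem r hc) _

end MapVars

/-! ### Products of odd variables -/

section OddProducts

variable {O : Type}

theorem xi_eq [DecidableEq O] (o : O) : xi o = ExteriorAlgebra.ι ℂ (Pi.single o 1 : O → ℂ) := by
  unfold xi
  congr!

/-- Transposing two odd variables costs a sign. Only the existence of the scalar is needed, to
compare a product in some order with the order fixed in `monomial`. -/
theorem exists_smul_of_perm {l l' : List O} (h : l.Perm l') :
    ∃ ε : ℂ, (l.map xi).prod = ε • (l'.map xi).prod := by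
  classical
  induction h with
  | nil => exact ⟨1, by simp⟩
  | cons a _ ih =>
    obtain ⟨ε, e⟩ := ih
    exact ⟨ε, by simp [e]⟩
  | swap a b l =>
    refine ⟨-1, ?_⟩
    simp only [List.map_cons, List.prod_cons, ← mul_assoc, neg_smul, one_smul]
    rw [← neg_mul, xi_eq a, xi_eq b, eq_neg_of_add_eq_zero_left (ExteriorAlgebra.ι_add_mul_swap _ _)]
  | trans _ _ ih ih' =>
    obtain ⟨ε, e⟩ := ih
    obtain ⟨ε', e'⟩ := ih'
    exact ⟨ε * ε', by rw [e, e', smul_smul]⟩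

/-- Contraction removes one factor at a time. Allowing all sublists, not only those with one factor
missing, gives a span that the induction carries through. The map `r` is the later restriction to
the odd variables that occur. -/
theorem contractLeft_map_prod_mem {κ : Type*} (r : (O → ℂ) →ₗ[ℂ] (κ → ℂ))
    (d : Module.Dual ℂ (κ → ℂ)) (l : List O) :
    CliffordAlgebra.contractLeft (Q := (0 : QuadraticForm ℂ (κ → ℂ))) d
      (ExteriorAlgebra.map r (l.map xi).prod) ∈
      Submodule.span ℂ {c | ∃ l' : List O, l'.Sublist l ∧ c = ExteriorAlgebra.map r (l'.map xi).prod} := by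
  classical
  induction l with
  | nil =>
    rw [List.map_nil, List.prod_nil, map_one]
    erw [CliffordAlgebra.contractLeft_one]
    exact zero_mem _
  | cons o l ih =>
    rw [List.map_cons, List.prod_cons, map_mul, xi_eq, ExteriorAlgebra.map_apply_ι]
    erw [CliffordAlgebra.contractLeft_ι_mul]
    refine sub_mem (Submodule.smul_mem _ _ (Submodule.subset_span
      ⟨l, List.sublist_cons_self o l, rfl⟩)) ?_
    refine Submodule.span_induction (p := fun c _ => (CliffordAlgebra.ι 0
      (r (Pi.single o 1)) * c : ExteriorAlgebra ℂ (κ → ℂ)) ∈ Submodule.span ℂ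
        {c | ∃ l' : List O, l'.Sublist (o :: l) ∧ c = ExteriorAlgebra.map r (l'.map xi).prod})
      ?_ ?_ ?_ ?_ ih
    · rintro _ ⟨l', hl, rfl⟩
      refine Submodule.subset_span ⟨o :: l', hl.cons_cons o, ?_⟩
      rw [List.map_cons, List.prod_cons, map_mul, xi_eq, ExteriorAlgebra.map_apply_ι]
    · rw [mul_zero]; exact zero_mem _
    · intro x y _ _ hx hy; rw [mul_add]; exact add_mem hx hy
    · intro z x _ hx; rw [mul_smul_comm]; exact Submodule.smul_mem _ _ hx

end OddProducts

/-! ### Monomial superalgebras of lower sets -/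

section LowerSet

open AddMonoidAlgebra

variable {E O : Type}

theorem extend_comp_eq {α β R : Type*} [Zero R] {k : α → β} (hk : Function.Injective k) {x : β → R}
    (hx : ∀ b, x b ≠ 0 → b ∈ Set.range k) : Function.extend k (x ∘ k) 0 = x := by
  funext b
  by_cases hb : b ∈ Set.range k
  · obtain ⟨a, rfl⟩ := hb
    rw [hk.extend_apply, Function.comp_apply]
  · rw [Function.extend_apply' _ _ _ hb]
    exact (not_not.1 (mt (hx b) hb)).symm

/-- The exponents of the monomial `x^m v^n`, as a function on the set of even variables, where
`none` stands for `v`. -/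
def exponents : (E → ℕ) × ℕ →+ (Option E → ℤ) where
  toFun m x := x.elim (m.2 : ℤ) fun e => m.1 e
  map_zero' := by funext x; cases x <;> rfl
  map_add' m n := by funext x; cases x <;> simp

theorem exponents_injective : Function.Injective (exponents (E := E)) := by
  intro m n h
  have h₁ : ∀ e, m.1 e = n.1 e := fun e => by
    have : (m.1 e : ℤ) = n.1 e := congrFun h (some e)
    exact_mod_cast this
  have h₂ : (m.2 : ℤ) = n.2 := congrFun h none
  exact Prod.ext (funext h₁) (by exact_mod_cast h₂)

variable (S : Set (Finset O × (E → ℕ)))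

/-- The exponent `m` of the generator `x^m v` that brings in the given even variable. -/
def baseExponent (x : Option E) : E → ℕ := by
  classical exact x.elim 0 fun e => Pi.single e 1

variable {p q : ℕ} (k : Fin p → Option E) (j : Fin q → O)

/-- Restriction of exponents to the variables in the range of `k`. -/
def restrictExponents : (E → ℕ) × ℕ →+ (Fin p → ℤ) :=
  (LinearMap.funLeft ℤ ℤ k).toAddMonoidHom.comp exponents

/-- The homomorphism from a monomial superalgebra to the coordinate superalgebra of a supertorus,
given by selections of the even and odd variables. -/
def monomialHom : SuperHom (MonomialSuperalgebra S) (SuperPoly (Fin p → ℤ) (Fin q)) where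
  toAlgHom := (mapVars (restrictExponents k) (LinearMap.funLeft ℂ ℂ j)).comp
    (Algebra.adjoin ℂ (generators S)).val
  map_part _ _ ha := mapVars_mem (restrictExponents k) (LinearMap.funLeft ℂ ℂ j) ha

theorem monomialHom_apply (a : MonomialSuperalgebra S) :
    (monomialHom S k j).toAlgHom a =
      mapVars (restrictExponents k) (LinearMap.funLeft ℂ ℂ j) a.1 := rfl

variable {S} in
/-- The generator `ξ^I x^m v`. -/
def gen {s : Finset O × (E → ℕ)} (hs : s ∈ S) : MonomialSuperalgebra S :=
  ⟨monomial s.1 s.2, Algebra.subset_adjoin ⟨s, hs, rfl⟩⟩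

theorem monomialHom_gen {s : Finset O × (E → ℕ)} (hs : s ∈ S) :
    (monomialHom S k j).toAlgHom (gen hs) = single (exponents (s.2, 1) ∘ k)
      (ExteriorAlgebra.map (LinearMap.funLeft ℂ ℂ j) (s.1.toList.map xi).prod) := by
  rw [monomialHom_apply]
  exact mapVars_single _ _ _ _

variable {S}

theorem adjoin_generators_induction {P : MonomialSuperalgebra S → Prop}
    (hgen : ∀ (s : Finset O × (E → ℕ)) (hs : s ∈ S), P (gen hs))
    (halg : ∀ r : ℂ, P (algebraMap ℂ _ r)) (hadd : ∀ a b, P a → P b → P (a + b))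
    (hmul : ∀ a b, P a → P b → P (a * b)) (a : MonomialSuperalgebra S) : P a := by
  obtain ⟨x, hx⟩ := a
  induction hx using Algebra.adjoin_induction with
  | mem x hx =>
    obtain ⟨s, hs, rfl⟩ := hx
    exact hgen s hs
  | algebraMap r => exact halg r
  | add x y hx' hy' hx hy => exact hadd ⟨x, hx'⟩ ⟨y, hy'⟩ hx hy
  | mul x y hx' hy' hx hy => exact hmul ⟨x, hx'⟩ ⟨y, hy'⟩ hx hy

/-! ### Consequences of the lower set property: injectivity, weights and odd derivations -/

section Lower

theorem mem_of_le (hS : IsLowerSet S) {s t : Finset O × (E → ℕ)} (hs : s ∈ S) (h₁ : t.1 ⊆ s.1)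
    (h₂ : t.2 ≤ s.2) :
    t ∈ S := hS (show t ≤ s from ⟨h₁, h₂⟩) hs

variable {k j}

/-- Variables outside the ranges of `k` and `j` occur in no monomial of a lower set, so forgetting
them loses nothing: extension by zero is an inverse on generators, up to the embedding of natural
exponents into integral ones. -/
theorem monomialHom_injective (hS : IsLowerSet S) (hk : Function.Injective k)
    (hj : Function.Injective j) (hkS : ∀ x, x ∈ Set.range k ↔ (∅, baseExponent x) ∈ S)
    (hjS : ∀ o, o ∈ Set.range j ↔ ({o}, 0) ∈ S) : Function.Injective (monomialHom S k j).toAlgHom := by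
  classical
  -- Extension by zero of exponents and of odd vectors, from the selected variables to all
  -- variables.
  let Θ : SuperPoly (Fin p → ℤ) (Fin q) →ₐ[ℂ] SuperPoly (Option E → ℤ) O :=
    mapVars (Function.ExtendByZero.linearMap ℤ k).toAddMonoidHom
      (Function.ExtendByZero.linearMap ℂ j)
  have key : ∀ a, Θ ((monomialHom S k j).toAlgHom a) = mapDomainAlgHom ℂ _ exponents a.1 := by
    refine adjoin_generators_induction (fun s hs => ?_) (fun r => ?_)
      (fun a b ha hb => ?_) fun a b ha hb => ?_
    · rw [monomialHom_gen, mapVars_single]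
      change _ = mapDomainAlgHom ℂ _ exponents (monomial s.1 s.2)
      rw [monomial, mapDomainAlgHom_apply, mapDomain_single]
      congr 1
      · refine extend_comp_eq hk fun x hx => ?_
        rw [hkS]
        refine mem_of_le hS hs (Finset.empty_subset _) ?_
        -- If `x` has nonzero exponent in a monomial of `S`, then the generator bringing in `x` lies
        -- below that monomial. For the variable `v` this generator has exponent `0`, which lies
        -- below everything.
        cases x with
        | none => exact fun e => Nat.zero_le _
        | some e =>
          have hx' : s.2 e ≠ 0 := fun h => hx (by simp [exponents, h])
          intro e'
          simp only [baseExponent, Option.elim_some, Pi.single_apply]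
          split_ifs with h
          · subst h; exact Nat.one_le_iff_ne_zero.2 hx'
          · exact Nat.zero_le _
      · rw [← AlgHom.comp_apply, ExteriorAlgebra.map_comp_map, map_list_prod, List.map_map]
        congr 1
        refine List.map_congr_left fun o ho => ?_
        rw [Finset.mem_toList] at ho
        rw [Function.comp_apply, xi_eq, ExteriorAlgebra.map_apply_ι]
        congr 1
        refine extend_comp_eq hj (x := (Pi.single o 1 : O → ℂ)) fun o' ho' => ?_
        have : o' = o := by
          by_contra h
          exact ho' (Pi.single_eq_of_ne h _)
        subst this
        rw [hjS]
        exact mem_of_le hS hs (Finset.singleton_subset_iff.2 ho) fun e => Nat.zero_le _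
    · rw [AlgHom.commutes, AlgHom.commutes]
      exact (AlgHom.commutes (mapDomainAlgHom ℂ _ exponents) r).symm
    · rw [map_add, map_add, ha, hb]; exact (map_add _ _ _).symm
    · rw [map_mul, map_mul, ha, hb]; exact (map_mul _ _ _).symm
  intro a b h
  have := congrArg Θ h
  rw [key, key] at this
  exact Subtype.ext (mapDomain_injective exponents_injective this)

theorem mem_span_weight (a : MonomialSuperalgebra S) : a ∈ Submodule.span ℂ
    {a : MonomialSuperalgebra S | ∃ m c, (monomialHom S k j).toAlgHom a = single m c} := by
  induction a using adjoin_generators_induction with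
  | hgen s hs => exact Submodule.subset_span ⟨_, _, monomialHom_gen S k j hs⟩
  | halg r => exact Submodule.subset_span ⟨0, algebraMap ℂ _ r, AlgHom.commutes _ r⟩
  | hadd a b ha hb => exact add_mem ha hb
  | hmul a b ha hb =>
    have h := Submodule.mul_mem_mul ha hb
    rw [Submodule.span_mul_span] at h
    refine Submodule.span_mono ?_ h
    rintro _ ⟨x, ⟨m, c, hx⟩, y, ⟨n, d, hy⟩, rfl⟩
    exact ⟨m + n, c * d, by simp only [map_mul, hx, hy, single_mul_single]⟩

/-- On a generator ξ^I x^m v the derivation gives a combination of ξ^{I'} x^m v with I' ⊆ I, all of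
them generators again, up to scalars. The Leibniz rule extends this to products. -/
theorem exists_oddDeriv (hS : IsLowerSet S) (i : Fin q) (a : MonomialSuperalgebra S) :
    ∃ b, (monomialHom S k j).toAlgHom b = oddDeriv _ i ((monomialHom S k j).toAlgHom a) := by
  classical
  induction a using adjoin_generators_induction with
  | hgen s hs =>
    rw [monomialHom_gen, oddDeriv_single]
    suffices h : ∀ c ∈ Submodule.span ℂ {c | ∃ l' : List O, l'.Sublist s.1.toList ∧
        c = ExteriorAlgebra.map (LinearMap.funLeft ℂ ℂ j) (l'.map xi).prod},
        ∃ b, (monomialHom S k j).toAlgHom b = single (exponents (s.2, 1) ∘ k) c from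
      h _ (neg_mem (contractLeft_map_prod_mem _ _ _))
    intro c hc
    induction hc using Submodule.span_induction with
    | mem c hc =>
      obtain ⟨l', hl, rfl⟩ := hc
      have hnd : l'.Nodup := hl.nodup s.1.nodup_toList
      have hsub : l'.toFinset ⊆ s.1 := fun o ho =>
        Finset.mem_toList.1 (hl.subset (List.mem_toFinset.1 ho))
      have hs' : (l'.toFinset, s.2) ∈ S := mem_of_le hS hs hsub le_rfl
      obtain ⟨ε, e⟩ := exists_smul_of_perm (l := l') (l' := l'.toFinset.toList)
        (List.toFinset_toList hnd).symm
      refine ⟨ε • gen hs', ?_⟩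
      rw [map_smul, monomialHom_gen, e, map_smul, smul_single]
    | zero => exact ⟨0, by rw [map_zero, single_zero]⟩
    | add x y _ _ hx hy =>
      obtain ⟨a, ha⟩ := hx
      obtain ⟨b, hb⟩ := hy
      exact ⟨a + b, by rw [map_add, ha, hb, single_add]⟩
    | smul z x _ hx =>
      obtain ⟨a, ha⟩ := hx
      exact ⟨z • a, by rw [map_smul, ha, smul_single]⟩
  | halg r =>
    refine ⟨0, ?_⟩
    rw [AlgHom.commutes, map_zero]
    change 0 = oddDeriv _ i (single 0 (algebraMap ℂ _ r))
    rw [oddDeriv_single]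
    erw [CliffordAlgebra.contractLeft_algebraMap]
    rw [neg_zero, single_zero]
  | hadd a b ha hb =>
    obtain ⟨a', ha⟩ := ha
    obtain ⟨b', hb⟩ := hb
    exact ⟨a' + b', by rw [map_add, map_add, map_add, ha, hb]⟩
  | hmul a b ha hb =>
    obtain ⟨a', ha⟩ := ha
    obtain ⟨b', hb⟩ := hb
    obtain ⟨a₀, h₀, a₁, h₁, rfl⟩ := exists_parts a
    -- The Leibniz sign depends on the parity of the first factor; passing from `a₀ + a₁` to `a₀ -
    -- a₁` encodes it.
    refine ⟨a' * b + (a₀ - a₁) * b', ?_⟩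
    have e₀ := oddDeriv_mul i ((monomialHom S k j).map_part 0 _ h₀)
      ((monomialHom S k j).toAlgHom b)
    have e₁ := oddDeriv_mul i ((monomialHom S k j).map_part 1 _ h₁)
      ((monomialHom S k j).toAlgHom b)
    change oddDeriv _ i ((monomialHom S k j).toAlgHom a₀ * _) =
      oddDeriv _ i ((monomialHom S k j).toAlgHom a₀) * _ +
      _ • ((monomialHom S k j).toAlgHom a₀ * _) at e₀
    change oddDeriv _ i ((monomialHom S k j).toAlgHom a₁ * _) =
      oddDeriv _ i ((monomialHom S k j).toAlgHom a₁) * _ +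
      _ • ((monomialHom S k j).toAlgHom a₁ * _) at e₁
    simp only [map_add, map_mul, map_sub, ha, hb, add_mul, e₀, e₁, sub_mul, ZMod.val_zero,
      ZMod.val_one, pow_zero, pow_one, one_smul, neg_smul]
    abel

end Lower

end LowerSet

/-! ### Fractions whose denominator is a power of a fixed even element -/

section Denominators

variable {A B : Type*} [Ring A] [Algebra ℂ A] [SuperCommAlgebra A]
  [Ring B] [Algebra ℂ B] [SuperCommAlgebra B]

/-- The elements of `B` of the form `a / fⁿ`, `a ∈ A`. -/
def fractionSubalgebra (φ : SuperHom A B) (f : evenSub A) : Subalgebra ℂ B where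
  carrier := {b | ∃ (n : ℕ) (a : A), φ.toAlgHom a = φ.toAlgHom f.1 ^ n * b}
  mul_mem' := by
    rintro b b' ⟨n, a, e⟩ ⟨n', a', e'⟩
    have hf : φ.toAlgHom f.1 ^ n' ∈ part B 0 := (φ.even f ^ n').2
    refine ⟨n + n', a * a', ?_⟩
    rw [map_mul, e, e', pow_add, mul_assoc, ← mul_assoc b, ← even_comm hf b]
    simp only [mul_assoc]
  add_mem' := by
    rintro b b' ⟨n, a, e⟩ ⟨n', a', e'⟩
    refine ⟨n + n', f.1 ^ n' * a + f.1 ^ n * a', ?_⟩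
    simp only [map_add, map_mul, map_pow, e, e', mul_add, ← mul_assoc, ← pow_add]
    rw [add_comm n' n]
  algebraMap_mem' r := ⟨0, algebraMap ℂ A r, by rw [AlgHom.commutes, pow_zero, one_mul]⟩

theorem map_mem_fractionSubalgebra (φ : SuperHom A B) (f : evenSub A) (a : A) :
    φ.toAlgHom a ∈ fractionSubalgebra φ f := ⟨0, a, by rw [pow_zero, one_mul]⟩

theorem mem_fractionSubalgebra_of_mul (φ : SuperHom A B) (f : evenSub A) {b : B} {a : A}
    (h : φ.toAlgHom f.1 * b = φ.toAlgHom a) : b ∈ fractionSubalgebra φ f :=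
  ⟨1, a, by rw [pow_one, h]⟩

end Denominators

/-! ### The Laurent superalgebra as a localization of the monomial superalgebra -/

section LowerSet

open AddMonoidAlgebra

variable {E O : Type} {S : Set (Finset O × (E → ℕ))} {p q : ℕ}
  {k : Fin p → Option E} {j : Fin q → O}

theorem gen_empty_mem {m : E → ℕ} (hm : (∅, m) ∈ S) :
    gen hm ∈ part (MonomialSuperalgebra S) 0 := by
  change monomial ∅ m ∈ polyPart _ _ 0
  rw [monomial, Finset.toList_empty, List.map_nil, List.prod_nil]
  exact single_mem_polyPart (Submodule.one_le.1 (CliffordAlgebra.one_le_evenOdd_zero _)) _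

/-- The product of the generators `x^m v` that bring in the even variables. -/
def denominator (hkS : ∀ x, x ∈ Set.range k ↔ (∅, baseExponent x) ∈ S) :
    evenSub (MonomialSuperalgebra S) :=
  ∏ i, ⟨gen ((hkS (k i)).1 ⟨i, rfl⟩), gen_empty_mem _⟩

theorem monomialHom_gen_empty {m : E → ℕ} (hm : (∅, m) ∈ S) :
    (monomialHom S k j).toAlgHom (gen hm) = single (exponents (m, 1) ∘ k) 1 := by
  rw [monomialHom_gen, Finset.toList_empty, List.map_nil, List.prod_nil, map_one]

theorem exponents_zero_comp (hk : Function.Injective k) {i : Fin p} (hi : k i = none) :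
    exponents (0, 1) ∘ k = Pi.single i 1 := by
  funext i'
  by_cases h : i' = i
  · subst h
    simp [exponents, hi]
  · rw [Pi.single_eq_of_ne h]
    obtain ⟨e, he⟩ := Option.ne_none_iff_exists'.1 fun h' => h (hk (h'.trans hi.symm))
    simp [exponents, he]

/-- The generator x_e v has the exponent of x_e plus that of v; dividing by v will isolate x_e. -/
theorem exponents_base_comp (hk : Function.Injective k) {i : Fin p} {e : E} (hi : k i = some e) :
    exponents (baseExponent (k i), 1) ∘ k = Pi.single i 1 + exponents (0, 1) ∘ k := by
  classical
  funext i'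
  by_cases h : i' = i
  · subst h
    simp [exponents, hi, baseExponent]
  · rw [Pi.add_apply, Pi.single_eq_of_ne h, zero_add]
    cases hi' : k i' with
    | none => simp [exponents, hi']
    | some e' =>
      have hne : e' ≠ e := fun he => h (hk (by rw [hi', hi, he]))
      simp [exponents, hi, hi', baseExponent, hne]

/-- The fractions form a subalgebra `D`, so it is enough to find the Laurent variables, their
inverses and the odd variables in it. Each even generator x_e v, and v itself, is a factor of the
denominator and so is invertible in `D`; dividing by v gives x_e and ξ_o. -/
theorem isPrincipalLocalization_monomialHom (hS : IsLowerSet S) (hk : Function.Injective k)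
    (hj : Function.Injective j) (hkS : ∀ x, x ∈ Set.range k ↔ (∅, baseExponent x) ∈ S)
    (hjS : ∀ o, o ∈ Set.range j ↔ ({o}, 0) ∈ S) :
    IsPrincipalLocalization (monomialHom S k j) (denominator hkS) := by
  classical
  let φ := monomialHom S k j
  let w (i : Fin p) : Fin p → ℤ := exponents (baseExponent (k i), 1) ∘ k
  let c (i : Fin p) : evenSub (MonomialSuperalgebra S) :=
    ⟨gen ((hkS (k i)).1 ⟨i, rfl⟩), gen_empty_mem _⟩
  have hc : ∀ i, φ.toAlgHom (c i).1 = single (w i) 1 := fun i =>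
    monomialHom_gen_empty ((hkS (k i)).1 ⟨i, rfl⟩)
  have hinv : ∀ v : Fin p → ℤ, (single v 1 : SuperPoly (Fin p → ℤ) (Fin q)) * single (-v) 1 = 1 :=
    fun v => by rw [single_mul_single, add_neg_cancel, one_mul]; rfl
  have hunit : IsUnit (φ.even (denominator hkS)) := by
    have hci : ∀ i, IsUnit (φ.even (c i)) := fun i =>
      IsUnit.of_mul_eq_one ⟨single (-(w i)) 1, single_mem_polyPart
        (Submodule.one_le.1 (CliffordAlgebra.one_le_evenOdd_zero _)) _⟩ (Subtype.ext (by
          change φ.toAlgHom (c i).1 * single (-(w i)) 1 = 1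
          rw [hc, hinv]))
    rw [denominator, map_prod]
    exact IsUnit.prod_iff.2 fun i _ => hci i
  let D := fractionSubalgebra φ (denominator hkS)
  have hw : ∀ i, single (w i) 1 ∈ D ∧ single (-(w i)) 1 ∈ D := by
    intro i
    refine ⟨hc i ▸ map_mem_fractionSubalgebra φ _ _, ?_⟩
    -- The inverse of the `i`-th factor is the product of the other factors divided by the
    -- denominator.
    refine mem_fractionSubalgebra_of_mul φ _
      (a := (∏ i' ∈ Finset.univ.erase i, c i' : evenSub (MonomialSuperalgebra S)).1) ?_
    have e : denominator hkS = (∏ i' ∈ Finset.univ.erase i, c i') * c i :=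
      (Finset.prod_erase_mul _ _ (Finset.mem_univ i)).symm
    rw [e]
    change φ.toAlgHom (_ * _) * _ = _
    rw [map_mul, hc, mul_assoc, hinv, mul_one]
  -- The exponents whose monomial lies in `D` together with its inverse. It contains every unit
  -- vector and hence is everything.
  let H : AddSubgroup (Fin p → ℤ) :=
    { carrier := {v | (single v 1 : SuperPoly (Fin p → ℤ) (Fin q)) ∈ D ∧
        (single (-v) 1 : SuperPoly (Fin p → ℤ) (Fin q)) ∈ D}
      zero_mem' := ⟨D.one_mem, by rw [neg_zero]; exact D.one_mem⟩
      add_mem' := by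
        rintro v v' ⟨h₁, h₂⟩ ⟨h₁', h₂'⟩
        refine ⟨?_, ?_⟩
        · have := D.mul_mem h₁ h₁'
          rwa [single_mul_single, one_mul] at this
        · have := D.mul_mem h₂ h₂'
          rwa [single_mul_single, one_mul, ← neg_add] at this
      neg_mem' := by
        rintro v ⟨h₁, h₂⟩
        exact ⟨h₂, by rwa [neg_neg]⟩ }
  have hwH : ∀ i, w i ∈ H := hw
  have hzero : ∀ {s : Finset O × (E → ℕ)}, s ∈ S → exponents (0, 1) ∘ k ∈ H := by
    intro s hs
    have h0 : ((∅ : Finset O), baseExponent (none : Option E)) ∈ S :=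
      mem_of_le hS hs (Finset.empty_subset _) fun e => Nat.zero_le _
    obtain ⟨i, hi⟩ := (hkS none).2 h0
    have := hwH i
    simp only [w, hi] at this
    exact this
  have hsingle : ∀ i, Pi.single i (1 : ℤ) ∈ H := by
    intro i
    have hi : (∅, baseExponent (k i)) ∈ S := (hkS (k i)).1 ⟨i, rfl⟩
    cases h : k i with
    | none => rw [← exponents_zero_comp hk h]; exact hzero hi
    | some e =>
      have := H.sub_mem (hwH i) (hzero hi)
      simp only [w] at this
      rwa [exponents_base_comp hk h, add_sub_cancel_right] at this
  have hH : ∀ v, v ∈ H := by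
    intro v
    rw [← Finset.univ_sum_single v]
    refine H.sum_mem fun i _ => ?_
    have e : (Pi.single i (v i) : Fin p → ℤ) = v i • Pi.single i (1 : ℤ) := by
      rw [← Pi.single_smul, smul_eq_mul, mul_one]
    rw [e]
    exact H.zsmul_mem (hsingle i) _
  have hxi : ∀ i : Fin q, (single 0 (xi i) : SuperPoly (Fin p → ℤ) (Fin q)) ∈ D := by
    intro i
    have hi : (({j i} : Finset O), (0 : E → ℕ)) ∈ S := (hjS (j i)).1 ⟨i, rfl⟩
    have h₁ : φ.toAlgHom (gen hi) = single (exponents (0, 1) ∘ k) (xi i) := by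
      refine (monomialHom_gen S k j hi).trans ?_
      congr 1
      rw [Finset.toList_singleton, List.map_singleton, List.prod_singleton, xi_eq,
        ExteriorAlgebra.map_apply_ι, xi_eq]
      congr 1
      funext i'
      simp [LinearMap.funLeft_apply, Pi.single_apply, hj.eq_iff]
    have := D.mul_mem (map_mem_fractionSubalgebra φ _ (gen hi)) (hH (-(exponents (0, 1) ∘ k))).1
    rwa [h₁, single_mul_single, add_neg_cancel, mul_one] at this
  have hext : ∀ x : ExteriorAlgebra ℂ (Fin q → ℂ),
      (single 0 x : SuperPoly (Fin p → ℤ) (Fin q)) ∈ D := by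
    intro x
    induction x using ExteriorAlgebra.induction with
    | algebraMap r => exact D.algebraMap_mem r
    | ι v =>
      have e : ExteriorAlgebra.ι ℂ v = ∑ i, v i • xi i := by
        conv_lhs => rw [← Finset.univ_sum_single v, map_sum]
        refine Finset.sum_congr rfl fun i _ => ?_
        rw [xi_eq, ← map_smul, ← Pi.single_smul, smul_eq_mul, mul_one]
      rw [e, ← lsingle_apply (R := ℂ), map_sum]
      refine D.sum_mem fun i _ => ?_
      rw [map_smul, lsingle_apply]
      exact D.smul_mem (hxi i) _
    | mul a b ha hb =>
      have := D.mul_mem ha hb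
      rwa [single_mul_single, add_zero] at this
    | add a b ha hb => rw [single_add]; exact D.add_mem ha hb
  refine ⟨monomialHom_injective hS hk hj hkS hjS, ?_, fun b => ?_⟩
  · exact hunit.map (evenSub (SuperPoly (Fin p → ℤ) (Fin q))).val
  · change b ∈ D
    induction b using AddMonoidAlgebra.induction_linear with
    | zero => exact D.zero_mem
    | add f g hf hg => exact D.add_mem hf hg
    | single v x =>
      have := D.mul_mem (hH v).1 (hext x)
      rwa [single_mul_single, one_mul, add_zero] at this

/-- The monomial superalgebra of a finite lower set of monomials defines a toric supervariety. -/
theorem isFaithfulToricSupervariety_of_isLowerSet (hS : IsLowerSet S) [Finite E] [Finite O]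
    (hfin : S.Finite) :
    IsFaithfulToricSupervariety (MonomialSuperalgebra S) := by
  classical
  -- The even and odd variables that occur in `S`. Only these become coordinates of the supertorus,
  -- since a label of λ may vanish and force some coordinates of the polytope to be zero.
  let V : Set (Option E) := {x | (∅, baseExponent x) ∈ S}
  let W : Set O := {o | ({o}, 0) ∈ S}
  let k : Fin (Nat.card V) → Option E := fun i => ((Finite.equivFin V).symm i).1
  let j : Fin (Nat.card W) → O := fun i => ((Finite.equivFin W).symm i).1
  have hk : Function.Injective k := Subtype.val_injective.comp (Finite.equivFin V).symm.injective
  have hj : Function.Injective j := Subtype.val_injective.comp (Finite.equivFin W).symm.injective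
  have hkS : ∀ x, x ∈ Set.range k ↔ (∅, baseExponent x) ∈ S := fun x =>
    ⟨by rintro ⟨i, rfl⟩; exact ((Finite.equivFin V).symm i).2,
      fun hx => ⟨Finite.equivFin V ⟨x, hx⟩,
        congrArg Subtype.val ((Finite.equivFin V).symm_apply_apply ⟨x, hx⟩)⟩⟩
  have hjS : ∀ o, o ∈ Set.range j ↔ ({o}, 0) ∈ S := fun o =>
    ⟨by rintro ⟨i, rfl⟩; exact ((Finite.equivFin W).symm i).2,
      fun ho => ⟨Finite.equivFin W ⟨o, ho⟩,
        congrArg Subtype.val ((Finite.equivFin W).symm_apply_apply ⟨o, ho⟩)⟩⟩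
  have hft : Algebra.FiniteType ℂ (MonomialSuperalgebra S) := by
    rw [← Subalgebra.fg_iff_finiteType, Subalgebra.fg_def]
    refine ⟨_, ?_, rfl⟩
    have : generators S = (fun s => monomial s.1 s.2) '' S := by
      ext f
      exact ⟨fun ⟨s, hs, e⟩ => ⟨s, hs, e.symm⟩, fun ⟨s, hs, e⟩ => ⟨s, hs, e.symm⟩⟩
    rw [this]
    exact hfin.image _
  exact isFaithfulToricSupervariety_of_isPrincipalLocalization
    ⟨Nat.card V, Nat.card W, 0, fun _ _ => rfl⟩ rfl (monomialHom S k j)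
    (isPrincipalLocalization_monomialHom hS hk hj hkS hjS) mem_span_weight
    (exists_oddDeriv hS) hft

end LowerSet

/-! ### Dyck paths -/

section DyckPaths

/-- Two paths joined at `x` make one path through `x`; this puts a given root on an admissible Dyck
path. -/
theorem exists_isChain_of_reflTransGen {α : Type*} {r : α → α → Prop} {a x b : α}
    (hax : Relation.ReflTransGen r a x) (hxb : Relation.ReflTransGen r x b) :
    ∃ l : List α, l.IsChain r ∧ l.head? = some a ∧ l.getLast? = some b ∧ x ∈ l := by
  have happend : ∀ {l : List α} {b c : α}, l.IsChain r → l.head? = some a → l.getLast? = some b →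
      r b c → (l ++ [c]).IsChain r ∧ (l ++ [c]).head? = some a ∧ (l ++ [c]).getLast? = some c := by
    intro l b c hl ha hb hbc
    refine ⟨List.isChain_append.2 ⟨hl, List.isChain_singleton c, ?_⟩, by simp [ha], by simp⟩
    intro u hu v hv
    rw [hb, Option.mem_some_iff] at hu
    rw [List.head?_cons, Option.mem_some_iff] at hv
    exact hu ▸ hv ▸ hbc
  induction hxb with
  | refl =>
    induction hax with
    | refl => exact ⟨[a], List.isChain_singleton a, rfl, rfl, List.mem_singleton_self a⟩
    | tail _ h ih =>
      obtain ⟨l, hl, ha, hb, -⟩ := ih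
      obtain ⟨h₁, h₂, h₃⟩ := happend hl ha hb h
      exact ⟨_, h₁, h₂, h₃, by simp⟩
  | tail _ h ih =>
    obtain ⟨l, hl, ha, hb, hx⟩ := ih
    obtain ⟨h₁, h₂, h₃⟩ := happend hl ha hb h
    exact ⟨_, h₁, h₂, h₃, List.mem_append_left _ hx⟩

theorem ARoot.reflTransGen_right {r : ℕ} (d : ℕ) (x y : ARoot r) (h₁ : y.1.1 = x.1.1)
    (h₂ : y.1.2 = x.1.2 + d) :
    Relation.ReflTransGen (fun x y : ARoot r => DyckStep x.1 y.1) x y := by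
  induction d generalizing y with
  | zero => rw [show y = x from Subtype.ext (Prod.ext h₁ h₂)]
  | succ d ih =>
    have hx := x.2
    have hy := y.2
    exact (ih ⟨(x.1.1, x.1.2 + d), by dsimp only; omega⟩ rfl rfl).tail
      (Or.inl (Prod.ext h₁ h₂))

theorem ARoot.reflTransGen_down {r : ℕ} (d : ℕ) (x y : ARoot r) (h₁ : y.1.1 = x.1.1 + d)
    (h₂ : y.1.2 = x.1.2) :
    Relation.ReflTransGen (fun x y : ARoot r => DyckStep x.1 y.1) x y := by
  induction d generalizing y with
  | zero => rw [show y = x from Subtype.ext (Prod.ext h₁ h₂)]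
  | succ d ih =>
    have hx := x.2
    have hy := y.2
    exact (ih ⟨(x.1.1 + d, x.1.2), by dsimp only; omega⟩ rfl rfl).tail
      (Or.inr (Prod.ext h₁ h₂))

theorem CRoot.reflTransGen_right {n : ℕ} (d : ℕ) (x y : CRoot n) (h₁ : y.1.1 = x.1.1)
    (h₂ : y.1.2 = x.1.2 + d) :
    Relation.ReflTransGen (fun x y : CRoot n => DyckStep x.1 y.1) x y := by
  induction d generalizing y with
  | zero => rw [show y = x from Subtype.ext (Prod.ext h₁ h₂)]
  | succ d ih =>
    have hx := x.2
    have hy := y.2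
    exact (ih ⟨(x.1.1, x.1.2 + d), by dsimp only; omega⟩ rfl rfl).tail
      (Or.inl (Prod.ext h₁ h₂))

/-- The path goes from α_i right to α_{i,j} and then down to α_j. All its coordinates are
nonnegative, so each one is at most the sum. -/
theorem DyckA.le {r : ℕ} {m : ℕ → ℝ} {s : ARoot r → ℝ} (h : DyckA m s) (hs : ∀ x, 0 ≤ s x)
    (x : ARoot r) : s x ≤ ∑ k ∈ Finset.Icc x.1.1 x.1.2, m k := by
  have hx := x.2
  let a : ARoot r := ⟨(x.1.1, x.1.1), by dsimp only; omega⟩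
  let b : ARoot r := ⟨(x.1.2, x.1.2), by dsimp only; omega⟩
  obtain ⟨l, hl, ha, hb, hxl⟩ := exists_isChain_of_reflTransGen
    (ARoot.reflTransGen_right (x.1.2 - x.1.1) a x rfl (by change x.1.2 = x.1.1 + _; omega))
    (ARoot.reflTransGen_down (x.1.2 - x.1.1) x b (by change x.1.2 = x.1.1 + _; omega) rfl)
  refine le_trans (List.single_le_sum ?_ _ (List.mem_map_of_mem hxl)) (h l a b hl ha hb rfl rfl)
  rintro _ hz
  obtain ⟨z, -, rfl⟩ := List.mem_map.1 hz
  exact hs z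

theorem DyckC.le {n : ℕ} {m : ℕ → ℝ} {s : CRoot n → ℝ} {t : ℕ → ℝ} (h : DyckC m s t)
    (hs : ∀ x, 0 ≤ s x) (ht : ∀ j, 0 ≤ t j) (x : CRoot n) :
    s x ≤ ∑ k ∈ Finset.Icc x.1.1 (n - 1), m k := by
  have hx := x.2
  let a : CRoot n := ⟨(x.1.1, x.1.1), by dsimp only; omega⟩
  -- The long root 2δ_i in the row of `x`. The path that stays in this row passes through `x`, so
  -- steps to the right suffice.
  let b : CRoot n := ⟨(x.1.1, 2 * n - 2 - x.1.1), by dsimp only; omega⟩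
  obtain ⟨l, hl, ha, hb, hxl⟩ := exists_isChain_of_reflTransGen
    (CRoot.reflTransGen_right (x.1.2 - x.1.1) a x rfl (by change x.1.2 = x.1.1 + _; omega))
    (CRoot.reflTransGen_right (2 * n - 2 - x.1.1 - x.1.2) x b rfl
      (by change 2 * n - 2 - x.1.1 = _; omega))
  have hb' : b.1.1 + b.1.2 + 2 = 2 * n := by
    change x.1.1 + (2 * n - 2 - x.1.1) + 2 = 2 * n
    omega
  have hle := (h l a b hl ha hb rfl).2 hb'
  have hsum : s x ≤ (l.map s).sum := by
    refine List.single_le_sum ?_ _ (List.mem_map_of_mem hxl)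
    rintro _ hz
    obtain ⟨z, -, rfl⟩ := List.mem_map.1 hz
    exact hs z
  exact le_trans (le_trans hsum (le_add_of_nonneg_right (ht _))) hle

theorem DyckA.anti {r : ℕ} {m : ℕ → ℝ} {s s' : ARoot r → ℝ} (h : DyckA m s) (hs : s' ≤ s) :
    DyckA m s' := fun l a b hl ha hb h₁ h₂ =>
  (List.sum_le_sum fun x _ => hs x).trans (h l a b hl ha hb h₁ h₂)

theorem DyckC.anti {n : ℕ} {m : ℕ → ℝ} {s s' : CRoot n → ℝ} {t t' : ℕ → ℝ} (h : DyckC m s t)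
    (hs : s' ≤ s) (ht : t' ≤ t) : DyckC m s' t' := fun l a b hl ha hb h₁ =>
  ⟨fun h₂ => (List.sum_le_sum fun x _ => hs x).trans ((h l a b hl ha hb h₁).1 h₂),
    fun h₂ => (add_le_add (List.sum_le_sum fun x _ => hs x) (ht _)).trans
      ((h l a b hl ha hb h₁).2 h₂)⟩

end DyckPaths

/-! ### The lattice points of the polytopes -/

theorem IneqB3.anti {m₁ m₂ m₃ : ℝ} {s s' : B3Root → ℝ} (h : IneqB3 m₁ m₂ m₃ s) (hs : s' ≤ s) :
    IneqB3 m₁ m₂ m₃ s' := by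
  have h11 := hs .r11
  have h12 := hs .r12
  have h13 := hs .r13
  have h22 := hs .r22
  have h23 := hs .r23
  have h33 := hs .r33
  have k23 := hs .u23
  have k13 := hs .u13
  have k12 := hs .u12
  simp only [IneqB3] at h ⊢
  refine h.imp ?_ (And.imp ?_ (And.imp ?_ (And.imp ?_ (And.imp ?_ (And.imp ?_ (And.imp ?_
    (And.imp ?_ (And.imp ?_ (And.imp ?_ (And.imp ?_ (And.imp ?_ (And.imp ?_ (And.imp ?_
    (And.imp ?_ (And.imp ?_ (And.imp ?_ (And.imp ?_ (And.imp ?_ ?_))))))))))))))))))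
  -- Every coordinate enters with a nonnegative coefficient, so lowering the coordinates lowers each
  -- left-hand side.
  all_goals exact fun h => le_trans (by gcongr) h

theorem IneqB3.exists_le (m₁ m₂ m₃ : ℝ) (r : B3Root) :
    ∃ b : ℝ, ∀ s : B3Root → ℝ, (∀ r, 0 ≤ s r) → IneqB3 m₁ m₂ m₃ s → s r ≤ b := by
  refine ⟨|m₁| + 3 * |m₂| + 2 * |m₃|, fun s hs h => ?_⟩
  have h11 := hs .r11
  have h12 := hs .r12
  have h13 := hs .r13
  have h22 := hs .r22
  have h23 := hs .r23
  have h33 := hs .r33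
  have k23 := hs .u23
  have k13 := hs .u13
  have k12 := hs .u12
  have a₁ := le_abs_self m₁
  have a₂ := le_abs_self m₂
  have a₃ := le_abs_self m₃
  have b₁ := abs_nonneg m₁
  have b₂ := abs_nonneg m₂
  have b₃ := abs_nonneg m₃
  simp only [IneqB3] at h
  obtain ⟨-, -, -, -, -, -, -, -, -, -, -, -, -, -, -, -, -, -, h₁, h₂⟩ := h
  cases r <;> linarith

theorem IneqG2.anti {m₁ m₂ : ℝ} {s s' : G2Root → ℝ} (h : IneqG2 m₁ m₂ s) (hs : s' ≤ s) :
    IneqG2 m₁ m₂ s' := by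
  have h10 := hs .r10
  have h01 := hs .r01
  have h11 := hs .r11
  have h21 := hs .r21
  have h31 := hs .r31
  have h32 := hs .r32
  refine h.imp ?_ (And.imp ?_ (And.imp ?_ (And.imp ?_ (And.imp ?_ (And.imp ?_ ?_)))))
  all_goals exact fun h => le_trans (by gcongr) h

theorem IneqG2.exists_le (m₁ m₂ : ℝ) (r : G2Root) :
    ∃ b : ℝ, ∀ s : G2Root → ℝ, (∀ r, 0 ≤ s r) → IneqG2 m₁ m₂ s → s r ≤ b := by
  -- Again the last two inequalities together involve all six coordinates.
  refine ⟨|m₁| + 2 * |m₂|, fun s hs h => ?_⟩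
  have h10 := hs .r10
  have h01 := hs .r01
  have h11 := hs .r11
  have h21 := hs .r21
  have h31 := hs .r31
  have h32 := hs .r32
  have a₁ := le_abs_self m₁
  have a₂ := le_abs_self m₂
  have b₁ := abs_nonneg m₁
  have b₂ := abs_nonneg m₂
  obtain ⟨-, -, -, -, -, h₁, h₂⟩ := h
  cases r <;> linarith

instance ARoot.finite (r : ℕ) : Finite (ARoot r) :=
  (((Set.finite_Iio r).prod (Set.finite_Iio r)).subset fun _ hx =>
    ⟨lt_of_le_of_lt hx.1 hx.2, hx.2⟩ : {x : ℕ × ℕ | x.1 ≤ x.2 ∧ x.2 < r}.Finite)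

instance CRoot.finite (n : ℕ) : Finite (CRoot n) :=
  (((Set.finite_Iio (2 * n)).prod (Set.finite_Iio (2 * n))).subset fun x hx =>
    ⟨by have := hx.2; simp only [Set.mem_Iio]; omega,
      by have := hx.2; simp only [Set.mem_Iio]; omega⟩ :
    {x : ℕ × ℕ | x.1 ≤ x.2 ∧ x.1 + x.2 + 2 ≤ 2 * n}.Finite)

instance B3Root.finite : Finite B3Root :=
  Finite.of_surjective (fun i : Fin 9 =>
    ![B3Root.r11, .r12, .r13, .r22, .r23, .r33, .u23, .u13, .u12] i) fun r => by
    cases r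
    exacts [⟨0, rfl⟩, ⟨1, rfl⟩, ⟨2, rfl⟩, ⟨3, rfl⟩, ⟨4, rfl⟩, ⟨5, rfl⟩, ⟨6, rfl⟩, ⟨7, rfl⟩, ⟨8, rfl⟩]

instance G2Root.finite : Finite G2Root :=
  Finite.of_surjective (fun i : Fin 6 =>
    ![G2Root.r10, .r01, .r11, .r21, .r31, .r32] i) fun r => by
    cases r
    exacts [⟨0, rfl⟩, ⟨1, rfl⟩, ⟨2, rfl⟩, ⟨3, rfl⟩, ⟨4, rfl⟩, ⟨5, rfl⟩]

theorem dite_fin_le_dite_fin {n : ℕ} {y y' : Fin n → ℝ} (h : ∀ i, y' i ≤ y i) (j : ℕ) :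
    (if hj : j < n then y' ⟨j, hj⟩ else 0) ≤ if hj : j < n then y ⟨j, hj⟩ else 0 := by
  split_ifs with hj
  exacts [h _, le_rfl]

theorem dite_fin_nonneg {n : ℕ} {y : Fin n → ℝ} (h : ∀ i, 0 ≤ y i) (j : ℕ) :
    0 ≤ if hj : j < n then y ⟨j, hj⟩ else 0 := by
  split_ifs with hj
  exacts [h _, le_rfl]

namespace KFType

instance finite_evenRoot : (τ : KFType) → Finite τ.EvenRoot
  | A m n => inferInstanceAs (Finite (ARoot (m - 1) ⊕ ARoot (n - 1)))
  | C n => inferInstanceAs (Finite (CRoot n))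
  | B n => inferInstanceAs (Finite (CRoot n))
  | D21 _ => inferInstanceAs (Finite (Fin 3))
  | F4 => inferInstanceAs (Finite (Option B3Root))
  | G3 => inferInstanceAs (Finite (Option G2Root))

instance finite_oddRoot : (τ : KFType) → Finite τ.OddRoot
  | A m n => inferInstanceAs (Finite (Fin m × Fin n))
  | C n => inferInstanceAs (Finite (Fin n × Bool))
  | B n => inferInstanceAs (Finite (Fin n))
  | D21 _ => inferInstanceAs (Finite (Bool × Bool))
  | F4 => inferInstanceAs (Finite (Bool × Bool × Bool))
  | G3 => inferInstanceAs (Finite (Option (Fin 3 × Bool)))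

theorem weightIneq_anti : (τ : KFType) → (a : Fin τ.rank → ℂ) → {x x' : τ.EvenRoot → ℝ} →
    {y y' : τ.OddRoot → ℝ} → τ.WeightIneq a x y → x' ≤ x → y' ≤ y → τ.WeightIneq a x' y'
  | A _ _, _, _, _, _, _, h, hx, _ =>
    ⟨h.1.anti fun r => hx (Sum.inl r), h.2.anti fun r => hx (Sum.inr r)⟩
  | C _, _, _, _, _, _, h, hx, _ => DyckC.anti h hx le_rfl
  | B n, a, x, _, y, _, h, hx, hy =>
    DyckC.anti (n := n) (m := fun k => if k + 1 = n then lab a k / 2 else lab a k) (s := x)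
      (t := fun j => if hj : j < n then y (⟨j, hj⟩ : Fin n) else 0) h hx (dite_fin_le_dite_fin hy)
  | D21 _, _, _, _, _, _, h, hx, hy =>
    ⟨(hx (1 : Fin 3)).trans h.1, (hx (2 : Fin 3)).trans h.2.1,
      (add_le_add (hx (0 : Fin 3)) (Finset.sum_le_sum fun o _ => hy o)).trans h.2.2⟩
  | F4, _, _, _, _, _, h, hx, hy =>
    ⟨h.1.anti fun r => hx (some r),
      (add_le_add (hx (none : Option B3Root)) (Finset.sum_le_sum fun o _ => hy o)).trans h.2⟩
  | G3, _, _, _, _, _, h, hx, hy =>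
    ⟨h.1.anti fun r => hx (some r),
      (add_le_add (hx (none : Option G2Root)) (Finset.sum_le_sum fun o _ => hy o)).trans h.2⟩

/-- Every coordinate is bounded on the polytope. -/
theorem exists_forall_weightIneq_le (τ : KFType) (a : Fin τ.rank → ℂ) (r : τ.EvenRoot) :
    ∃ b : ℝ, ∀ (x : τ.EvenRoot → ℝ) (y : τ.OddRoot → ℝ), (∀ r, 0 ≤ x r) → (∀ o, 0 ≤ y o) →
      τ.WeightIneq a x y → x r ≤ b := by
  cases τ with
  | A m n =>
    rcases r with r | r
    · exact ⟨_, fun x y hx _ h => h.1.le (fun r => hx (Sum.inl r)) r⟩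
    · exact ⟨_, fun x y hx _ h => h.2.le (fun r => hx (Sum.inr r)) r⟩
  | C n => exact ⟨_, fun x y hx _ h => DyckC.le h hx (fun _ => le_rfl) r⟩
  | B n =>
    refine ⟨_, fun x y hx hy h => DyckC.le (n := n)
      (m := fun k => if k + 1 = n then lab a k / 2 else lab a k)
      (t := fun j => if hj : j < n then y (⟨j, hj⟩ : Fin n) else 0) h hx (dite_fin_nonneg hy) r⟩
  | D21 α =>
    change Fin 3 at r
    refine ⟨max (corootValue (D21 α) a ![2, 1, 1]) (max (lab a 1) (lab a 2)),
      fun x y _ hy h => ?_⟩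
    obtain ⟨h₁, h₂, h₀⟩ := h
    have hsum : 0 ≤ ∑ o : Bool × Bool, y o := Finset.sum_nonneg fun o _ => hy o
    fin_cases r
    · exact le_max_of_le_left ((le_add_of_nonneg_right hsum).trans h₀)
    · exact le_max_of_le_right (le_max_of_le_left h₁)
    · exact le_max_of_le_right (le_max_of_le_right h₂)
  | F4 =>
    change Option B3Root at r
    cases r with
    | none =>
      refine ⟨_, fun x y _ hy h => le_trans ?_ h.2⟩
      exact le_add_of_nonneg_right (Finset.sum_nonneg fun o _ => hy o)
    | some r =>
      obtain ⟨b, hb⟩ := IneqB3.exists_le (lab a 3) (lab a 2) (lab a 1) r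
      exact ⟨b, fun x y hx _ h => hb _ (fun r => hx (some r)) h.1⟩
  | G3 =>
    change Option G2Root at r
    cases r with
    | none =>
      refine ⟨_, fun x y _ hy h => le_trans ?_ h.2⟩
      exact le_add_of_nonneg_right (Finset.sum_nonneg fun o _ => hy o)
    | some r =>
      obtain ⟨b, hb⟩ := IneqG2.exists_le (lab a 1) (lab a 2) r
      exact ⟨b, fun x y hx _ h => hb _ (fun r => hx (some r)) h.1⟩

/-- Shrinking `I` lowers its indicator function, and the weight inequalities are inherited by
smaller points. -/
theorem isLowerSet_latticePoints (τ : KFType) (a : Fin τ.rank → ℂ) :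
    IsLowerSet (τ.latticePoints a) := by
  classical
  rintro ⟨I, m⟩ ⟨I', m'⟩ hle ⟨h₀, h₁, h⟩
  obtain ⟨hI, hm⟩ : I' ⊆ I ∧ m' ≤ m := hle
  refine ⟨?_, ?_, weightIneq_anti τ a h ?_ ?_⟩
  · rintro (r | o)
    · exact Nat.cast_nonneg _
    · exact Set.indicator_nonneg (fun _ _ => zero_le_one) o
  · intro o
    exact Set.indicator_le_self' (fun _ _ => zero_le_one) o
  · intro r
    exact Nat.cast_le.2 (hm r)
  · intro o
    exact Set.indicator_le_indicator_of_subset (Finset.coe_subset.2 hI)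
      (fun _ => zero_le_one) o

theorem finite_latticePoints (τ : KFType) (a : Fin τ.rank → ℂ) : (τ.latticePoints a).Finite := by
  classical
  choose b hb using exists_forall_weightIneq_le τ a
  have := Fintype.ofFinite τ.EvenRoot
  -- Only the even exponents need a bound; there are finitely many sets of odd roots.
  refine (Set.finite_univ.prod (Set.Finite.pi' fun r => Set.finite_Iic ⌊b r⌋₊)).subset ?_
  rintro ⟨I, m⟩ ⟨h₀, -, h⟩
  refine ⟨trivial, fun r => Nat.le_floor ?_⟩
  exact hb r _ _ (fun r => h₀ (Sum.inl r)) (fun o => h₀ (Sum.inr o)) h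

end KFType

end SuperToric
end

theorem mainTheorem2 (τ : SuperToric.KFType) (hτ : τ.Valid)
    {g : Type*} [AddCommGroup g] [Module ℂ g] [FiniteDimensional ℂ g]
    (L : SuperToric.LieSuperalgebra g) (hL : L.IsSimple)
    (R : SuperToric.ChevalleyGenerators τ L)
    (lam : Module.Dual ℂ R.cartan) (hdom : R.IsDominantIntegral lam)
    (htyp : ∀ k : ℕ, 1 ≤ k → R.IsTypical ((k : ℂ) • lam)) :
    SuperToric.IsFaithfulToricSupervariety
      (SuperToric.MonomialSuperalgebra (τ.latticePoints (R.labels lam))) :=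
  SuperToric.isFaithfulToricSupervariety_of_isLowerSet
    (SuperToric.KFType.isLowerSet_latticePoints τ (R.labels lam))
    (SuperToric.KFType.finite_latticePoints τ (R.labels lam))
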